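/- Let $n\ge 1$ and let $O_n$ be the orthogonal group of Euclidean space $\mathbb R^n$. A reflection (respectively, a rotation) is an element of $O_n$ whose fixed point subspace has codimension one (respectively, two). A reflection group (respectively, a rotation group) in $O_n$ is a finite subgroup of $O_n$ generated by reflections (respectively, by rotations); for a subgroup $G<O_n$ put $G^+=G\cap SO_n$, its orientation preserving subgroup. Let $W<O_n$ be a reflection group acting irreducibly on $\mathbb R^n$. Then the following are equivalent: (a) there exists a rotation $h\in SO_n\setminus W$ that normalizes $W$ and $W^+$ and is such that $W^*=\langle W^+,h\rangle$ is a rotation group which is not the orientation preserving subgroup of any reflection group in $O_n$; (b) $W$ has type $A_4$, $D_4$, $F_4$, $A_5$ or $E_6$. Moreover, in this case the group $W^*$ is unique, that is, the subgroup $\langle W^+,h\rangle$ of $O_n$ is the same for all $h$ as in (a). Here $W$ is said to have the type given by a Coxeter matrix $(m_{ij})$ if $W$ is generated by the reflections in the hyperplanes $\alpha_i^{\perp}$ for a basis $(\alpha_i)$ of $\mathbb R^n$ consisting of unit vectors with $\langle\alpha_i,\alpha_j\rangle=-\cos(\pi/m_{ij})$ for all $i,j$. -/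

import Mathlib

/-- The orthogonal group `O_n`, as the group of linear isometries of Euclidean `n`-space. -/
abbrev OrthGroup (n : ℕ) : Type :=
  EuclideanSpace ℝ (Fin n) ≃ₗᵢ[ℝ] EuclideanSpace ℝ (Fin n)

/-- The special orthogonal group `SO_n`: the orthogonal transformations of determinant one. -/
noncomputable def SOGroup (n : ℕ) : Subgroup (OrthGroup n) where
  carrier := {g | LinearMap.det
    (g.toLinearEquiv : EuclideanSpace ℝ (Fin n) →ₗ[ℝ] EuclideanSpace ℝ (Fin n)) = 1}
  one_mem' := LinearMap.det_id
  mul_mem' := by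
    intro a b ha hb
    change LinearMap.det ((a.toLinearEquiv : EuclideanSpace ℝ (Fin n) →ₗ[ℝ] _) ∘ₗ
      (b.toLinearEquiv : EuclideanSpace ℝ (Fin n) →ₗ[ℝ] _)) = 1
    rw [LinearMap.det_comp]
    rw [Set.mem_ofPred_eq] at ha hb
    rw [ha, hb, one_mul]
  inv_mem' := by
    intro a ha
    rw [Set.mem_ofPred_eq] at ha
    have h : LinearMap.det (a.toLinearEquiv.symm : EuclideanSpace ℝ (Fin n) →ₗ[ℝ] _) *
        LinearMap.det (a.toLinearEquiv : EuclideanSpace ℝ (Fin n) →ₗ[ℝ] _) = 1 :=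
      LinearEquiv.det_symm_mul_det a.toLinearEquiv
    rw [ha, mul_one] at h
    exact h

/-- The fixed point subspace of an orthogonal transformation. -/
noncomputable def fixedSpace {n : ℕ} (g : OrthGroup n) : Submodule ℝ (EuclideanSpace ℝ (Fin n)) :=
  LinearMap.eqLocus
    (g.toLinearEquiv : EuclideanSpace ℝ (Fin n) →ₗ[ℝ] EuclideanSpace ℝ (Fin n)) LinearMap.id

/-- A reflection: an orthogonal transformation whose fixed point subspace has codimension one. -/
def IsReflection {n : ℕ} (g : OrthGroup n) : Prop :=
  Module.finrank ℝ (fixedSpace g) + 1 = n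

/-- A rotation: an orthogonal transformation whose fixed point subspace has codimension two. -/
def IsRotation {n : ℕ} (g : OrthGroup n) : Prop :=
  Module.finrank ℝ (fixedSpace g) + 2 = n

/-- A (real) reflection group: a finite group generated by reflections. -/
def IsReflectionGroup {n : ℕ} (W : Subgroup (OrthGroup n)) : Prop :=
  Finite W ∧ ∃ S : Set (OrthGroup n), (∀ s ∈ S, IsReflection s) ∧ W = Subgroup.closure S

/-- A rotation group: a finite group generated by rotations. -/
def IsRotationGroup {n : ℕ} (G : Subgroup (OrthGroup n)) : Prop :=
  Finite G ∧ ∃ S : Set (OrthGroup n), (∀ s ∈ S, IsRotation s) ∧ G = Subgroup.closure S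

/-- `G` acts irreducibly on `ℝⁿ`: the space is nonzero, and `0` and `ℝⁿ` are the only
`G`-invariant linear subspaces. -/
def ActsIrreducibly {n : ℕ} (G : Subgroup (OrthGroup n)) : Prop :=
  0 < n ∧ ∀ U : Submodule ℝ (EuclideanSpace ℝ (Fin n)),
    (∀ g ∈ G, ∀ v ∈ U, g v ∈ U) → U = ⊥ ∨ U = ⊤

/-- The orientation preserving subgroup `G⁺ = G ∩ SO_n`. -/
noncomputable def orientationPreserving {n : ℕ} (G : Subgroup (OrthGroup n)) : Subgroup (OrthGroup n) :=
  G ⊓ SOGroup n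

/-- `W` has the type given by the Coxeter matrix `M`: it is generated by the reflections in the
hyperplanes orthogonal to the vectors `α i` of some basis of `ℝⁿ` consisting of unit vectors with
`⟪α i, α j⟫ = -cos (π / M i j)`. Equivalently, `W` has a chamber whose walls have unit normals
`α i`, and the Coxeter diagram read off from this chamber is the one of `M`. -/
def HasCoxeterType {n : ℕ} {ι : Type} (W : Subgroup (OrthGroup n)) (M : CoxeterMatrix ι) : Prop :=
  ∃ α : Module.Basis ι ℝ (EuclideanSpace ℝ (Fin n)),
    (∀ i j, inner ℝ (α i) (α j) = -Real.cos (Real.pi / (M i j : ℝ))) ∧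
    W = Subgroup.closure (Set.range fun i => (Submodule.span ℝ {α i})ᗮ.reflection)

/-- The Coxeter matrix of type `D₄`: the node `1` is joined to each of the nodes `0`, `2` and `3` by
a bond labelled three, and there are no other bonds. (Mathlib's `CoxeterMatrix.D 4` is not used: it
has an additional bond between `2` and `3`, so its diagram contains a triangle.) -/
def coxeterMatrixD4 : CoxeterMatrix (Fin 4) where
  M := !![1, 3, 2, 2;
          3, 1, 3, 3;
          2, 3, 1, 2;
          2, 3, 2, 1]
  isSymm := by decide
  diagonal := by decide
  off_diagonal := by
    intro i j hij
    fin_cases i <;> fin_cases j <;> simp at hij ⊢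

/-- `W` has type `A₄`, `D₄`, `F₄`, `A₅` or `E₆`. -/
def HasExtendableType {n : ℕ} (W : Subgroup (OrthGroup n)) : Prop :=
  HasCoxeterType W (CoxeterMatrix.A 4) ∨ HasCoxeterType W coxeterMatrixD4 ∨
  HasCoxeterType W CoxeterMatrix.F₄ ∨ HasCoxeterType W (CoxeterMatrix.A 5) ∨
  HasCoxeterType W CoxeterMatrix.E₆

/-- The group `⟨W⁺, h⟩` generated by the orientation preserving subgroup of `W` and `h`. -/
noncomputable def extendedGroup {n : ℕ} (W : Subgroup (OrthGroup n)) (h : OrthGroup n) :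
    Subgroup (OrthGroup n) :=
  Subgroup.closure ((orientationPreserving W : Set (OrthGroup n)) ∪ {h})

/-- `h ∈ SO_n \ W` is a rotation that normalizes `W` and `W⁺` such that `⟨W⁺, h⟩` is a rotation
group which is not the orientation preserving subgroup of any reflection group. -/
structure IsExtendingRotation {n : ℕ} (W : Subgroup (OrthGroup n)) (h : OrthGroup n) : Prop where
  isRotation : IsRotation h
  mem_SO : h ∈ SOGroup n
  notMem : h ∉ W
  normalizes : ∀ g, g ∈ W ↔ h * g * h⁻¹ ∈ W
  normalizes_orientationPreserving :
    ∀ g, g ∈ orientationPreserving W ↔ h * g * h⁻¹ ∈ orientationPreserving W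
  isRotationGroup : IsRotationGroup (extendedGroup W h)
  not_orientationPreserving :
    ¬ ∃ W' : Subgroup (OrthGroup n), IsReflectionGroup W' ∧
      extendedGroup W h = orientationPreserving W'

/-!
Let `α` be a simple system of `W`. An element `h` as in (a) maps chambers of `W` to chambers, so
`h = w a`, where `w ∈ W` and `a` permutes `α` through an automorphism `σ` of the Coxeter diagram.
For a generic vector fixed by `h`, one can choose `w` such that `a` fixes at least as much as `h`,
whence the permutation matrix `a` is trivial, a reflection or a rotation. It is not trivial because
`h ∉ W`, and if it were a reflection then `⟨W⁺, h⟩` would be the orientation preserving subgroup of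
`⟨W, a⟩`. Thus `σ` is a three-cycle or a product of two transpositions, and among the connected
positive definite diagrams only those of the listed types have such a symmetry.

Conversely, each listed diagram has such a symmetry, unique up to inversion. If the corresponding
group `⟨W⁺, a⟩` were `W'⁺` for a reflection group `W'`, consider three nodes that span a subdiagram
of type `A₃` or `B₃` not preserved by `σ`. An element of `W⟨a⟩` that fixes the orthogonal complement
of these nodes acts as a symmetry of a cube, and this forces `W` and `W'` to share a reflection `r`.
Then `s r ∈ W⟨a⟩` for every reflection `s ∈ W'`; since a rotation other than `1` in `⟨a⟩` makes the
codimension of the fixed space of any element of `W a ^ t` at least two, `s ∈ W`. Hence `W' ≤ W`,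
contrary to `a ∈ W'`.
-/

open scoped RealInnerProductSpace

namespace ReflectionGroup

/-! ### Reflections and roots -/

section Reflection

variable {E : Type*} [NormedAddCommGroup E] [InnerProductSpace ℝ E]

theorem mul_apply (g h : E ≃ₗᵢ[ℝ] E) (x : E) : (g * h) x = g (h x) := rfl

theorem one_apply (x : E) : (1 : E ≃ₗᵢ[ℝ] E) x = x := rfl

theorem inv_apply_self (g : E ≃ₗᵢ[ℝ] E) (x : E) : g⁻¹ (g x) = x := g.symm_apply_apply x

theorem apply_inv_self (g : E ≃ₗᵢ[ℝ] E) (x : E) : g (g⁻¹ x) = x := g.apply_symm_apply x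

theorem inv_apply_eq {g : E ≃ₗᵢ[ℝ] E} {x y : E} : g⁻¹ x = y ↔ x = g y :=
  g.toEquiv.symm_apply_eq

theorem inner_inv_right (g : E ≃ₗᵢ[ℝ] E) (x y : E) : ⟪x, g⁻¹ y⟫ = ⟪g x, y⟫ := by
  rw [← g.inner_map_map, apply_inv_self]

theorem ne_zero_of_norm_eq_one {F : Type*} [NormedAddCommGroup F] {v : F} (hv : ‖v‖ = 1) : v ≠ 0 :=
  ne_zero_of_norm_ne_zero (hv ▸ one_ne_zero)

theorem eq_or_eq_neg_of_smul {v w : E} (hv : ‖v‖ = 1) (hw : ‖w‖ = 1) {c : ℝ}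
    (h : w = c • v) : w = v ∨ w = -v := by
  have hc : |c| = 1 := by rw [← hw, h, norm_smul, hv, mul_one, Real.norm_eq_abs]
  refine (eq_or_eq_neg_of_abs_eq hc).imp ?_ ?_ <;> rintro rfl <;> simpa using h

theorem eq_or_eq_neg_of_orthogonal {u v : E} (hu : ‖u‖ = 1) (hv : ‖v‖ = 1)
    (h : ∀ x, ⟪x, v⟫ = 0 → ⟪x, u⟫ = 0) : u = v ∨ u = -v := by
  have hmem : u ∈ (ℝ ∙ v)ᗮᗮ := fun x hx =>
    h x (Submodule.mem_orthogonal_singleton_iff_inner_left.mp hx)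
  rw [Submodule.orthogonal_orthogonal] at hmem
  obtain ⟨c, hc⟩ := Submodule.mem_span_singleton.mp hmem
  exact eq_or_eq_neg_of_smul hv hu hc.symm

/-- The reflection in the hyperplane orthogonal to `v`; it is the identity for `v = 0`. -/
noncomputable abbrev reflect (v : E) : E ≃ₗᵢ[ℝ] E := (ℝ ∙ v)ᗮ.reflection

theorem reflect_apply (v x : E) : reflect v x = x - (2 * ⟪v, x⟫ / ⟪v, v⟫) • v := by
  rw [reflect, Submodule.reflection_orthogonal_apply, Submodule.reflection_singleton_apply,
    real_inner_self_eq_norm_sq, RCLike.ofReal_real_eq_id, id]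
  module

theorem reflect_apply_of_norm {v : E} (hv : ‖v‖ = 1) (x : E) :
    reflect v x = x - (2 * ⟪v, x⟫) • v := by
  rw [reflect_apply, inner_self_eq_one_of_norm_eq_one hv, div_one]

theorem reflect_apply_self (v : E) : reflect v v = -v :=
  Submodule.reflection_orthogonalComplement_singleton_eq_neg v

theorem reflect_reflect (v x : E) : reflect v (reflect v x) = x :=
  Submodule.reflection_reflection _ _

theorem reflect_mul_self (v : E) : reflect v * reflect v = 1 :=
  Submodule.reflection_mul_reflection _

theorem reflect_inv (v : E) : (reflect v)⁻¹ = reflect v := Submodule.reflection_inv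

theorem reflect_apply_eq_self_iff {v x : E} : reflect v x = x ↔ ⟪v, x⟫ = 0 := by
  rw [reflect, Submodule.reflection_eq_self_iff,
    Submodule.mem_orthogonal_singleton_iff_inner_right]

theorem reflect_smul {c : ℝ} (hc : c ≠ 0) (v : E) : reflect (c • v) = reflect v := by
  simp only [reflect, Submodule.span_singleton_smul_eq (IsUnit.mk0 c hc)]

theorem reflect_neg (v : E) : reflect (-v) = reflect v := by
  rw [← neg_one_smul ℝ, reflect_smul (by norm_num)]

theorem conj_reflect (g : E ≃ₗᵢ[ℝ] E) (v : E) : g * reflect v * g⁻¹ = reflect (g v) := by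
  ext1 x
  rw [mul_apply, mul_apply, reflect_apply, reflect_apply, map_sub, map_smul, apply_inv_self,
    inner_inv_right, g.inner_map_map]

theorem eq_or_eq_neg_of_reflect_neg {v w : E} (hv : ‖v‖ = 1) (hw : ‖w‖ = 1)
    (h : reflect v w = -w) : w = v ∨ w = -v := by
  rw [reflect_apply_of_norm hv] at h
  refine eq_or_eq_neg_of_smul hv hw (c := ⟪v, w⟫) (smul_right_injective _ (two_ne_zero (α := ℝ)) ?_)
  linear_combination (norm := module) h

theorem eq_or_eq_neg_of_reflect_eq {v w : E} (hv : ‖v‖ = 1) (hw : ‖w‖ = 1)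
    (h : reflect v = reflect w) : w = v ∨ w = -v :=
  eq_or_eq_neg_of_reflect_neg hv hw (by rw [h, reflect_apply_self])

theorem reflect_ne_one {v : E} (hv : v ≠ 0) : reflect v ≠ 1 := fun h =>
  hv (inner_self_eq_zero.mp (reflect_apply_eq_self_iff.mp (by rw [h, one_apply])))

theorem apply_eq_self_of_mem_closure {S : Set (E ≃ₗᵢ[ℝ] E)} {x : E}
    (hS : ∀ s ∈ S, s x = x) {g : E ≃ₗᵢ[ℝ] E} (hg : g ∈ Subgroup.closure S) : g x = x := by
  induction hg using Subgroup.closure_induction with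
  | mem s hs => exact hS s hs
  | one => rfl
  | mul g g' _ _ hg hg' => rw [mul_apply, hg', hg]
  | inv g _ hg => rw [inv_apply_eq, hg]

theorem exists_generic (U : Submodule ℝ E) {S : Set E} (hS : S.Finite) :
    ∃ u ∈ U, ∀ s ∈ S, ⟪u, s⟫ = 0 → ∀ x ∈ U, ⟪x, s⟫ = 0 := by
  let T := {s ∈ S | ∃ x ∈ U, ⟪s, x⟫ ≠ 0}
  have : Finite T := hS.subset (Set.sep_subset _ _)
  obtain ⟨u, hu, hne⟩ := Module.Dual.exists_forall_mem_ne_zero_of_forall_exists U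
    (fun s : T => innerₛₗ ℝ (s : E)) fun s => s.2.2
  refine ⟨u, hu, fun s hs h0 x hx => by_contra fun hx0 => ?_⟩
  rw [real_inner_comm] at h0 hx0
  exact hne ⟨s, hs, x, hx, hx0⟩ h0

end Reflection

section Roots

variable {E : Type*} [NormedAddCommGroup E] [InnerProductSpace ℝ E] {W : Subgroup (E ≃ₗᵢ[ℝ] E)}

/-- The roots of a group `W` of isometries: the unit normals of the reflecting hyperplanes. -/
def roots (W : Subgroup (E ≃ₗᵢ[ℝ] E)) : Set E := {v | ‖v‖ = 1 ∧ reflect v ∈ W}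

theorem neg_mem_roots {v : E} (hv : v ∈ roots W) : -v ∈ roots W :=
  ⟨by rw [norm_neg, hv.1], by rw [reflect_neg]; exact hv.2⟩

theorem apply_mem_roots_of_mem_normalizer {g : E ≃ₗᵢ[ℝ] E}
    (hg : g ∈ Subgroup.normalizer (W : Set (E ≃ₗᵢ[ℝ] E))) {v : E} (hv : v ∈ roots W) :
    g v ∈ roots W :=
  ⟨by rw [g.norm_map, hv.1],
    by rw [← conj_reflect]; exact (Subgroup.mem_normalizer_iff.mp hg _).mp hv.2⟩

theorem apply_mem_roots {g : E ≃ₗᵢ[ℝ] E} (hg : g ∈ W) {v : E} (hv : v ∈ roots W) :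
    g v ∈ roots W :=
  apply_mem_roots_of_mem_normalizer (Subgroup.le_normalizer hg) hv

theorem finite_roots (W : Subgroup (E ≃ₗᵢ[ℝ] E)) [Finite W] : (roots W).Finite := by
  refine Set.Finite.of_finite_fibers reflect ((W : Set (E ≃ₗᵢ[ℝ] E)).toFinite.subset ?_) ?_
  · rintro _ ⟨v, hv, rfl⟩
    exact hv.2
  · rintro _ ⟨v, hv, rfl⟩
    exact (Set.toFinite {v, -v}).subset fun w hw => eq_or_eq_neg_of_reflect_eq hv.1 hw.1.1 hw.2.symm

end Roots

/-! ### Simple systems -/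

section Basis

theorem eq_smul_of_repr_eq_zero {R M ι : Type*} [Ring R] [AddCommGroup M] [Module R M]
    (α : Module.Basis ι R M) {v : M} {j : ι} (h : ∀ k ≠ j, α.repr v k = 0) :
    v = α.repr v j • α j := by
  refine α.ext_elem fun k => ?_
  rw [map_smul, α.repr_self, Finsupp.smul_apply]
  rcases eq_or_ne k j with rfl | hk
  · simp
  · simp [h k hk, Finsupp.single_eq_of_ne hk]

/-- If a linear automorphism and its inverse both preserve the cone spanned by a basis, then they
permute the extremal rays of the cone. -/
theorem exists_symm_apply_eq_smul {M ι : Type*} [AddCommGroup M] [Module ℝ M] [Finite ι]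
    (α : Module.Basis ι ℝ M) (f : M ≃ₗ[ℝ] M) (hf : ∀ i j, 0 ≤ α.repr (f (α i)) j)
    (hf' : ∀ i j, 0 ≤ α.repr (f.symm (α i)) j) (i : ι) :
    ∃ j, ∃ c : ℝ, f.symm (α j) = c • α i := by
  cases nonempty_fintype ι
  obtain ⟨j, hj⟩ : ∃ j, α.repr (f (α i)) j ≠ 0 := by
    by_contra! hz
    exact α.ne_zero i (f.map_eq_zero_iff.mp (α.ext_elem fun j => by simpa using hz j))
  refine ⟨j, _, eq_smul_of_repr_eq_zero α fun k hk => ?_⟩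
  have hsum : ∑ l, α.repr (f (α i)) l * α.repr (f.symm (α l)) k = 0 := by
    have h := congrArg (fun v => α.repr (f.symm v) k) (α.sum_repr (f (α i)))
    simpa only [map_sum, map_smul, Finsupp.finsetSum_apply, Finsupp.smul_apply, smul_eq_mul,
      f.symm_apply_apply, α.repr_self, Finsupp.single_eq_of_ne hk] using h
  have hz := (Finset.sum_eq_zero_iff_of_nonneg fun l _ =>
    mul_nonneg (hf i l) (hf' l k)).mp hsum j (Finset.mem_univ j)
  exact (mul_eq_zero.mp hz).resolve_left hj

variable {E ι : Type*} [NormedAddCommGroup E] [InnerProductSpace ℝ E]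

theorem repr_reflect {α : Module.Basis ι ℝ E} {j : ι} (v : E) {k : ι} (hk : k ≠ j) :
    α.repr (reflect (α j) v) k = α.repr v k := by
  simp [reflect_apply, Finsupp.single_eq_of_ne hk]

theorem eq_basis_of_reflect_nonpos {α : Module.Basis ι ℝ E} {j : ι} (hj : ‖α j‖ = 1)
    {v : E} (hv : ‖v‖ = 1) (hpos : ∀ k, 0 ≤ α.repr v k)
    (hneg : ∀ k, α.repr (reflect (α j) v) k ≤ 0) : v = α j := by
  have hz (k : ι) (hk : k ≠ j) : α.repr v k = 0 :=
    le_antisymm (by rw [← repr_reflect v hk]; exact hneg k) (hpos k)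
  refine (eq_or_eq_neg_of_smul hj hv (eq_smul_of_repr_eq_zero α hz)).resolve_right fun h => ?_
  have := hpos j
  simp only [h, map_neg, α.repr_self, Finsupp.neg_apply, Finsupp.single_eq_same] at this
  linarith

theorem inner_eq_sum_repr [Fintype ι] (α : Module.Basis ι ℝ E) (x v : E) :
    ⟪x, v⟫ = ∑ j, α.repr v j * ⟪x, α j⟫ := by
  conv_lhs => rw [← α.sum_repr v, inner_sum]
  simp only [inner_smul_right]

theorem exists_inner_basis_eq [Finite ι] (α : Module.Basis ι ℝ E) (f : ι → ℝ) :
    ∃ x : E, ∀ i, ⟪x, α i⟫ = f i := by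
  have : FiniteDimensional ℝ E := α.finiteDimensional_of_finite
  have : CompleteSpace E := FiniteDimensional.complete ℝ E
  refine ⟨(InnerProductSpace.toDual ℝ E).symm (α.constr ℝ f).toContinuousLinearMap, fun i => ?_⟩
  rw [InnerProductSpace.toDual_symm_apply]
  exact α.constr_basis ℝ f i

theorem exists_isometry_of_inner_perm [Finite ι] (α : Module.Basis ι ℝ E) (σ : Equiv.Perm ι)
    (h : ∀ i j, ⟪α (σ i), α (σ j)⟫ = ⟪α i, α j⟫) :
    ∃ a : E ≃ₗᵢ[ℝ] E, ∀ i, a (α i) = α (σ i) := by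
  cases nonempty_fintype ι
  let f : E ≃ₗ[ℝ] E := α.equiv α σ
  have hf (i : ι) : f (α i) = α (σ i) := α.equiv_apply i α σ
  have hsum (z : E) : f z = ∑ i, α.repr z i • α (σ i) := by
    conv_lhs => rw [← α.sum_repr z, map_sum]
    simp only [map_smul, hf]
  refine ⟨f.isometryOfInner fun x y => ?_, hf⟩
  rw [hsum x, hsum y]
  conv_rhs => rw [← α.sum_repr x, ← α.sum_repr y]
  simp only [sum_inner, inner_sum, inner_smul_left, inner_smul_right, h]

end Basis

/-- `α` is a simple system for the finite reflection group `W`: the reflections in the unit vectors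
`α i` generate `W`, and each image of some `α i` under `W` has coordinates of constant sign. -/
structure IsSimpleSystem {E ι : Type*} [NormedAddCommGroup E] [InnerProductSpace ℝ E]
    (W : Subgroup (E ≃ₗᵢ[ℝ] E)) (α : Module.Basis ι ℝ E) : Prop where
  norm_eq_one : ∀ i, ‖α i‖ = 1
  eq_closure : W = Subgroup.closure (Set.range fun i => reflect (α i))
  dichotomy : ∀ w ∈ W, ∀ i,
    (∀ j, 0 ≤ α.repr (w (α i)) j) ∨ (∀ j, α.repr (w (α i)) j ≤ 0)

section Chamber

variable {E ι : Type*} [NormedAddCommGroup E] [InnerProductSpace ℝ E]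
  {W : Subgroup (E ≃ₗᵢ[ℝ] E)} {α : Module.Basis ι ℝ E}

/-- The closed chamber cut out by the hyperplanes orthogonal to the members of a basis. -/
def chamber (α : Module.Basis ι ℝ E) : Set E := {x | ∀ i, 0 ≤ ⟪x, α i⟫}

/-- The product of simple reflections given by a word in their indices. -/
noncomputable def wordProd (α : Module.Basis ι ℝ E) (l : List ι) : E ≃ₗᵢ[ℝ] E :=
  (l.map fun i => reflect (α i)).prod

theorem wordProd_cons (α : Module.Basis ι ℝ E) (i : ι) (l : List ι) :
    wordProd α (i :: l) = reflect (α i) * wordProd α l := by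
  simp only [wordProd, List.map_cons, List.prod_cons]

theorem wordProd_append (α : Module.Basis ι ℝ E) (l m : List ι) :
    wordProd α (l ++ m) = wordProd α l * wordProd α m := by
  simp only [wordProd, List.map_append, List.prod_append]

theorem apply_mem_chamber_of_perm {a : E ≃ₗᵢ[ℝ] E} {σ : Equiv.Perm ι}
    (hσ : ∀ i, a (α i) = α (σ i)) {x : E} (hx : x ∈ chamber α) : a x ∈ chamber α := fun i => by
  rw [← σ.apply_symm_apply i, ← hσ, a.inner_map_map]
  exact hx _

namespace IsSimpleSystem

theorem reflect_mem (h : IsSimpleSystem W α) (i : ι) : reflect (α i) ∈ W :=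
  h.eq_closure ▸ Subgroup.subset_closure ⟨i, rfl⟩

theorem mem_roots (h : IsSimpleSystem W α) (i : ι) : α i ∈ roots W :=
  ⟨h.norm_eq_one i, h.reflect_mem i⟩

theorem norm_apply (h : IsSimpleSystem W α) (w : E ≃ₗᵢ[ℝ] E) (i : ι) : ‖w (α i)‖ = 1 := by
  rw [w.norm_map, h.norm_eq_one]

theorem wordProd_mem (h : IsSimpleSystem W α) (l : List ι) : wordProd α l ∈ W := by
  refine W.list_prod_mem fun x hx => ?_
  obtain ⟨i, -, rfl⟩ := List.mem_map.mp hx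
  exact h.reflect_mem i

theorem exists_wordProd_eq (h : IsSimpleSystem W α) {w : E ≃ₗᵢ[ℝ] E} (hw : w ∈ W) :
    ∃ l, wordProd α l = w := by
  rw [h.eq_closure] at hw
  induction hw using Subgroup.closure_induction with
  | mem x hx => obtain ⟨i, rfl⟩ := hx; exact ⟨[i], by simp [wordProd]⟩
  | one => exact ⟨[], rfl⟩
  | mul x y _ _ hx hy =>
    obtain ⟨l, rfl⟩ := hx
    obtain ⟨m, rfl⟩ := hy
    exact ⟨l ++ m, wordProd_append α l m⟩
  | inv x _ hx =>
    obtain ⟨l, rfl⟩ := hx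
    refine ⟨l.reverse, ?_⟩
    rw [wordProd, wordProd, List.prod_inv_reverse, List.map_reverse, List.map_map]
    simp only [Function.comp_def, reflect_inv]

/-- The deletion property of Coxeter groups. -/
theorem exists_shorter_word (h : IsSimpleSystem W α) (k : ι) (l : List ι)
    (hl : ∀ j, α.repr (wordProd α l (α k)) j ≤ 0) :
    ∃ l' : List ι, l'.length < l.length ∧ wordProd α l' = wordProd α l * reflect (α k) := by
  induction l with
  | nil =>
    have := hl k
    rw [wordProd, List.map_nil, List.prod_nil, one_apply, α.repr_self,
      Finsupp.single_eq_same] at this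
    linarith
  | cons j t ih =>
    by_cases ht : ∀ j, α.repr (wordProd α t (α k)) j ≤ 0
    · obtain ⟨l', hlt, heq⟩ := ih ht
      refine ⟨j :: l', by simpa using hlt, ?_⟩
      rw [wordProd_cons, wordProd_cons, mul_assoc, ← heq]
    · have hpos := (h.dichotomy _ (h.wordProd_mem t) k).resolve_right ht
      rw [wordProd_cons, mul_apply] at hl
      have heq := eq_basis_of_reflect_nonpos (h.norm_eq_one j) (h.norm_apply _ k) hpos hl
      refine ⟨t, by simp, ?_⟩
      rw [wordProd_cons, ← heq, ← conj_reflect]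
      simp only [mul_assoc, inv_mul_cancel_left, reflect_mul_self, mul_one]

theorem mem_normalizer_of_perm (h : IsSimpleSystem W α) {a : E ≃ₗᵢ[ℝ] E} {σ : Equiv.Perm ι}
    (hσ : ∀ i, a (α i) = α (σ i)) : a ∈ Subgroup.normalizer (W : Set (E ≃ₗᵢ[ℝ] E)) := by
  rw [Subgroup.mem_normalizer_iff_map_conj_eq, h.eq_closure, MonoidHom.map_closure,
    ← Set.range_comp]
  refine congrArg Subgroup.closure ((σ.surjective.range_comp _).symm.trans ?_).symm
  refine congrArg Set.range (funext fun i => ?_)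
  change reflect (α (σ i)) = a * reflect (α i) * a⁻¹
  rw [conj_reflect, hσ]

variable [Finite ι]

theorem wordProd_fixes_of_mem_chamber (h : IsSimpleSystem W α) {m : ℕ} {l : List ι}
    (hl : l.length ≤ m) {x : E} (hx : x ∈ chamber α) (hy : wordProd α l x ∈ chamber α) :
    wordProd α l x = x ∧
      wordProd α l ∈ Subgroup.closure {g | ∃ i, ⟪x, α i⟫ = 0 ∧ g = reflect (α i)} := by
  cases nonempty_fintype ι
  induction m generalizing l with
  | zero =>
    obtain rfl : l = [] := by simpa using hl
    exact ⟨rfl, Subgroup.one_mem _⟩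
  | succ m ih =>
    rcases List.eq_nil_or_concat' l with rfl | ⟨t, k, rfl⟩
    · exact ⟨rfl, Subgroup.one_mem _⟩
    have hlen : t.length ≤ m := by simpa using hl
    have hw : wordProd α (t ++ [k]) = wordProd α t * reflect (α k) := by
      simp [wordProd]
    rw [hw] at hy ⊢
    rcases h.dichotomy _ (h.wordProd_mem t) k with hpos | hneg
    · have hk : ⟪x, α k⟫ = 0 := by
        refine le_antisymm ?_ (hx k)
        rw [← (wordProd α t * reflect (α k)).inner_map_map, mul_apply _ _ (α k),
          reflect_apply_self, map_neg, inner_neg_right, neg_nonpos, inner_eq_sum_repr α]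
        exact Finset.sum_nonneg fun j _ => mul_nonneg (hpos j) (hy j)
      rw [mul_apply, reflect_apply_eq_self_iff.mpr (by rwa [real_inner_comm])] at hy ⊢
      obtain ⟨hfix, hmem⟩ := ih hlen hy
      exact ⟨hfix, Subgroup.mul_mem _ hmem (Subgroup.subset_closure ⟨k, hk, rfl⟩)⟩
    · obtain ⟨l', hlt, heq⟩ := h.exists_shorter_word k t hneg
      rw [← heq] at hy ⊢
      exact ih (by omega) hy

theorem fixes_of_mem_chamber (h : IsSimpleSystem W α) {w : E ≃ₗᵢ[ℝ] E} (hw : w ∈ W) {x : E}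
    (hx : x ∈ chamber α) (hy : w x ∈ chamber α) :
    w x = x ∧ w ∈ Subgroup.closure {g | ∃ i, ⟪x, α i⟫ = 0 ∧ g = reflect (α i)} := by
  obtain ⟨l, rfl⟩ := h.exists_wordProd_eq hw
  exact h.wordProd_fixes_of_mem_chamber le_rfl hx hy

theorem eq_one_of_perm (h : IsSimpleSystem W α) {w : E ≃ₗᵢ[ℝ] E} (hw : w ∈ W)
    {σ : Equiv.Perm ι} (hσ : ∀ i, w (α i) = α (σ i)) : w = 1 := by
  obtain ⟨ρ, hρ⟩ := exists_inner_basis_eq α fun _ => 1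
  have hc : ρ ∈ chamber α := fun i => by rw [hρ]; exact zero_le_one
  have hmem := (h.fixes_of_mem_chamber hw hc (apply_mem_chamber_of_perm hσ hc)).2
  simpa [hρ] using hmem

variable [Finite W]

theorem exists_apply_mem_chamber (h : IsSimpleSystem W α) (x : E) : ∃ w ∈ W, w x ∈ chamber α := by
  obtain ⟨ρ, hρ⟩ := exists_inner_basis_eq α fun _ => 1
  obtain ⟨w, hw⟩ := Finite.exists_max fun w : W => ⟪(w : E ≃ₗᵢ[ℝ] E) x, ρ⟫
  refine ⟨w, w.2, fun i => ?_⟩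
  have hle := hw ⟨reflect (α i) * w, W.mul_mem (h.reflect_mem i) w.2⟩
  rw [mul_apply, reflect_apply_of_norm (h.norm_eq_one i), inner_sub_left, real_inner_smul_left,
    real_inner_comm ρ (α i), hρ i, real_inner_comm _ (α i)] at hle
  linarith

theorem exists_root_orthogonal_fixed (h : IsSimpleSystem W α) {g : E ≃ₗᵢ[ℝ] E}
    (hg : g ∈ W) (hne : g ≠ 1) : ∃ w ∈ W, ∃ i, ∀ x, g x = x → ⟪x, w (α i)⟫ = 0 := by
  obtain ⟨u, hu, hgen⟩ := exists_generic
    (LinearMap.eqLocus (g.toLinearEquiv : E →ₗ[ℝ] E) LinearMap.id) (finite_roots W)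
  obtain ⟨w, hw, hc⟩ := h.exists_apply_mem_chamber u
  have hfix : (w * g * w⁻¹) (w u) = w u := by
    rw [mul_apply, mul_apply, inv_apply_self]
    exact congrArg w hu
  have hconj : w * g * w⁻¹ ∈ W := W.mul_mem (W.mul_mem hw hg) (W.inv_mem hw)
  have hmem := (h.fixes_of_mem_chamber hconj hc (by rwa [hfix])).2
  obtain ⟨i, hi⟩ : ∃ i, ⟪w u, α i⟫ = 0 := by
    by_contra! hnone
    exact hne (by simpa [hnone] using hmem)
  refine ⟨w⁻¹, W.inv_mem hw, i, fun x hx => ?_⟩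
  exact hgen _ (apply_mem_roots (W.inv_mem hw) (h.mem_roots i)) (by rw [inner_inv_right, hi]) x hx

theorem exists_eq_or_eq_neg (h : IsSimpleSystem W α) {v : E} (hv : v ∈ roots W) :
    ∃ w ∈ W, ∃ i, v = w (α i) ∨ v = -w (α i) := by
  obtain ⟨w, hw, i, horth⟩ :=
    h.exists_root_orthogonal_fixed hv.2 (reflect_ne_one (ne_zero_of_norm_eq_one hv.1))
  have heq := eq_or_eq_neg_of_orthogonal (h.norm_apply w i) hv.1 fun x hx =>
    horth x (reflect_apply_eq_self_iff.mpr (by rwa [real_inner_comm]))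
  exact ⟨w, hw, i, heq.imp Eq.symm fun h => by rw [h, neg_neg]⟩

theorem root_dichotomy (h : IsSimpleSystem W α) {v : E} (hv : v ∈ roots W) :
    (∀ j, 0 ≤ α.repr v j) ∨ (∀ j, α.repr v j ≤ 0) := by
  obtain ⟨w, hw, i, rfl | rfl⟩ := h.exists_eq_or_eq_neg hv
  · exact h.dichotomy w hw i
  · simpa only [map_neg, Finsupp.neg_apply, neg_nonneg, neg_nonpos] using (h.dichotomy w hw i).symm

theorem repr_nonneg_of_inner_pos (h : IsSimpleSystem W α) {v x : E} (hv : v ∈ roots W)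
    (hx : x ∈ chamber α) (hpos : 0 < ⟪x, v⟫) (j : ι) : 0 ≤ α.repr v j := by
  cases nonempty_fintype ι
  refine (h.root_dichotomy hv).resolve_right (fun hneg => hpos.not_ge ?_) j
  rw [inner_eq_sum_repr α]
  exact Finset.sum_nonpos fun j _ => mul_nonpos_of_nonpos_of_nonneg (hneg j) (hx j)

theorem repr_nonneg_of_inner_nonneg (h : IsSimpleSystem W α) {v x : E} (hv : v ∈ roots W)
    (hx : ∀ i, 0 < ⟪x, α i⟫) (hnonneg : 0 ≤ ⟪x, v⟫) (j : ι) : 0 ≤ α.repr v j := by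
  cases nonempty_fintype ι
  refine (h.root_dichotomy hv).resolve_right (fun hneg => ?_) j
  have hterm (j : ι) : α.repr v j * ⟪x, α j⟫ ≤ 0 :=
    mul_nonpos_of_nonpos_of_nonneg (hneg j) (hx j).le
  have hsum : ∑ j, α.repr v j * ⟪x, α j⟫ = 0 :=
    le_antisymm (Finset.sum_nonpos fun j _ => hterm j) (by rwa [← inner_eq_sum_repr])
  have hzero := (Finset.sum_eq_zero_iff_of_nonpos fun j _ => hterm j).mp hsum
  exact ne_zero_of_norm_eq_one hv.1 (α.ext_elem fun j => by
    simpa [(hx j).ne'] using hzero j (Finset.mem_univ j))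

theorem exists_perm_of_mem_normalizer (h : IsSimpleSystem W α) {a : E ≃ₗᵢ[ℝ] E}
    (ha : a ∈ Subgroup.normalizer (W : Set (E ≃ₗᵢ[ℝ] E))) {x : E} (hx : ∀ i, 0 < ⟪x, α i⟫)
    (hax : a x ∈ chamber α) : ∃ σ : Equiv.Perm ι, ∀ i, a (α i) = α (σ i) := by
  have hpos (i j : ι) : 0 ≤ α.repr (a (α i)) j :=
    h.repr_nonneg_of_inner_pos (apply_mem_roots_of_mem_normalizer ha (h.mem_roots i)) hax
      (by rw [a.inner_map_map]; exact hx i) j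
  have hpos' (i j : ι) : 0 ≤ α.repr (a⁻¹ (α i)) j :=
    h.repr_nonneg_of_inner_nonneg
      (apply_mem_roots_of_mem_normalizer (Subgroup.inv_mem _ ha) (h.mem_roots i)) hx
      (by rw [inner_inv_right]; exact hax i) j
  have hsimple (i : ι) : ∃ j, a (α i) = α j := by
    obtain ⟨j, c, hc⟩ := exists_symm_apply_eq_smul α a.toLinearEquiv hpos hpos' i
    refine ⟨j, ?_⟩
    rcases eq_or_eq_neg_of_smul (h.norm_eq_one i) (h.norm_apply a⁻¹ j) hc with heq | heq
    · exact (inv_apply_eq.mp heq).symm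
    · have := hpos' j i
      rw [heq, map_neg, α.repr_self, Finsupp.neg_apply, Finsupp.single_eq_same] at this
      linarith
  choose f hf using hsimple
  have hinj : Function.Injective f := fun i j hij =>
    α.injective (a.injective (by rw [hf, hf, hij]))
  exact ⟨Equiv.ofBijective f (Finite.injective_iff_bijective.mp hinj), hf⟩

/-- Choosing a generic fixed vector of `b` makes the fixed space of the diagram automorphism `a` at
least as large as that of `b`: `c` carries the latter into the former. -/
theorem exists_eq_mul_perm (h : IsSimpleSystem W α) {b : E ≃ₗᵢ[ℝ] E}
    (hb : b ∈ Subgroup.normalizer (W : Set (E ≃ₗᵢ[ℝ] E))) :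
    ∃ w ∈ W, ∃ (a : E ≃ₗᵢ[ℝ] E) (σ : Equiv.Perm ι), (∀ i, a (α i) = α (σ i)) ∧ b = w * a ∧
      ∃ c : E ≃ₗᵢ[ℝ] E, ∀ x, b x = x → a (c x) = c x := by
  obtain ⟨u, hu, hgen⟩ := exists_generic
    (LinearMap.eqLocus (b.toLinearEquiv : E →ₗ[ℝ] E) LinearMap.id) (finite_roots W)
  replace hu : b u = u := hu
  obtain ⟨c, hcW, hc⟩ := h.exists_apply_mem_chamber u
  obtain ⟨ρ, hρ⟩ := exists_inner_basis_eq α fun _ => 1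
  obtain ⟨w, hwW, hwρ⟩ := h.exists_apply_mem_chamber ((c * b * c⁻¹) ρ)
  have hN {g : E ≃ₗᵢ[ℝ] E} (hg : g ∈ W) := Subgroup.le_normalizer hg
  obtain ⟨σ, hσ⟩ := h.exists_perm_of_mem_normalizer (a := w * (c * b * c⁻¹)) (x := ρ)
    (mul_mem (hN hwW) (mul_mem (mul_mem (hN hcW) hb) (hN (W.inv_mem hcW))))
    (fun i => by rw [hρ]; exact one_pos) hwρ
  set a := w * (c * b * c⁻¹) with ha
  have hac {x : E} (hx : b x = x) : a (c x) = w (c x) := by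
    simp only [ha, mul_apply, inv_apply_self, hx]
  have hmem := (h.fixes_of_mem_chamber hwW hc
    (by rw [← hac hu]; exact apply_mem_chamber_of_perm hσ hc)).2
  refine ⟨c⁻¹ * w⁻¹ * (a * c * a⁻¹), ?_, a, σ, hσ, by rw [ha]; group, c, fun x hx => ?_⟩
  · exact W.mul_mem (W.mul_mem (W.inv_mem hcW) (W.inv_mem hwW))
      ((Subgroup.mem_normalizer_iff.mp (h.mem_normalizer_of_perm hσ) c).mp hcW)
  · rw [hac hx]
    refine apply_eq_self_of_mem_closure ?_ hmem
    rintro _ ⟨i, hi, rfl⟩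
    rw [reflect_apply_eq_self_iff, real_inner_comm, ← inner_inv_right]
    exact hgen _ (apply_mem_roots (W.inv_mem hcW) (h.mem_roots i))
      (by rw [inner_inv_right, hi]) x hx

end IsSimpleSystem

end Chamber

/-! ### Existence of simple systems -/

section OrthogonalGroup

/-- The determinant, as a homomorphism on linear isometries. -/
noncomputable def isometryDet (E : Type*) [NormedAddCommGroup E] [InnerProductSpace ℝ E] :
    (E ≃ₗᵢ[ℝ] E) →* ℝ where
  toFun g := LinearMap.det (g.toLinearEquiv : E →ₗ[ℝ] E)
  map_one' := LinearMap.det_id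
  map_mul' g h := by rw [← LinearMap.det_comp]; rfl

theorem isometryDet_reflect {E : Type*} [NormedAddCommGroup E] [InnerProductSpace ℝ E]
    [FiniteDimensional ℝ E] {v : E} (hv : v ≠ 0) : isometryDet E (reflect v) = -1 := by
  have h := Submodule.det_reflection (ℝ ∙ v)ᗮ
  rw [Submodule.orthogonal_orthogonal, finrank_span_singleton hv, pow_one] at h
  exact h

variable {n : ℕ}

theorem mem_orientationPreserving {G : Subgroup (OrthGroup n)} {g : OrthGroup n} :
    g ∈ orientationPreserving G ↔ g ∈ G ∧ isometryDet _ g = 1 := Iff.rfl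

theorem mem_fixedSpace {g : OrthGroup n} {x : EuclideanSpace ℝ (Fin n)} :
    x ∈ fixedSpace g ↔ g x = x := Iff.rfl

theorem fixedSpace_reflect (v : EuclideanSpace ℝ (Fin n)) : fixedSpace (reflect v) = (ℝ ∙ v)ᗮ := by
  ext x
  rw [mem_fixedSpace, reflect_apply_eq_self_iff, Submodule.mem_orthogonal_singleton_iff_inner_right]

theorem isReflection_reflect {v : EuclideanSpace ℝ (Fin n)} (hv : v ≠ 0) :
    IsReflection (reflect v) := by
  have h := (ℝ ∙ v).finrank_add_finrank_orthogonal
  rwa [finrank_span_singleton hv, finrank_euclideanSpace_fin, ← fixedSpace_reflect, add_comm] at h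

theorem eq_reflect_of_fixedSpace_eq {g : OrthGroup n} {v : EuclideanSpace ℝ (Fin n)}
    (hv : ‖v‖ = 1) (hg : fixedSpace g = (ℝ ∙ v)ᗮ) : g = reflect v := by
  have hgv : g v = -v := by
    have horth : ∀ x, ⟪x, v⟫ = 0 → ⟪x, g v⟫ = 0 := fun x hx => by
      have hx' : x ∈ fixedSpace g := hg ▸ Submodule.mem_orthogonal_singleton_iff_inner_left.mpr hx
      rwa [← mem_fixedSpace.mp hx', g.inner_map_map]
    refine (eq_or_eq_neg_of_orthogonal (by rwa [g.norm_map]) hv horth).resolve_left fun h => ?_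
    have hself : v ∈ (ℝ ∙ v)ᗮ := hg ▸ mem_fixedSpace.mpr h
    exact ne_zero_of_norm_eq_one hv
      (inner_self_eq_zero.mp (Submodule.mem_orthogonal_singleton_iff_inner_left.mp hself))
  ext1 x
  obtain ⟨y, hy, z, hz, rfl⟩ := (ℝ ∙ v).exists_add_mem_mem_orthogonal x
  obtain ⟨c, rfl⟩ := Submodule.mem_span_singleton.mp hy
  rw [map_add, map_add, map_smul, map_smul, hgv, reflect_apply_self,
    mem_fixedSpace.mp (hg ▸ hz), mem_fixedSpace.mp (fixedSpace_reflect v ▸ hz)]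

theorem isReflection_iff {g : OrthGroup n} :
    IsReflection g ↔ ∃ v : EuclideanSpace ℝ (Fin n), ‖v‖ = 1 ∧ g = reflect v := by
  refine ⟨fun h => ?_, fun ⟨v, hv, hg⟩ => hg ▸ isReflection_reflect (ne_zero_of_norm_eq_one hv)⟩
  have hrank : Module.finrank ℝ (fixedSpace g)ᗮ = 1 := by
    have := (fixedSpace g).finrank_add_finrank_orthogonal
    rw [finrank_euclideanSpace_fin] at this
    unfold IsReflection at h
    omega
  have : Nontrivial (fixedSpace g)ᗮ := Module.nontrivial_of_finrank_pos (R := ℝ) (by omega)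
  obtain ⟨v, hv⟩ := exists_norm_eq (fixedSpace g)ᗮ zero_le_one
  have hne : (v : EuclideanSpace ℝ (Fin n)) ≠ 0 := ne_zero_of_norm_eq_one hv
  refine ⟨v, hv, eq_reflect_of_fixedSpace_eq hv ?_⟩
  rw [Submodule.eq_of_le_of_finrank_eq ((Submodule.span_singleton_le_iff_mem _ _).mpr v.2)
    (by rw [finrank_span_singleton hne, hrank]), Submodule.orthogonal_orthogonal]

theorem eq_closure_roots {W : Subgroup (OrthGroup n)} (hW : IsReflectionGroup W) :
    W = Subgroup.closure (reflect '' roots W) := by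
  refine le_antisymm ?_ ((Subgroup.closure_le _).mpr (Set.image_subset_iff.mpr fun v hv => hv.2))
  obtain ⟨-, S, hS, hWS⟩ := hW
  conv_lhs => rw [hWS]
  refine Subgroup.closure_mono fun s hs => ?_
  obtain ⟨v, hv, rfl⟩ := isReflection_iff.mp (hS s hs)
  exact ⟨v, ⟨hv, hWS ▸ Subgroup.subset_closure hs⟩, rfl⟩

end OrthogonalGroup

section Cone

open NNReal

variable {E : Type*} [NormedAddCommGroup E] [InnerProductSpace ℝ E]

theorem linearIndependent_of_inner_nonpos {ι : Type*} {v : ι → E} {x : E}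
    (hx : ∀ i, 0 < ⟪x, v i⟫) (hv : Pairwise fun i j => ⟪v i, v j⟫ ≤ 0) : LinearIndependent ℝ v :=
  LinearMap.BilinForm.linearIndependent_of_pairwise_le_zero (innerₗ E)
    (fun _ hy => real_inner_self_pos.mpr hy) (innerₗ E x) v hx hv

theorem inner_nonneg_of_mem_span {S : Set E} {x : E} (hS : ∀ s ∈ S, 0 < ⟪x, s⟫)
    {u : E} (hu : u ∈ Submodule.span ℝ≥0 S) : 0 ≤ ⟪x, u⟫ := by
  induction hu using Submodule.span_induction with
  | mem s hs => exact (hS s hs).le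
  | zero => rw [inner_zero_right]
  | add u v _ _ hu hv => rw [inner_add_right]; exact add_nonneg hu hv
  | smul c u _ hu => rw [NNReal.smul_def, inner_smul_right]; exact mul_nonneg c.2 hu

theorem exists_minimal_generators {R M : Type*} [Semiring R] [AddCommMonoid M] [Module R M]
    {P : Set M} (hP : P.Finite) :
    ∃ D ⊆ P, P ⊆ Submodule.span R D ∧ ∀ b ∈ D, b ∉ Submodule.span R (D \ {b}) := by
  have hfin : {D : Set M | D ⊆ P ∧ P ⊆ Submodule.span R D}.Finite :=
    hP.finite_subsets.subset fun D hD => hD.1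
  obtain ⟨D, hD, hmin⟩ := hfin.exists_minimal ⟨P, subset_rfl, Submodule.subset_span⟩
  refine ⟨D, hD.1, hD.2, fun b hb hmem => ?_⟩
  have hspan : Submodule.span R (D \ {b}) = Submodule.span R D := by
    rw [← Submodule.span_insert_eq_span hmem, Set.insert_sdiff_singleton, Set.insert_eq_of_mem hb]
  exact (hmin (y := D \ {b}) ⟨Set.sdiff_subset.trans hD.1, hspan ▸ hD.2⟩ Set.sdiff_subset hb).2 rfl

theorem smul_sub_notMem_span {D : Set E} {x : E} (hx : ∀ s ∈ D, 0 < ⟪x, s⟫) {b : E} (hb : b ∈ D)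
    (hmin : b ∉ Submodule.span ℝ≥0 (D \ {b})) {p : E} (hp : p ∈ Submodule.span ℝ≥0 (D \ {b}))
    (hxp : 0 < ⟪x, p⟫) (t : ℝ) : t • b - p ∉ Submodule.span ℝ≥0 D := by
  intro hmem
  rw [← Set.insert_eq_of_mem hb, ← Set.insert_sdiff_singleton, Submodule.mem_span_insert] at hmem
  obtain ⟨c, z, hz, hcz⟩ := hmem
  have hsum : (t - c) • b = p + z := by
    rw [NNReal.smul_def] at hcz
    linear_combination (norm := module) hcz
  have hpos : 0 < ⟪x, (t - c) • b⟫ := by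
    rw [hsum, inner_add_right]
    exact add_pos_of_pos_of_nonneg hxp (inner_nonneg_of_mem_span (fun s hs => hx s hs.1) hz)
  rw [inner_smul_right] at hpos
  have hc : 0 < t - c := pos_of_mul_pos_left hpos (hx b hb).le
  have hb' : (t - c)⁻¹ • (t - c) • b ∈ Submodule.span ℝ≥0 (D \ {b}) := by
    rw [hsum]
    exact Submodule.smul_mem _ (⟨(t - c)⁻¹, (inv_pos.mpr hc).le⟩ : ℝ≥0)
      (Submodule.add_mem _ hp hz)
  rw [inv_smul_smul₀ hc.ne'] at hb'
  exact hmin hb'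

theorem coe_span_nnreal_subset (D : Set E) :
    (Submodule.span ℝ≥0 D : Set E) ⊆ Submodule.span ℝ D :=
  SetLike.coe_subset_coe.mpr (Submodule.span_le_restrictScalars ℝ≥0 ℝ D)

theorem repr_nonneg_of_mem_span {M ι : Type*} [AddCommGroup M] [Module ℝ M]
    (α : Module.Basis ι ℝ M) {u : M} (hu : u ∈ Submodule.span ℝ≥0 (Set.range α)) (j : ι) :
    0 ≤ α.repr u j := by
  classical
  induction hu using Submodule.span_induction with
  | mem s hs =>
    obtain ⟨i, rfl⟩ := hs
    rw [α.repr_self, Finsupp.single_apply]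
    positivity
  | zero => simp
  | add u v _ _ hu hv => rw [map_add]; exact add_nonneg hu hv
  | smul c u _ hu => rw [NNReal.smul_def, map_smul]; exact mul_nonneg c.2 hu

end Cone

section PositiveRoots

open NNReal

variable {E : Type*} [NormedAddCommGroup E] [InnerProductSpace ℝ E] {W : Subgroup (E ≃ₗᵢ[ℝ] E)}

/-- The roots of `W` in the open half space of vectors having positive inner product with `x`. -/
def positiveRoots (W : Subgroup (E ≃ₗᵢ[ℝ] E)) (x : E) : Set E := {s ∈ roots W | 0 < ⟪x, s⟫}

theorem exists_regular (W : Subgroup (E ≃ₗᵢ[ℝ] E)) [Finite W] :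
    ∃ x : E, ∀ s ∈ roots W, ⟪x, s⟫ ≠ 0 := by
  obtain ⟨x, -, hx⟩ := exists_generic ⊤ (finite_roots W)
  exact ⟨x, fun s hs h0 =>
    ne_zero_of_norm_eq_one hs.1 (inner_self_eq_zero.mp (hx s hs h0 s trivial))⟩

theorem mem_or_neg_mem_positiveRoots {x : E} (hx : ∀ s ∈ roots W, ⟪x, s⟫ ≠ 0) {v : E}
    (hv : v ∈ roots W) : v ∈ positiveRoots W x ∨ -v ∈ positiveRoots W x := by
  rcases (hx v hv).lt_or_gt with h | h
  · exact .inr ⟨neg_mem_roots hv, by rwa [inner_neg_right, neg_pos]⟩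
  · exact .inl ⟨hv, h⟩

theorem inner_nonpos_of_minimal {x : E} (hx : ∀ s ∈ roots W, ⟪x, s⟫ ≠ 0)
    {D : Set E} (hD : D ⊆ positiveRoots W x) (hspan : positiveRoots W x ⊆ Submodule.span ℝ≥0 D)
    (hmin : ∀ b ∈ D, b ∉ Submodule.span ℝ≥0 (D \ {b})) {a b : E} (ha : a ∈ D) (hb : b ∈ D)
    (hab : a ≠ b) : ⟪a, b⟫ ≤ 0 := by
  by_contra! hpos
  have hDx : ∀ s ∈ D, 0 < ⟪x, s⟫ := fun s hs => (hD hs).2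
  have h2 : 0 < 2 * ⟪a, b⟫ := by positivity
  have hmem := mem_or_neg_mem_positiveRoots hx (apply_mem_roots (hD ha).1.2 (hD hb).1)
  rw [reflect_apply_of_norm (hD ha).1.1, neg_sub] at hmem
  rcases hmem with h | h
  · refine smul_sub_notMem_span hDx hb (hmin b hb) (p := (2 * ⟪a, b⟫) • a) ?_ ?_ 1
      (by rw [one_smul]; exact hspan h)
    · exact Submodule.smul_mem _ (⟨2 * ⟪a, b⟫, h2.le⟩ : ℝ≥0) (Submodule.subset_span ⟨ha, hab⟩)
    · rw [inner_smul_right]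
      exact mul_pos h2 (hDx a ha)
  · exact smul_sub_notMem_span hDx ha (hmin a ha) (Submodule.subset_span ⟨hb, hab.symm⟩)
      (hDx b hb) (2 * ⟪a, b⟫) (hspan h)

theorem exists_basis_positiveRoots [Finite W] (hspan : Submodule.span ℝ (roots W) = ⊤) {x : E}
    (hx : ∀ s ∈ roots W, ⟪x, s⟫ ≠ 0) :
    ∃ (D : Set E) (α : Module.Basis D ℝ E), (∀ i, α i ∈ positiveRoots W x) ∧
      ∀ v ∈ positiveRoots W x, ∀ j, 0 ≤ α.repr v j := by
  obtain ⟨D, hD, hDspan, hmin⟩ := exists_minimal_generators (R := ℝ≥0)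
    (P := positiveRoots W x) ((finite_roots W).subset fun s hs => hs.1)
  have hli : LinearIndependent ℝ ((↑) : D → E) :=
    linearIndependent_of_inner_nonpos (fun i => (hD i.2).2) fun i j hij =>
      inner_nonpos_of_minimal hx hD hDspan hmin i.2 j.2 (Subtype.coe_ne_coe.mpr hij)
  have htop : ⊤ ≤ Submodule.span ℝ (Set.range ((↑) : D → E)) := by
    rw [← hspan, Submodule.span_le, Subtype.range_coe]
    intro s hs
    refine (mem_or_neg_mem_positiveRoots hx hs).elim
      (fun h => coe_span_nnreal_subset D (hDspan h)) fun h => ?_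
    exact neg_neg s ▸ Submodule.neg_mem _ (coe_span_nnreal_subset D (hDspan h))
  refine ⟨D, Module.Basis.mk hli htop, fun i => ?_, fun v hv => repr_nonneg_of_mem_span _ ?_⟩
  · rw [Module.Basis.mk_apply]
    exact hD i.2
  · rw [Module.Basis.coe_mk, Subtype.range_coe]
    exact hDspan hv

variable {ι : Type*} {α : Module.Basis ι ℝ E} {x : E}

/-- Descent on `⟪x, ·⟫` over the orbit of `b` under the simple reflections. -/
theorem exists_apply_eq_basis [Finite ι] [Finite W] (hx : ∀ s ∈ roots W, ⟪x, s⟫ ≠ 0)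
    (hα : ∀ i, α i ∈ positiveRoots W x) (hpos : ∀ v ∈ positiveRoots W x, ∀ j, 0 ≤ α.repr v j)
    {b : E} (hb : b ∈ positiveRoots W x) :
    ∃ w ∈ Subgroup.closure (Set.range fun i => reflect (α i)), ∃ i, w b = α i := by
  cases nonempty_fintype ι
  set W₀ := Subgroup.closure (Set.range fun i => reflect (α i))
  obtain ⟨c, ⟨hc, w, hw, rfl⟩, hmin⟩ := Set.exists_min_image
    {c | c ∈ positiveRoots W x ∧ ∃ w ∈ W₀, c = w b} (fun c => ⟪x, c⟫)
    ((finite_roots W).subset fun c hc => hc.1.1) ⟨b, hb, 1, W₀.one_mem, rfl⟩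
  have hwb : ‖w b‖ = 1 := hc.1.1
  obtain ⟨j, hj⟩ : ∃ j, 0 < ⟪w b, α j⟫ := by
    by_contra! hnonpos
    have hself : ⟪w b, w b⟫ ≤ 0 := by
      rw [inner_eq_sum_repr α]
      exact Finset.sum_nonpos fun j _ =>
        mul_nonpos_of_nonneg_of_nonpos (hpos _ hc j) (hnonpos j)
    exact ne_zero_of_norm_eq_one hwb (real_inner_self_nonpos.mp hself)
  have hrj : reflect (α j) ∈ W₀ := Subgroup.subset_closure ⟨j, rfl⟩
  refine ⟨w, hw, j, ?_⟩
  rcases mem_or_neg_mem_positiveRoots hx (apply_mem_roots (hα j).1.2 hc.1) with h | h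
  · have hle := hmin _ ⟨h, reflect (α j) * w, W₀.mul_mem hrj hw, rfl⟩
    rw [reflect_apply_of_norm (hα j).1.1, inner_sub_right, inner_smul_right,
      real_inner_comm (w b) (α j)] at hle
    have := mul_pos (show 0 < 2 * ⟪w b, α j⟫ by positivity) (hα j).2
    linarith
  · refine eq_basis_of_reflect_nonpos (hα j).1.1 hwb (hpos _ hc) fun k => ?_
    simpa only [map_neg, Finsupp.neg_apply, neg_nonneg] using hpos _ h k

theorem isSimpleSystem_of_positiveRoots [Finite ι] [Finite W]
    (hW : W = Subgroup.closure (reflect '' roots W)) (hx : ∀ s ∈ roots W, ⟪x, s⟫ ≠ 0)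
    (hα : ∀ i, α i ∈ positiveRoots W x) (hpos : ∀ v ∈ positiveRoots W x, ∀ j, 0 ≤ α.repr v j) :
    IsSimpleSystem W α where
  norm_eq_one i := (hα i).1.1
  eq_closure := by
    refine le_antisymm ?_ ((Subgroup.closure_le _).mpr (Set.range_subset_iff.mpr fun i =>
      (hα i).1.2))
    set W₀ := Subgroup.closure (Set.range fun i => reflect (α i))
    have hmem {b : E} (hb : b ∈ positiveRoots W x) : reflect b ∈ W₀ := by
      obtain ⟨w, hw, i, hi⟩ := exists_apply_eq_basis hx hα hpos hb
      rw [← inv_apply_self w b, ← conj_reflect, hi]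
      exact W₀.mul_mem (W₀.mul_mem (W₀.inv_mem hw) (Subgroup.subset_closure ⟨i, rfl⟩))
        (W₀.inv_mem (W₀.inv_mem hw))
    rw [hW, Subgroup.closure_le]
    rintro _ ⟨b, hb, rfl⟩
    exact (mem_or_neg_mem_positiveRoots hx hb).elim hmem fun h => reflect_neg b ▸ hmem h
  dichotomy w hw i := by
    refine (mem_or_neg_mem_positiveRoots hx (apply_mem_roots hw (hα i).1)).imp
      (hpos _) fun h j => ?_
    simpa only [map_neg, Finsupp.neg_apply, neg_nonneg] using hpos _ h j

theorem exists_isSimpleSystem [FiniteDimensional ℝ E] [Finite W]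
    (hW : W = Subgroup.closure (reflect '' roots W)) (hspan : Submodule.span ℝ (roots W) = ⊤) :
    ∃ (D : Set E) (α : Module.Basis D ℝ E), IsSimpleSystem W α := by
  obtain ⟨x, hx⟩ := exists_regular W
  obtain ⟨D, α, hα, hpos⟩ := exists_basis_positiveRoots hspan hx
  have := Module.Finite.finite_basis α
  exact ⟨D, α, isSimpleSystem_of_positiveRoots hW hx hα hpos⟩

end PositiveRoots

section Dihedral

theorem eq_pi_div_of_sin_mul_sin_nonneg {θ : ℝ} (hθ : 0 < θ) (hθ' : θ ≤ Real.pi / 2)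
    (hsign : ∀ k : ℕ, 0 ≤ Real.sin ((k + 1) * θ) * Real.sin (k * θ)) :
    ∃ m : ℕ, 2 ≤ m ∧ θ = Real.pi / m := by
  have hπ := Real.pi_pos
  obtain ⟨m, hm⟩ : ∃ m : ℕ, ⌈Real.pi / θ⌉₊ = m + 1 :=
    Nat.exists_eq_add_one.mpr (Nat.ceil_pos.mpr (div_pos hπ hθ))
  obtain ⟨hlt, hle⟩ := (Nat.ceil_eq_iff m.succ_ne_zero).mp hm
  rw [Nat.succ_sub_one, lt_div_iff₀ hθ] at hlt
  rw [div_le_iff₀ hθ, Nat.cast_succ] at hle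
  have hm1 : 1 ≤ m := by
    rw [Nat.one_le_iff_ne_zero]
    rintro rfl
    norm_num at hle
    linarith
  have hm1' : (1 : ℝ) ≤ m := by exact_mod_cast hm1
  have hsin : 0 ≤ Real.sin ((m + 1) * θ) := nonneg_of_mul_nonneg_left (hsign m)
    (Real.sin_pos_of_pos_of_lt_pi (mul_pos (by linarith) hθ) hlt)
  have heq : (m + 1) * θ = Real.pi := by
    refine (hle.lt_or_eq).elim (fun hgt => ?_) Eq.symm
    have := Real.sin_pos_of_pos_of_lt_pi (sub_pos.mpr hgt) (by nlinarith)
    rw [Real.sin_sub_pi] at this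
    linarith
  refine ⟨m + 1, by omega, ?_⟩
  rw [← heq]
  push_cast
  field_simp

variable {E ι : Type*} [NormedAddCommGroup E] [InnerProductSpace ℝ E]
  {W : Subgroup (E ≃ₗᵢ[ℝ] E)} {α : Module.Basis ι ℝ E}

theorem reflect_sin_smul_add {a b : E} (hb : ‖b‖ = 1) {θ : ℝ} (hab : ⟪b, a⟫ = -Real.cos θ)
    (k : ℕ) : reflect b (Real.sin ((k + 1) * θ) • a + Real.sin (k * θ) • b) =
      Real.sin ((k + 1 + 1) * θ) • b + Real.sin ((k + 1) * θ) • a := by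
  have hsin : Real.sin ((k + 1 + 1) * θ) =
      2 * Real.cos θ * Real.sin ((k + 1) * θ) - Real.sin (k * θ) := by
    rw [show ((k : ℝ) + 1 + 1) * θ = (k + 1) * θ + θ by ring,
      show (k : ℝ) * θ = (k + 1) * θ - θ by ring, Real.sin_add, Real.sin_sub]
    ring
  rw [reflect_apply_of_norm hb, inner_add_right, inner_smul_right, inner_smul_right, hab,
    inner_self_eq_one_of_norm_eq_one hb, hsin]
  module

namespace IsSimpleSystem

theorem inner_nonpos (h : IsSimpleSystem W α) {i j : ι} (hij : i ≠ j) : ⟪α i, α j⟫ ≤ 0 := by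
  have hd := h.dichotomy _ (h.reflect_mem i) j
  have hj : α.repr (reflect (α i) (α j)) j = 1 := by
    rw [repr_reflect _ hij.symm, α.repr_self, Finsupp.single_eq_same]
  have hi := (hd.resolve_right fun hneg => by linarith [hneg j]) i
  rw [reflect_apply_of_norm (h.norm_eq_one i), map_sub, map_smul, α.repr_self, α.repr_self,
    Finsupp.sub_apply, Finsupp.smul_apply, Finsupp.single_eq_same,
    Finsupp.single_eq_of_ne hij, smul_eq_mul] at hi
  linarith

/-- The orbit of two simple roots at angle `π - θ` under the dihedral group they generate. -/
theorem exists_sin_smul_apply_eq (h : IsSimpleSystem W α) {i j : ι} {θ : ℝ}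
    (hij : ⟪α i, α j⟫ = -Real.cos θ) (k : ℕ) :
    ∃ w ∈ W, ∃ l, Real.sin θ • w (α l) =
      Real.sin ((k + 1) * θ) • α i + Real.sin (k * θ) • α j := by
  induction k generalizing i j with
  | zero => exact ⟨1, W.one_mem, i, by simp⟩
  | succ k ih =>
    obtain ⟨w, hw, l, hl⟩ := ih (i := j) (j := i) (by rwa [real_inner_comm])
    refine ⟨reflect (α i) * w, W.mul_mem (h.reflect_mem i) hw, l, ?_⟩
    rw [mul_apply, ← map_smul, hl, reflect_sin_smul_add (h.norm_eq_one i) hij, Nat.cast_succ]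

theorem exists_inner_eq_neg_cos (h : IsSimpleSystem W α) {i j : ι} (hij : i ≠ j) :
    ∃ m : ℕ, 2 ≤ m ∧ ⟪α i, α j⟫ = -Real.cos (Real.pi / m) := by
  have hnonpos := h.inner_nonpos hij
  have hlow : -1 < ⟪α i, α j⟫ := by
    refine lt_of_le_of_ne ?_ fun heq => ?_
    · exact neg_le_of_abs_le (abs_real_inner_le_norm (α i) (α j) |>.trans
        (by rw [h.norm_eq_one, h.norm_eq_one, mul_one]))
    · have hneg := (inner_eq_neg_one_iff_of_norm_eq_one (h.norm_eq_one i) (h.norm_eq_one j)).mp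
        heq.symm
      simpa [Finsupp.single_eq_of_ne hij] using congrArg (fun v => α.repr v i) hneg
  set θ := Real.arccos (-⟪α i, α j⟫)
  have hcos : ⟪α i, α j⟫ = -Real.cos θ := by
    rw [Real.cos_arccos (by linarith) (by linarith), neg_neg]
  have hθ : 0 < θ := Real.arccos_pos.mpr (by linarith)
  have hθ' : θ ≤ Real.pi / 2 := Real.arccos_le_pi_div_two.mpr (by linarith)
  have hsin : 0 < Real.sin θ := Real.sin_pos_of_pos_of_lt_pi hθ (by linarith [Real.pi_pos])
  obtain ⟨m, hm, hθm⟩ := eq_pi_div_of_sin_mul_sin_nonneg hθ hθ' fun k => by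
    obtain ⟨w, hw, l, hl⟩ := h.exists_sin_smul_apply_eq hcos k
    have hi : Real.sin θ * α.repr (w (α l)) i = Real.sin ((k + 1) * θ) := by
      simpa [Finsupp.single_eq_of_ne hij] using congrArg (fun v => α.repr v i) hl
    have hj : Real.sin θ * α.repr (w (α l)) j = Real.sin (k * θ) := by
      simpa [Finsupp.single_eq_of_ne hij.symm] using congrArg (fun v => α.repr v j) hl
    rw [← hi, ← hj, mul_mul_mul_comm]
    refine mul_nonneg (mul_pos hsin hsin).le ?_
    rcases h.dichotomy w hw l with hd | hd
    · exact mul_nonneg (hd i) (hd j)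
    · exact mul_nonneg_of_nonpos_of_nonpos (hd i) (hd j)
  exact ⟨m, hm, by rw [hcos, hθm]⟩

end IsSimpleSystem

end Dihedral

/-! ### Diagram automorphisms that move few nodes -/

section Rank

variable {K V : Type*} [Field K] [AddCommGroup V] [Module K V]

theorem finrank_add_card_le {ι : Type*} [Finite ι] (α : Module.Basis ι K V) {U : Submodule K V}
    {P : Finset ι} (hU : ∀ x ∈ U, (∀ i ∉ P, α.repr x i = 0) → x = 0) :
    Module.finrank K U + P.card ≤ Module.finrank K V := by
  have : Module.Finite K V := .of_basis α
  have hcard := finrank_span_eq_card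
    (α.linearIndependent.comp ((↑) : P → ι) Subtype.val_injective)
  rw [Set.range_comp, Subtype.range_coe_subtype, Finset.setOfPred_mem, Fintype.card_coe] at hcard
  rw [← hcard]
  refine Submodule.finrank_add_finrank_le_of_disjoint (Submodule.disjoint_def.mpr ?_)
  exact fun x hx hxP => hU x hx fun i hi => Finsupp.notMem_support_iff.mp
    fun h => hi (α.mem_span_image.mp hxP h)

theorem finrank_le_add_of_ker_le {F : Type*} [AddCommGroup F] [Module K F] [FiniteDimensional K V]
    [FiniteDimensional K F] (L : V →ₗ[K] F) {U : Submodule K V} (h : LinearMap.ker L ≤ U) :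
    Module.finrank K V ≤ Module.finrank K U + Module.finrank K F := by
  rw [← L.finrank_range_add_finrank_ker, add_comm]
  exact add_le_add (Submodule.finrank_mono h) (Submodule.finrank_le _)

end Rank

section Permuting

variable {E ι : Type*} [NormedAddCommGroup E] [InnerProductSpace ℝ E]
  {α : Module.Basis ι ℝ E} {a : E ≃ₗᵢ[ℝ] E} {σ : Equiv.Perm ι}

theorem repr_apply_perm (hσ : ∀ i, a (α i) = α (σ i)) (x : E) (i : ι) :
    α.repr (a x) (σ i) = α.repr x i := by
  have h : α.coord (σ i) ∘ₗ (a.toLinearEquiv : E →ₗ[ℝ] E) = α.coord i :=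
    α.ext fun j => by
      classical simp [hσ, Finsupp.single_apply]
  exact LinearMap.congr_fun h x

theorem apply_eq_self_iff_repr (hσ : ∀ i, a (α i) = α (σ i)) {x : E} :
    a x = x ↔ ∀ i, α.repr x (σ i) = α.repr x i := by
  refine ⟨fun h i => by rw [← repr_apply_perm hσ x i, h], fun h => α.ext_elem fun j => ?_⟩
  obtain ⟨i, rfl⟩ := σ.surjective j
  rw [repr_apply_perm hσ, h]

theorem pow_apply_basis (hσ : ∀ i, a (α i) = α (σ i)) (k : ℕ) (i : ι) :
    (a ^ k) (α i) = α ((σ ^ k) i) := by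
  induction k with
  | zero => rfl
  | succ k ih => rw [pow_succ', mul_apply, ih, hσ, pow_succ', Equiv.Perm.mul_apply]

theorem inv_apply_basis (hσ : ∀ i, a (α i) = α (σ i)) (i : ι) : a⁻¹ (α i) = α (σ⁻¹ i) :=
  inv_apply_eq.mpr (by rw [hσ]; simp)

theorem eq_one_of_perm_eq_one (hσ : ∀ i, a (α i) = α (σ i)) (h : σ = 1) : a = 1 :=
  Module.Basis.ext_linearIsometryEquiv α fun i => by rw [hσ, h]; rfl

theorem isOfFinOrder_of_perm [Finite ι] (hσ : ∀ i, a (α i) = α (σ i)) : IsOfFinOrder a := by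
  obtain ⟨k, hk, h⟩ := isOfFinOrder_iff_pow_eq_one.mp (isOfFinOrder_of_finite σ)
  exact isOfFinOrder_iff_pow_eq_one.mpr ⟨k, hk, eq_one_of_perm_eq_one (pow_apply_basis hσ k) h⟩

end Permuting

section FewMoved

variable {ι : Type*} {σ : Equiv.Perm ι}

/-- `σ` is the transposition of `x` and `x'`. -/
def IsSwapOn (σ : Equiv.Perm ι) (x x' : ι) : Prop :=
  x ≠ x' ∧ σ x = x' ∧ σ x' = x ∧ ∀ i, i ≠ x → i ≠ x' → σ i = i

/-- `σ` is the three-cycle `x ↦ y ↦ z ↦ x`. -/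
def IsThreeCycleOn (σ : Equiv.Perm ι) (x y z : ι) : Prop :=
  x ≠ y ∧ y ≠ z ∧ z ≠ x ∧ σ x = y ∧ σ y = z ∧ σ z = x ∧
    ∀ i, i ≠ x → i ≠ y → i ≠ z → σ i = i

/-- `σ` is the product of the disjoint transpositions of `x` and `x'` and of `y` and `y'`. -/
def IsDoubleSwapOn (σ : Equiv.Perm ι) (x x' y y' : ι) : Prop :=
  x ≠ x' ∧ x ≠ y ∧ x ≠ y' ∧ x' ≠ y ∧ x' ≠ y' ∧ y ≠ y' ∧
  σ x = x' ∧ σ x' = x ∧ σ y = y' ∧ σ y' = y ∧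
    ∀ i, i ≠ x → i ≠ x' → i ≠ y → i ≠ y' → σ i = i

theorem IsDoubleSwapOn.symm {x x' y y' : ι} (h : IsDoubleSwapOn σ x x' y y') :
    IsDoubleSwapOn σ y y' x x' := by
  obtain ⟨xx', xy, xy', x'y, x'y', yy', hx, hx', hy, hy', hfix⟩ := h
  exact ⟨yy', xy.symm, x'y.symm, xy'.symm, x'y'.symm, xx', hy, hy', hx, hx',
    fun i h1 h2 h3 h4 => hfix i h3 h4 h1 h2⟩

theorem IsDoubleSwapOn.flip {x x' y y' : ι} (h : IsDoubleSwapOn σ x x' y y') :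
    IsDoubleSwapOn σ x x' y' y := by
  obtain ⟨xx', xy, xy', x'y, x'y', yy', hx, hx', hy, hy', hfix⟩ := h
  exact ⟨xx', xy', xy, x'y', x'y, yy'.symm, hx, hx', hy', hy,
    fun i h1 h2 h3 h4 => hfix i h1 h2 h4 h3⟩

/-- `P` contains no orbit of `σ`, phrased through functions constant on the orbits. When `σ`
permutes a basis, the cardinality of `P` is then a lower bound for the codimension of its fixed
space. -/
def ContainsNoOrbit (σ : Equiv.Perm ι) (P : Finset ι) : Prop :=
  ∀ f : ι → ℝ, (∀ i, f (σ i) = f i) → (∀ i ∉ P, f i = 0) → f = 0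

theorem containsNoOrbit_of_forall_mem {P : Finset ι}
    (h : ∀ f : ι → ℝ, (∀ i, f (σ i) = f i) → (∀ i ∉ P, f i = 0) → ∀ i ∈ P, f i = 0) :
    ContainsNoOrbit σ P := fun f hf h0 => funext fun i => by
  by_cases hi : i ∈ P
  exacts [h f hf h0 i hi, h0 i hi]

theorem exists_isThreeCycleOn (hσ : ∀ P, ContainsNoOrbit σ P → P.card ≤ 2) {x : ι}
    (hx : σ (σ x) ≠ x) : ∃ y z, IsThreeCycleOn σ x y z := by
  classical
  have hx1 : σ x ≠ x := fun h => hx (by rw [h, h])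
  have hx2 : σ (σ x) ≠ σ x := σ.injective.ne hx1
  have hx3 : σ (σ (σ x)) = x := by
    by_contra hx3
    have hcard := hσ {x, σ x, σ (σ x)} <| containsNoOrbit_of_forall_mem fun f hf h0 => by
      have h : f (σ (σ (σ x))) = 0 :=
        h0 _ (by simp [hx3, σ.injective.ne hx, σ.injective.ne hx2])
      simp_all
    rw [Finset.card_eq_three.mpr ⟨_, _, _, hx1.symm, hx.symm, hx2.symm, rfl⟩] at hcard
    omega
  refine ⟨σ x, σ (σ x), hx1.symm, hx2.symm, hx, rfl, rfl, hx3, fun i h1 h2 h3 => ?_⟩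
  by_contra hi
  have hcard := hσ {i, x, σ x} <| containsNoOrbit_of_forall_mem fun f hf h0 => by
    have hz : f (σ (σ x)) = 0 := h0 _ (by simp [hx, hx2, h3.symm])
    have hi0 : f (σ i) = 0 := h0 _ (by
      have : σ i ≠ x := fun h => h3 (σ.injective (by rw [h, hx3]))
      simp [hi, this, h1])
    simp_all
  rw [Finset.card_eq_three.mpr ⟨_, _, _, h1, h2, hx1.symm, rfl⟩] at hcard
  omega

theorem exists_isSwapOn_or_isDoubleSwapOn (hσ : ∀ P, ContainsNoOrbit σ P → P.card ≤ 2)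
    (hinv : ∀ x, σ (σ x) = x) {x : ι} (hx : σ x ≠ x) :
    (∃ x', IsSwapOn σ x x') ∨ ∃ x' y y', IsDoubleSwapOn σ x x' y y' := by
  classical
  by_cases hsw : ∀ i, i ≠ x → i ≠ σ x → σ i = i
  · exact .inl ⟨σ x, hx.symm, rfl, hinv x, hsw⟩
  push Not at hsw
  obtain ⟨y, hyx, hyx', hy⟩ := hsw
  have hxy' : x ≠ σ y := fun h => hyx' (by rw [h, hinv])
  have hx'y' : σ x ≠ σ y := σ.injective.ne hyx.symm
  refine .inr ⟨σ x, y, σ y, hx.symm, hyx.symm, hxy', hyx'.symm, hx'y', hy.symm, rfl, hinv x, rfl,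
    hinv y, fun i h1 h2 h3 h4 => ?_⟩
  by_contra hi
  have hcard := hσ {i, x, y} <| containsNoOrbit_of_forall_mem fun f hf h0 => by
    have hi0 : f (σ i) = 0 := h0 _ (by
      have hix : σ i ≠ x := fun h => h2 (by rw [← h, hinv])
      have hiy : σ i ≠ y := fun h => h4 (by rw [← h, hinv])
      simp [hi, hix, hiy])
    have hx0 : f (σ x) = 0 := h0 _ (by simp [hx, h2.symm, hyx'.symm])
    have hy0 : f (σ y) = 0 := h0 _ (by simp [hy, h4.symm, hxy'.symm])
    simp_all
  rw [Finset.card_eq_three.mpr ⟨_, _, _, h1, h3, hyx.symm, rfl⟩] at hcard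
  omega

end FewMoved

section FixedSpace

variable {n : ℕ} {ι : Type*} [Finite ι] {α : Module.Basis ι ℝ (EuclideanSpace ℝ (Fin n))}
  {a : OrthGroup n} {σ : Equiv.Perm ι} {P : Finset ι}

theorem finrank_fixedSpace_add_card_le (hσ : ∀ i, a (α i) = α (σ i)) (hP : ContainsNoOrbit σ P) :
    Module.finrank ℝ (fixedSpace a) + P.card ≤ n := by
  have h := finrank_add_card_le α (U := fixedSpace a) (P := P) fun x hx h0 =>
    α.repr.map_eq_zero_iff.mp (DFunLike.coe_injective
      (hP _ ((apply_eq_self_iff_repr hσ).mp (mem_fixedSpace.mp hx)) h0))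
  rwa [finrank_euclideanSpace_fin] at h

theorem finrank_fixedSpace_add_card_eq (hσ : ∀ i, a (α i) = α (σ i)) (hP : ContainsNoOrbit σ P)
    (hP' : ∀ f : ι → ℝ, (∀ i ∈ P, f (σ i) = f i) → ∀ i, f (σ i) = f i) :
    Module.finrank ℝ (fixedSpace a) + P.card = n := by
  refine le_antisymm (finrank_fixedSpace_add_card_le hσ hP) ?_
  have h := finrank_le_add_of_ker_le (U := fixedSpace a)
    (LinearMap.pi fun i : P => α.coord (σ i) - α.coord i) fun x hx =>
      mem_fixedSpace.mpr ((apply_eq_self_iff_repr hσ).mpr (hP' _ fun i hi =>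
        sub_eq_zero.mp (congrFun (LinearMap.mem_ker.mp hx) ⟨i, hi⟩)))
  rwa [finrank_euclideanSpace_fin, Module.finrank_fintype_fun_eq_card, Fintype.card_coe] at h

theorem IsSwapOn.isReflection {x x' : ι} (h : IsSwapOn σ x x') (hσ : ∀ i, a (α i) = α (σ i)) :
    IsReflection a := by
  obtain ⟨hne, hx, hx', hfix⟩ := h
  refine finrank_fixedSpace_add_card_eq (P := {x}) hσ
    (containsNoOrbit_of_forall_mem fun f hf h0 => ?_) fun f hf i => ?_
  · have h1 := h0 x' (by simpa using hne.symm)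
    have h2 := hf x
    simp_all
  · have h1 := hf x (by simp)
    rcases eq_or_ne i x with rfl | hix
    · exact h1
    rcases eq_or_ne i x' with rfl | hix'
    · rw [hx', ← h1, hx]
    · rw [hfix i hix hix']

theorem IsThreeCycleOn.isRotation {x y z : ι} (h : IsThreeCycleOn σ x y z)
    (hσ : ∀ i, a (α i) = α (σ i)) : IsRotation a := by
  classical
  obtain ⟨hxy, hyz, hzx, hx, hy, hz, hfix⟩ := h
  rw [IsRotation, ← Finset.card_pair hxy]
  refine finrank_fixedSpace_add_card_eq hσ
    (containsNoOrbit_of_forall_mem fun f hf h0 => ?_) fun f hf i => ?_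
  · have h1 := h0 z (by simp [hzx, hyz.symm])
    have h2 := hf y
    have h3 := hf x
    simp_all
  · have h1 := hf x (by simp)
    have h2 := hf y (by simp)
    rcases eq_or_ne i x with rfl | hix
    · exact h1
    rcases eq_or_ne i y with rfl | hiy
    · exact h2
    rcases eq_or_ne i z with rfl | hiz
    · rw [hz, ← h1, hx, ← h2, hy]
    · rw [hfix i hix hiy hiz]

theorem IsDoubleSwapOn.isRotation {x x' y y' : ι} (h : IsDoubleSwapOn σ x x' y y')
    (hσ : ∀ i, a (α i) = α (σ i)) : IsRotation a := by
  classical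
  obtain ⟨hxx', hxy, hxy', hx'y, hx'y', hyy', hx, hx', hy, hy', hfix⟩ := h
  rw [IsRotation, ← Finset.card_pair hxy]
  refine finrank_fixedSpace_add_card_eq hσ
    (containsNoOrbit_of_forall_mem fun f hf h0 => ?_) fun f hf i => ?_
  · have h1 := h0 x' (by simp [hxx'.symm, hx'y])
    have h2 := h0 y' (by simp [hxy'.symm, hyy'.symm])
    have h3 := hf x
    have h4 := hf y
    simp_all
  · have h1 := hf x (by simp)
    have h2 := hf y (by simp)
    rcases eq_or_ne i x with rfl | hix
    · exact h1
    rcases eq_or_ne i x' with rfl | hix'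
    · rw [hx', ← h1, hx]
    rcases eq_or_ne i y with rfl | hiy
    · exact h2
    rcases eq_or_ne i y' with rfl | hiy'
    · rw [hy', ← h2, hy]
    · rw [hfix i hix hix' hiy hiy']

theorem perm_cases_of_finrank_le (hσ : ∀ i, a (α i) = α (σ i))
    (hn : n ≤ Module.finrank ℝ (fixedSpace a) + 2) :
    σ = 1 ∨ (∃ x x', IsSwapOn σ x x') ∨ (∃ x y z, IsThreeCycleOn σ x y z) ∨
      ∃ x x' y y', IsDoubleSwapOn σ x x' y y' := by
  have hcard : ∀ P, ContainsNoOrbit σ P → P.card ≤ 2 := fun P hP => by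
    have := finrank_fixedSpace_add_card_le hσ hP
    omega
  by_cases hlong : ∃ x, σ (σ x) ≠ x
  · obtain ⟨x, hx⟩ := hlong
    exact .inr (.inr (.inl ⟨x, exists_isThreeCycleOn hcard hx⟩))
  push Not at hlong
  by_cases hx : ∃ x, σ x ≠ x
  · obtain ⟨x, hx⟩ := hx
    rcases exists_isSwapOn_or_isDoubleSwapOn hcard hlong hx with h | h
    exacts [.inr (.inl ⟨x, h⟩), .inr (.inr (.inr ⟨x, h⟩))]
  · push Not at hx
    exact .inl (Equiv.ext hx)

end FixedSpace

section Extension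

theorem exists_mul_zpow_of_mem_sup {G : Type*} [Group G] {H : Subgroup G} {a : G}
    (ha : a ∈ Subgroup.normalizer (H : Set G)) {g : G} (hg : g ∈ H ⊔ Subgroup.zpowers a) :
    ∃ w ∈ H, ∃ t : ℤ, g = w * a ^ t := by
  rw [← SetLike.mem_coe, Subgroup.coe_mul_of_right_le_normalizer_left _ _
    (Subgroup.zpowers_le.mpr ha)] at hg
  obtain ⟨w, hw, _, ⟨t, rfl⟩, rfl⟩ := hg
  exact ⟨w, hw, t, rfl⟩

theorem finite_sup_zpowers {G : Type*} [Group G] {H : Subgroup G} [Finite H] {a : G}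
    (ha : a ∈ Subgroup.normalizer (H : Set G)) (hfin : IsOfFinOrder a) :
    Finite ↥(H ⊔ Subgroup.zpowers a) := by
  refine Set.Finite.to_subtype (s := ((H ⊔ Subgroup.zpowers a : Subgroup G) : Set G)) ?_
  rw [Subgroup.coe_mul_of_right_le_normalizer_left _ _ (Subgroup.zpowers_le.mpr ha)]
  exact (Set.toFinite (H : Set G)).mul (finite_zpowers.mpr hfin)

variable {n : ℕ} {W : Subgroup (OrthGroup n)} {a h w : OrthGroup n}

theorem mem_extendedGroup : h ∈ extendedGroup W h := Subgroup.subset_closure (.inr rfl)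

theorem orientationPreserving_le_extendedGroup : orientationPreserving W ≤ extendedGroup W h :=
  fun _ hg => Subgroup.subset_closure (.inl hg)

theorem extendedGroup_le {G : Subgroup (OrthGroup n)} :
    extendedGroup W h ≤ G ↔ orientationPreserving W ≤ G ∧ h ∈ G := by
  rw [extendedGroup, Subgroup.closure_le, Set.union_subset_iff, Set.singleton_subset_iff]
  rfl

theorem extendedGroup_le_sup (hw : w ∈ W) :
    extendedGroup W (w * a) ≤ W ⊔ Subgroup.zpowers a :=
  extendedGroup_le.mpr ⟨inf_le_left.trans le_sup_left, mul_mem (Subgroup.mem_sup_left hw)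
    (Subgroup.mem_sup_right (Subgroup.mem_zpowers a))⟩

theorem extendedGroup_eq_orientationPreserving_sup
    (ha : a ∈ Subgroup.normalizer (W : Set (OrthGroup n))) (ha2 : a * a = 1) (hw : w ∈ W)
    (hdet : isometryDet _ (w * a) = 1) :
    extendedGroup W (w * a) = orientationPreserving (W ⊔ Subgroup.zpowers a) := by
  refine le_antisymm (le_inf (extendedGroup_le_sup hw) (extendedGroup_le.mpr
    ⟨inf_le_right, hdet⟩)) fun g hg => ?_
  rw [mem_orientationPreserving] at hg
  obtain ⟨hg, hgdet⟩ := hg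
  obtain ⟨w', hw', t, rfl⟩ := exists_mul_zpow_of_mem_sup ha hg
  rcases Int.even_or_odd' t with ⟨k, rfl | rfl⟩
  · have heven : a ^ (2 * k) = 1 := by rw [zpow_mul, zpow_two, ha2, one_zpow]
    rw [heven, mul_one] at hgdet ⊢
    exact orientationPreserving_le_extendedGroup ⟨hw', hgdet⟩
  · have hodd : w' * a ^ (2 * k + 1) = w' * w⁻¹ * (w * a) := by
      rw [zpow_add, zpow_mul, zpow_two, ha2, one_zpow]
      group
    rw [hodd] at hgdet ⊢
    rw [map_mul, hdet, mul_one] at hgdet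
    exact mul_mem (orientationPreserving_le_extendedGroup ⟨W.mul_mem hw' (W.inv_mem hw), hgdet⟩)
      mem_extendedGroup

theorem isReflectionGroup_sup_zpowers (hW : IsReflectionGroup W)
    (ha : a ∈ Subgroup.normalizer (W : Set (OrthGroup n))) (hr : IsReflection a)
    (hfin : IsOfFinOrder a) : IsReflectionGroup (W ⊔ Subgroup.zpowers a) := by
  have := hW.1
  obtain ⟨-, S, hS, hWS⟩ := hW
  refine ⟨finite_sup_zpowers ha hfin, S ∪ {a}, ?_, ?_⟩
  · rintro s (hs | rfl)
    exacts [hS s hs, hr]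
  · rw [Subgroup.closure_union, ← hWS, Subgroup.zpowers_eq_closure]

theorem exists_eq_orientationPreserving_of_isReflection (hW : IsReflectionGroup W)
    (ha : a ∈ Subgroup.normalizer (W : Set (OrthGroup n))) (hr : IsReflection a) (hw : w ∈ W)
    (hdet : isometryDet _ (w * a) = 1) :
    ∃ W' : Subgroup (OrthGroup n), IsReflectionGroup W' ∧
      extendedGroup W (w * a) = orientationPreserving W' := by
  have ha2 : a * a = 1 := by
    obtain ⟨v, -, rfl⟩ := isReflection_iff.mp hr
    exact reflect_mul_self v
  exact ⟨_, isReflectionGroup_sup_zpowers hW ha hr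
    (isOfFinOrder_iff_pow_eq_one.mpr ⟨2, two_pos, by rw [pow_two, ha2]⟩),
    extendedGroup_eq_orientationPreserving_sup ha ha2 hw hdet⟩

variable {ι : Type*} [Finite ι] {α : Module.Basis ι ℝ (EuclideanSpace ℝ (Fin n))}
  {σ : Equiv.Perm ι}

theorem IsSimpleSystem.finrank_fixedSpace_mul_le [Finite W] (hα : IsSimpleSystem W α) (hw : w ∈ W)
    (hσ : ∀ i, a (α i) = α (σ i)) :
    Module.finrank ℝ (fixedSpace (w * a)) ≤ Module.finrank ℝ (fixedSpace a) := by
  obtain ⟨w', hw', a', τ, hτ, heq, c, hc⟩ := hα.exists_eq_mul_perm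
    (mul_mem (Subgroup.le_normalizer hw) (hα.mem_normalizer_of_perm hσ))
  have hmem : a' * a⁻¹ ∈ W := by
    rw [← inv_mul_eq_iff_eq_mul] at heq
    rw [← heq, mul_assoc, mul_inv_cancel_right]
    exact mul_mem (inv_mem hw') hw
  obtain rfl : a' = a := mul_inv_eq_one.mp <| hα.eq_one_of_perm (σ := τ * σ⁻¹) hmem fun i => by
    rw [mul_apply, inv_apply_basis hσ, hτ, Equiv.Perm.mul_apply]
  rw [← c.toLinearEquiv.finrank_map_eq (fixedSpace (w * a'))]
  exact Submodule.finrank_mono (Submodule.map_le_iff_le_comap.mpr hc)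

/-- The diagram automorphism `σ` is neither trivial, since `h ∉ W`, nor a transposition, since the
latter is induced by a reflection. -/
theorem IsExtendingRotation.exists_perm (hW : IsReflectionGroup W) (hα : IsSimpleSystem W α)
    (hh : IsExtendingRotation W h) :
    ∃ w ∈ W, ∃ (a : OrthGroup n) (σ : Equiv.Perm ι), (∀ i, a (α i) = α (σ i)) ∧ h = w * a ∧
      ((∃ x y z, IsThreeCycleOn σ x y z) ∨ ∃ x x' y y', IsDoubleSwapOn σ x x' y y') := by
  have := hW.1
  obtain ⟨w, hw, a, σ, hσ, rfl, -⟩ :=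
    hα.exists_eq_mul_perm (Subgroup.mem_normalizer_iff.mpr hh.normalizes)
  refine ⟨w, hw, a, σ, hσ, rfl, ?_⟩
  have hrank := hα.finrank_fixedSpace_mul_le hw hσ
  rcases perm_cases_of_finrank_le hσ (by linarith [hh.isRotation.ge]) with hone | ⟨x, x', hswap⟩ | h
  · exact absurd (by rwa [eq_one_of_perm_eq_one hσ hone, mul_one]) hh.notMem
  · exact absurd (exists_eq_orientationPreserving_of_isReflection hW (hα.mem_normalizer_of_perm hσ)
      (hswap.isReflection hσ) hw hh.mem_SO) hh.not_orientationPreserving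
  · exact h

end Extension

/-! ### Positive definite diagrams with a symmetry -/

section Diagram

variable {E ι : Type*} [NormedAddCommGroup E] [InnerProductSpace ℝ E] {α : Module.Basis ι ℝ E}

/-- A connected Coxeter diagram, given by unit vectors `α i`; two members are bonded if they are not
orthogonal. Only the angles `π / 2`, `π / 3` and `π / 4` matter below, so all larger bond labels are
lumped together in the single estimate `⟪α i, α j⟫ ≤ -3 / 4`. -/
structure IsDiagram (α : Module.Basis ι ℝ E) : Prop where
  inner_self : ∀ i, ⟪α i, α i⟫ = 1
  inner_cases : ∀ i j, i ≠ j → ⟪α i, α j⟫ = 0 ∨ ⟪α i, α j⟫ = -(1 / 2) ∨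
    ⟪α i, α j⟫ = -(√2 / 2) ∨ ⟪α i, α j⟫ ≤ -(3 / 4)
  connected : ∀ S : Set ι, S.Nonempty → (∀ i ∈ S, ∀ j ∉ S, ⟪α i, α j⟫ = 0) → S = Set.univ

/-- The squared length of the linear combination `∑ c • α i` over the pairs `(c, i)` in a list,
expanded in terms of the Gram matrix. -/
noncomputable def gramForm (α : Module.Basis ι ℝ E) : List (ℝ × ι) → ℝ
  | [] => 0
  | p :: l => p.1 * p.1 * ⟪α p.2, α p.2⟫ +
      (l.map fun q => 2 * (p.1 * q.1) * ⟪α p.2, α q.2⟫).sum + gramForm α l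

theorem gramForm_eq_inner (α : Module.Basis ι ℝ E) (l : List (ℝ × ι)) :
    gramForm α l = ⟪(l.map fun q => q.1 • α q.2).sum, (l.map fun q => q.1 • α q.2).sum⟫ := by
  induction l with
  | nil => simp [gramForm]
  | cons p l ih =>
    have hcross (v : E) (c : ℝ) (l : List (ℝ × ι)) :
        (l.map fun q => 2 * (c * q.1) * ⟪v, α q.2⟫).sum =
          2 * (c * ⟪v, (l.map fun q => q.1 • α q.2).sum⟫) := by
      induction l with
      | nil => simp
      | cons q l ih =>
        simp only [List.map_cons, List.sum_cons, ih, inner_add_right, inner_smul_right]; ring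
    rw [gramForm, hcross, ih, List.map_cons, List.sum_cons]
    simp only [inner_add_left, inner_add_right, inner_smul_left, inner_smul_right, conj_trivial]
    rw [real_inner_comm (α p.2) (List.sum _)]
    ring

theorem gramForm_pos (α : Module.Basis ι ℝ E) {c : ℝ} (hc : c ≠ 0) {x : ι} {l : List (ℝ × ι)}
    (hx : ∀ p ∈ l, x ≠ p.2) : 0 < gramForm α ((c, x) :: l) := by
  rw [gramForm_eq_inner, real_inner_self_pos]
  have hl : α.repr (l.map fun q => q.1 • α q.2).sum x = 0 := by
    induction l with
    | nil => simp
    | cons q l ih =>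
      rw [List.forall_mem_cons] at hx
      simp [ih hx.2, Finsupp.single_eq_of_ne hx.1]
  intro h0
  have hrepr := congrArg (fun v => α.repr v x) h0
  simp only [List.map_cons, List.sum_cons, map_add, Finsupp.add_apply, hl, map_smul, α.repr_self,
    Finsupp.smul_apply, Finsupp.single_eq_same, map_zero, Finsupp.zero_apply, smul_eq_mul, mul_one,
    add_zero] at hrepr
  exact hc hrepr

namespace IsDiagram

variable (h : IsDiagram α)

include h

theorem inner_nonpos {i j : ι} (hij : i ≠ j) : ⟪α i, α j⟫ ≤ 0 := by
  have := Real.sqrt_nonneg 2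
  rcases h.inner_cases i j hij with h | h | h | h <;> linarith

theorem inner_le_of_ne_zero {i j : ι} (hij : i ≠ j) (h0 : ⟪α i, α j⟫ ≠ 0) :
    ⟪α i, α j⟫ ≤ -(1 / 2) := by
  have := Real.one_lt_sqrt_two
  rcases h.inner_cases i j hij with h | h | h | h
  · exact absurd h h0
  all_goals linarith

theorem inner_eq_or_le_of_ne_zero {i j : ι} (hij : i ≠ j) (h0 : ⟪α i, α j⟫ ≠ 0) :
    ⟪α i, α j⟫ = -(1 / 2) ∨ ⟪α i, α j⟫ ≤ -(√2 / 2) := by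
  have := Real.sqrt_two_lt_three_halves
  rcases h.inner_cases i j hij with h | h | h | h
  · exact absurd h h0
  · exact .inl h
  · exact .inr h.le
  · exact .inr (by linarith)

theorem exists_bond {l : List ι} {i₀ j₀ : ι} (hi : i₀ ∈ l) (hj : j₀ ∉ l) :
    ∃ i ∈ l, ∃ j ∉ l, ⟪α i, α j⟫ ≠ 0 := by
  by_contra! hl
  have huniv := h.connected {i | i ∈ l} ⟨i₀, hi⟩ hl
  exact hj (huniv ▸ Set.mem_univ j₀ : j₀ ∈ {i | i ∈ l})

theorem sum_inner_nonpos_of_two_bonds {s : Finset ι} {i a b : ι} (hi : i ∈ s) (ha : a ∈ s)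
    (hb : b ∈ s) (hia : i ≠ a) (hib : i ≠ b) (hab : a ≠ b) (ha0 : ⟪α i, α a⟫ ≠ 0)
    (hb0 : ⟪α i, α b⟫ ≠ 0) : ∑ j ∈ s, ⟪α i, α j⟫ ≤ 0 := by
  classical
  rw [← Finset.add_sum_erase _ _ hi,
    ← Finset.add_sum_erase _ _ (Finset.mem_erase.mpr ⟨hia.symm, ha⟩),
    ← Finset.add_sum_erase _ _ (Finset.mem_erase.mpr ⟨hab.symm,
      Finset.mem_erase.mpr ⟨hib.symm, hb⟩⟩), h.inner_self]
  have hrest : ∑ j ∈ ((s.erase i).erase a).erase b, ⟪α i, α j⟫ ≤ 0 :=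
    Finset.sum_nonpos fun j hj => h.inner_nonpos (Finset.ne_of_mem_erase
      (Finset.mem_of_mem_erase (Finset.mem_of_mem_erase hj))).symm
  linarith [h.inner_le_of_ne_zero hia ha0, h.inner_le_of_ne_zero hib hb0]

/-- Each of its two bonds costs a member of a cycle at least half of its squared length, so the sum
of the members would have nonpositive squared length. -/
theorem no_cycle {l : List ι} (hl : l.Nodup) (h3 : 3 ≤ l.length)
    (hb : List.Forall₂ (fun i j => ⟪α i, α j⟫ ≠ 0) l (l.rotate 1)) : False := by
  have : NeZero l.length := ⟨by omega⟩
  let v : Fin l.length ↪ ι := ⟨l.get, List.nodup_iff_injective_get.mp hl⟩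
  have hbond (k : Fin l.length) : ⟪α (v k), α (v (k + 1))⟫ ≠ 0 := by
    have := (List.forall₂_iff_get.mp hb).2 k k.2 (by simp)
    rw [List.get_rotate_one] at this
    rwa [show k + 1 = ⟨(k + 1) % l.length, Nat.mod_lt _ (by omega)⟩ by
      ext; rw [Fin.val_add, Fin.val_one', Nat.add_mod_mod]]
  have h1 : (1 : Fin l.length) ≠ 0 := by
    rw [ne_eq, Fin.ext_iff, Fin.val_one', Nat.mod_eq_of_lt (by omega)]; simp
  have h2 : (1 + 1 : Fin l.length) ≠ 0 := by
    rw [ne_eq, Fin.ext_iff, Fin.val_add, Fin.val_one', Nat.mod_eq_of_lt (by omega : 1 < l.length),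
      Nat.mod_eq_of_lt (by omega)]; simp
  have hrow (k : Fin l.length) : ∑ j, ⟪α (v k), α (v j)⟫ ≤ 0 := by
    rw [← Finset.sum_map Finset.univ v fun j => ⟪α (v k), α j⟫]
    refine h.sum_inner_nonpos_of_two_bonds (a := v (k + 1)) (b := v (k - 1)) (by simp) (by simp)
      (by simp) ?_ ?_ ?_ (hbond k) ?_
    · rwa [v.injective.ne_iff, ne_eq, left_eq_add]
    · rwa [v.injective.ne_iff, ne_comm, ne_eq, sub_eq_self]
    · rwa [v.injective.ne_iff, ne_comm, ne_eq, sub_eq_iff_eq_add, add_assoc, left_eq_add]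
    · have := hbond (k - 1)
      rwa [sub_add_cancel, real_inner_comm] at this
  have hsum : ∑ k, α (v k) ≠ 0 := fun h0 => one_ne_zero <|
    Fintype.linearIndependent_iff.mp (α.linearIndependent.comp v v.injective) 1
      (by simpa using h0) 0
  refine (real_inner_self_pos.mpr hsum).not_ge ?_
  rw [sum_inner]
  exact Finset.sum_nonpos fun k _ => by rw [inner_sum]; exact hrow k

/-! The coefficients below span the radical of the Gram matrix of the affine diagram in question. -/

theorem no_four_star {c x y z w : ι} (hd : [c, x, y, z, w].Nodup) (h1 : ⟪α c, α x⟫ ≠ 0)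
    (h2 : ⟪α c, α y⟫ ≠ 0) (h3 : ⟪α c, α z⟫ ≠ 0) (h4 : ⟪α c, α w⟫ ≠ 0) : False := by
  simp only [List.nodup_cons, List.mem_cons, List.not_mem_nil, or_false, not_or] at hd
  obtain ⟨⟨cx, cy, cz, cw⟩, ⟨xy, xz, xw⟩, ⟨yz, yw⟩, zw, -⟩ := hd
  have := gramForm_pos α (c := 2) two_ne_zero (x := c)
    (l := [(1, x), (1, y), (1, z), (1, w)]) (by simp [*])
  simp only [gramForm, h.inner_self, List.map_cons, List.map_nil, List.sum_cons,
    List.sum_nil] at this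
  linarith [h.inner_le_of_ne_zero cx h1, h.inner_le_of_ne_zero cy h2, h.inner_le_of_ne_zero cz h3,
    h.inner_le_of_ne_zero cw h4, h.inner_nonpos xy, h.inner_nonpos xz, h.inner_nonpos xw,
    h.inner_nonpos yz, h.inner_nonpos yw, h.inner_nonpos zw]

theorem no_heavy_three_star {c x y z : ι} (hd : [c, x, y, z].Nodup) (h1 : ⟪α c, α x⟫ ≠ 0)
    (h2 : ⟪α c, α y⟫ ≠ 0) (h3 : ⟪α c, α z⟫ ≤ -(√2 / 2)) : False := by
  simp only [List.nodup_cons, List.mem_cons, List.not_mem_nil, or_false, not_or] at hd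
  obtain ⟨⟨cx, cy, cz⟩, ⟨xy, xz⟩, yz, -⟩ := hd
  have hsq := Real.mul_self_sqrt (zero_le_two (α := ℝ))
  have hs : 0 < √2 := by positivity
  have := gramForm_pos α (c := 2) two_ne_zero (x := c)
    (l := [(1, x), (1, y), (√2, z)]) (by simp [*])
  simp only [gramForm, h.inner_self, List.map_cons, List.map_nil, List.sum_cons,
    List.sum_nil] at this
  have e1 := mul_le_mul_of_nonneg_left h3 hs.le
  have e2 := mul_nonpos_of_nonneg_of_nonpos hs.le (h.inner_nonpos xz)
  have e3 := mul_nonpos_of_nonneg_of_nonpos hs.le (h.inner_nonpos yz)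
  linarith [h.inner_le_of_ne_zero cx h1, h.inner_le_of_ne_zero cy h2, h.inner_nonpos xy]

theorem no_two_heavy {c x y : ι} (hd : [c, x, y].Nodup) (h1 : ⟪α c, α x⟫ ≤ -(√2 / 2))
    (h2 : ⟪α c, α y⟫ ≤ -(√2 / 2)) : False := by
  simp only [List.nodup_cons, List.mem_cons, List.not_mem_nil, or_false, not_or] at hd
  obtain ⟨⟨cx, cy⟩, xy, -⟩ := hd
  have hsq := Real.mul_self_sqrt (zero_le_two (α := ℝ))
  have hs : 0 < √2 := by positivity
  have := gramForm_pos α (c := √2) hs.ne' (x := c) (l := [(1, x), (1, y)]) (by simp [*])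
  simp only [gramForm, h.inner_self, List.map_cons, List.map_nil, List.sum_cons,
    List.sum_nil] at this
  have e1 := mul_le_mul_of_nonneg_left h1 hs.le
  have e2 := mul_le_mul_of_nonneg_left h2 hs.le
  linarith [h.inner_nonpos xy]

theorem no_heavy_ends_four {a b c d : ι} (hd : [a, b, c, d].Nodup) (h1 : ⟪α a, α b⟫ ≤ -(√2 / 2))
    (h2 : ⟪α b, α c⟫ ≠ 0) (h3 : ⟪α c, α d⟫ ≤ -(√2 / 2)) : False := by
  simp only [List.nodup_cons, List.mem_cons, List.not_mem_nil, or_false, not_or] at hd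
  obtain ⟨⟨ab, ac, ad⟩, ⟨bc, bd⟩, -⟩ := hd
  have hsq := Real.mul_self_sqrt (zero_le_two (α := ℝ))
  have hs : 0 < √2 := by positivity
  have := gramForm_pos α (c := 1) one_ne_zero (x := a)
    (l := [(√2, b), (√2, c), (1, d)]) (by simp [*])
  simp only [gramForm, h.inner_self, List.map_cons, List.map_nil, List.sum_cons,
    List.sum_nil, hsq] at this
  have e1 := mul_le_mul_of_nonneg_left h1 hs.le
  have e2 := mul_le_mul_of_nonneg_left h3 hs.le
  have e3 := mul_nonpos_of_nonneg_of_nonpos hs.le (h.inner_nonpos ac)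
  have e4 := mul_nonpos_of_nonneg_of_nonpos hs.le (h.inner_nonpos bd)
  linarith [h.inner_le_of_ne_zero bc h2, h.inner_nonpos ad]

theorem no_heavy_ends_five {a b c d e : ι} (hd : [a, b, c, d, e].Nodup)
    (h1 : ⟪α a, α b⟫ ≤ -(√2 / 2)) (h2 : ⟪α b, α c⟫ ≠ 0) (h3 : ⟪α c, α d⟫ ≠ 0)
    (h4 : ⟪α d, α e⟫ ≤ -(√2 / 2)) : False := by
  simp only [List.nodup_cons, List.mem_cons, List.not_mem_nil, or_false, not_or] at hd
  obtain ⟨⟨ab, ac, ad, ae⟩, ⟨bc, bd, be⟩, ⟨cd, ce⟩, -⟩ := hd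
  have hsq := Real.mul_self_sqrt (zero_le_two (α := ℝ))
  have hs : 0 < √2 := by positivity
  have := gramForm_pos α (c := 1) one_ne_zero (x := a)
    (l := [(√2, b), (√2, c), (√2, d), (1, e)]) (by simp [*])
  simp only [gramForm, h.inner_self, List.map_cons, List.map_nil, List.sum_cons,
    List.sum_nil, hsq] at this
  have e1 := mul_le_mul_of_nonneg_left h1 hs.le
  have e2 := mul_le_mul_of_nonneg_left h4 hs.le
  have e3 := mul_nonpos_of_nonneg_of_nonpos hs.le (h.inner_nonpos ac)
  have e4 := mul_nonpos_of_nonneg_of_nonpos hs.le (h.inner_nonpos ad)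
  have e5 := mul_nonpos_of_nonneg_of_nonpos hs.le (h.inner_nonpos be)
  have e6 := mul_nonpos_of_nonneg_of_nonpos hs.le (h.inner_nonpos ce)
  linarith [h.inner_le_of_ne_zero bc h2, h.inner_le_of_ne_zero cd h3, h.inner_nonpos bd,
    h.inner_nonpos ae]

theorem no_heavy_middle {a b c d : ι} (hd : [a, b, c, d].Nodup) (h1 : ⟪α a, α b⟫ ≠ 0)
    (h2 : ⟪α b, α c⟫ ≤ -(3 / 4)) (h3 : ⟪α c, α d⟫ ≠ 0) : False := by
  simp only [List.nodup_cons, List.mem_cons, List.not_mem_nil, or_false, not_or] at hd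
  obtain ⟨⟨ab, ac, ad⟩, ⟨-, bd⟩, cd, -⟩ := hd
  have := gramForm_pos α (c := 1) one_ne_zero (x := a)
    (l := [(2, b), (2, c), (1, d)]) (by simp [*])
  simp only [gramForm, h.inner_self, List.map_cons, List.map_nil, List.sum_cons,
    List.sum_nil] at this
  linarith [h.inner_le_of_ne_zero ab h1, h.inner_le_of_ne_zero cd h3, h.inner_nonpos ac,
    h.inner_nonpos bd, h.inner_nonpos ad]

theorem no_long_three_star {c x y z x' y' z' : ι} (hd : [c, x, y, z, x', y', z'].Nodup)
    (h1 : ⟪α c, α x⟫ ≠ 0) (h2 : ⟪α c, α y⟫ ≠ 0) (h3 : ⟪α c, α z⟫ ≠ 0)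
    (h4 : ⟪α x, α x'⟫ ≠ 0) (h5 : ⟪α y, α y'⟫ ≠ 0) (h6 : ⟪α z, α z'⟫ ≠ 0) : False := by
  simp only [List.nodup_cons, List.mem_cons, List.not_mem_nil, or_false, not_or] at hd
  obtain ⟨⟨cx, cy, cz, cx', cy', cz'⟩, ⟨xy, xz, xx', xy', xz'⟩, ⟨yz, yx', yy', yz'⟩,
    ⟨zx', zy', zz'⟩, ⟨x'y', x'z'⟩, y'z', -⟩ := hd
  have := gramForm_pos α (c := 3) three_ne_zero (x := c)
    (l := [(2, x), (2, y), (2, z), (1, x'), (1, y'), (1, z')]) (by simp [*])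
  simp only [gramForm, h.inner_self, List.map_cons, List.map_nil, List.sum_cons,
    List.sum_nil] at this
  linarith [h.inner_le_of_ne_zero cx h1, h.inner_le_of_ne_zero cy h2, h.inner_le_of_ne_zero cz h3,
    h.inner_le_of_ne_zero xx' h4, h.inner_le_of_ne_zero yy' h5, h.inner_le_of_ne_zero zz' h6,
    h.inner_nonpos cx', h.inner_nonpos cy', h.inner_nonpos cz', h.inner_nonpos xy,
    h.inner_nonpos xz, h.inner_nonpos xy', h.inner_nonpos xz', h.inner_nonpos yz,
    h.inner_nonpos yx', h.inner_nonpos yz', h.inner_nonpos zx', h.inner_nonpos zy',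
    h.inner_nonpos x'y', h.inner_nonpos x'z', h.inner_nonpos y'z']

section Ends

variable [Fintype ι]

/-- Adding to a set of members a further one that is bonded to it does not increase the squared
length of the sum. -/
theorem inner_sum_self_le_one (i₀ : ι) : ⟪∑ i, α i, ∑ i, α i⟫ ≤ 1 := by
  classical
  obtain ⟨S, ⟨h₀, hle⟩, hmax⟩ := (Set.toFinite
    {S : Finset ι | i₀ ∈ S ∧ ⟪∑ i ∈ S, α i, ∑ i ∈ S, α i⟫ ≤ 1}).exists_maximal
    ⟨{i₀}, Finset.mem_singleton_self i₀, by rw [Finset.sum_singleton, h.inner_self]⟩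
  suffices hS : (S : Set ι) = Set.univ by rwa [Finset.coe_eq_univ.mp hS] at hle
  refine h.connected S ⟨i₀, h₀⟩ fun i hi j hj => by_contra fun hij => hj ?_
  have hne (k : ι) (hk : k ∈ S) : j ≠ k := fun e => hj (e ▸ hk)
  have hsum : ⟪α j, ∑ k ∈ S, α k⟫ ≤ -(1 / 2) := by
    rw [inner_sum, ← Finset.add_sum_erase _ _ hi]
    have hbond := h.inner_le_of_ne_zero (hne i hi) (by rwa [real_inner_comm])
    have hrest : ∑ k ∈ S.erase i, ⟪α j, α k⟫ ≤ 0 :=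
      Finset.sum_nonpos fun k hk => h.inner_nonpos (hne k (Finset.mem_of_mem_erase hk))
    linarith
  refine hmax ⟨Finset.mem_insert_of_mem h₀, ?_⟩ (Finset.subset_insert j S)
    (Finset.mem_insert_self j S)
  rw [Finset.sum_insert hj, inner_add_left, inner_add_right, inner_add_right, h.inner_self,
    real_inner_comm (α j) (∑ k ∈ S, α k)]
  linarith

/-- A member has inner product `1 / 2` with the sum of all members if it is a simply bonded end of
the diagram. -/
theorem card_ends_lt_four {T : Finset ι} (hT : (T : Set ι).Pairwise fun i j => ⟪α i, α j⟫ = 0)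
    (hend : ∀ u ∈ T, ⟪α u, ∑ i, α i⟫ = 1 / 2) : T.card < 4 := by
  classical
  by_contra! h4
  obtain ⟨u, hu⟩ : T.Nonempty := Finset.card_pos.mp (by omega)
  set s := ∑ i, α i with hs
  set X := ∑ u ∈ T, α u with hX
  have hXX : ⟪X, X⟫ = T.card := by
    rw [hX, sum_inner, Finset.sum_congr rfl fun i hi => ?_, Finset.sum_const, nsmul_one]
    rw [inner_sum, Finset.sum_eq_single_of_mem i hi fun j hj hji => hT hi hj hji.symm, h.inner_self]
  have hXs : ⟪X, s⟫ = T.card * (1 / 2) := by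
    rw [hX, sum_inner, Finset.sum_congr rfl hend, Finset.sum_const, nsmul_eq_mul]
  have hne : (2 : ℝ) • s - X ≠ 0 := by
    intro h0
    have := congrArg (fun v => α.repr v u) h0
    simp only [hs, hX, map_sub, map_smul, map_sum, α.repr_self, Finsupp.sub_apply,
      Finsupp.smul_apply, Finsupp.finsetSum_apply, Finsupp.single_apply, Finset.sum_ite_eq',
      Finset.mem_univ, hu, if_true, map_zero, Finsupp.zero_apply] at this
    norm_num at this
  have hpos := real_inner_self_pos.mpr hne
  rw [inner_sub_left, inner_sub_right, inner_sub_right, real_inner_smul_left, real_inner_smul_left,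
    real_inner_smul_right, real_inner_smul_right, hXX, real_inner_comm X s, hXs] at hpos
  have : (4 : ℝ) ≤ T.card := by exact_mod_cast h4
  linarith [h.inner_sum_self_le_one u]

theorem inner_sum_eq_half {u f : ι} (huf : u ≠ f) (hf : ⟪α u, α f⟫ = -(1 / 2))
    (h0 : ∀ i, i ≠ u → i ≠ f → ⟪α u, α i⟫ = 0) : ⟪α u, ∑ i, α i⟫ = 1 / 2 := by
  classical
  rw [inner_sum, Fintype.sum_eq_add u f huf fun i hi => h0 i hi.1 hi.2, h.inner_self, hf]
  norm_num

end Ends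

section Symmetric

variable {σ : Equiv.Perm ι} (hσ : ∀ i j, ⟪α (σ i), α (σ j)⟫ = ⟪α i, α j⟫)

omit h in
include hσ in
theorem inner_apply_of_fixed {f : ι} (hf : σ f = f) (u : ι) : ⟪α f, α (σ u)⟫ = ⟪α f, α u⟫ := by
  rw [← hσ f u, hf]

include hσ

theorem inner_apply_self_eq_zero_of_bond {f u : ι} (hf : σ f = f) (hu : σ u ≠ u)
    (hfu : ⟪α f, α u⟫ ≠ 0) : ⟪α u, α (σ u)⟫ = 0 := by
  by_contra hu0
  have hfu' : f ≠ u := fun e => hu (e ▸ hf)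
  have hfu'' : f ≠ σ u := fun e => hu (σ.injective (e ▸ hf))
  have hσu := inner_apply_of_fixed hσ hf u
  rw [← hσu, real_inner_comm] at hfu
  refine h.no_cycle (l := [f, u, σ u]) (by simp [*, hu.symm]) (by simp) ?_
  simp_all [real_inner_comm]

theorem inner_eq_neg_half_of_bond {f u : ι} (hf : σ f = f) (hu : σ u ≠ u)
    (hfu : ⟪α f, α u⟫ ≠ 0) : ⟪α f, α u⟫ = -(1 / 2) := by
  have hfu' : f ≠ u := fun e => hu (e ▸ hf)
  have hfu'' : f ≠ σ u := fun e => hu (σ.injective (e ▸ hf))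
  refine (h.inner_eq_or_le_of_ne_zero hfu' hfu).resolve_right fun hle => ?_
  exact h.no_two_heavy (c := f) (x := u) (y := σ u) (by simp [*, hu.symm]) hle
    (by rwa [inner_apply_of_fixed hσ hf])

theorem inner_eq_zero_of_bond {f g u : ι} (hf : σ f = f) (hu : σ u ≠ u) (hfu : ⟪α f, α u⟫ ≠ 0)
    (hg : σ g = g) (hgf : g ≠ f) : ⟪α g, α u⟫ = 0 := by
  have hfu' : f ≠ u := fun e => hu (e ▸ hf)
  have hfu'' : f ≠ σ u := fun e => hu (σ.injective (e ▸ hf))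
  have hgu' : g ≠ u := fun e => hu (e ▸ hg)
  have hgu'' : g ≠ σ u := fun e => hu (σ.injective (e ▸ hg))
  by_contra hgu
  refine h.no_cycle (l := [f, u, g, σ u]) (by simp [*, hu.symm, hgf.symm, hgu'.symm]) (by simp) ?_
  have hug : ⟪α u, α g⟫ ≠ 0 := by rwa [real_inner_comm]
  have hgσ : ⟪α g, α (σ u)⟫ ≠ 0 := by rwa [inner_apply_of_fixed hσ hg]
  have hσf : ⟪α (σ u), α f⟫ ≠ 0 := by rwa [real_inner_comm, inner_apply_of_fixed hσ hf]
  simp [*]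

end Symmetric

end IsDiagram

end Diagram

section Realizes

variable {E ι κ : Type*} [NormedAddCommGroup E] [InnerProductSpace ℝ E] {α : Module.Basis ι ℝ E}

/-- The members of `α` are unit vectors which enclose the angles prescribed by `M`. -/
def HasGram (α : ι → E) (M : CoxeterMatrix ι) : Prop :=
  ∀ i j, ⟪α i, α j⟫ = -Real.cos (Real.pi / (M i j : ℝ))

/-- After a relabelling of its members, `α` realizes the Coxeter matrix `M`. -/
def Realizes (α : Module.Basis ι ℝ E) (M : CoxeterMatrix κ) : Prop :=
  ∃ f : κ ≃ ι, HasGram (α ∘ f) M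

/-- `α` realizes the Coxeter matrix of type `A₄`, `D₄`, `F₄`, `A₅` or `E₆`. -/
def RealizesExtendable (α : Module.Basis ι ℝ E) : Prop :=
  Realizes α (CoxeterMatrix.A 4) ∨ Realizes α coxeterMatrixD4 ∨ Realizes α CoxeterMatrix.F₄ ∨
    Realizes α (CoxeterMatrix.A 5) ∨ Realizes α CoxeterMatrix.E₆

theorem eq_cos_of_two {m : ℕ} (hm : m = 2) {t : ℝ} (ht : t = 0) :
    t = -Real.cos (Real.pi / (m : ℝ)) := by
  subst hm ht; simp

theorem eq_cos_of_three {m : ℕ} (hm : m = 3) {t : ℝ} (ht : t = -(1 / 2)) :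
    t = -Real.cos (Real.pi / (m : ℝ)) := by
  subst hm ht; simp

theorem eq_cos_of_four {m : ℕ} (hm : m = 4) {t : ℝ} (ht : t = -(√2 / 2)) :
    t = -Real.cos (Real.pi / (m : ℝ)) := by
  subst hm ht; simp

theorem realizes_of_nodup (hα : ∀ i, ⟪α i, α i⟫ = 1) {k : ℕ} (M : CoxeterMatrix (Fin k))
    {v : Fin k → ι} (hv : (List.ofFn v).Nodup) (hall : ∀ i, i ∈ List.ofFn v)
    (hM : ∀ i j, i < j → ⟪α (v i), α (v j)⟫ = -Real.cos (Real.pi / (M i j : ℝ))) :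
    Realizes α M := by
  refine ⟨Equiv.ofBijective v ⟨List.nodup_ofFn.mp hv, fun i => List.mem_ofFn.mp (hall i)⟩,
    fun i j => ?_⟩
  change ⟪α (v i), α (v j)⟫ = _
  rcases lt_trichotomy i j with hij | rfl | hij
  · exact hM i j hij
  · rw [hα, M.diagonal]; simp
  · rw [real_inner_comm, hM j i hij, M.symmetric]

end Realizes

namespace IsDiagram

variable {E ι : Type*} [NormedAddCommGroup E] [InnerProductSpace ℝ E] {α : Module.Basis ι ℝ E}
  (h : IsDiagram α) {σ : Equiv.Perm ι} (hσ : ∀ i j, ⟪α (σ i), α (σ j)⟫ = ⟪α i, α j⟫)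

include h hσ

section ThreeCycle

theorem inner_eq_zero_of_threeCycle {x y z : ι} (hc : IsThreeCycleOn σ x y z) :
    ⟪α x, α y⟫ = 0 ∧ ⟪α x, α z⟫ = 0 ∧ ⟪α y, α z⟫ = 0 := by
  obtain ⟨xy, yz, zx, hx, hy, hz, -⟩ := hc
  have hyz : ⟪α y, α z⟫ = ⟪α x, α y⟫ := by rw [← hσ x y, hx, hy]
  have hzx : ⟪α z, α x⟫ = ⟪α x, α y⟫ := by rw [← hyz, ← hσ y z, hy, hz]
  rw [real_inner_comm (α z) (α x), hyz, hzx, and_self, and_self]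
  by_contra hne
  exact h.no_cycle (l := [x, y, z]) (by simp [*, zx.symm]) (by simp) (by simp [*])

theorem exists_fixed_bond_of_threeCycle {x y z : ι} (hc : IsThreeCycleOn σ x y z) :
    ∃ f, σ f = f ∧ ⟪α f, α x⟫ ≠ 0 := by
  obtain ⟨hxy, hxz, -⟩ := h.inner_eq_zero_of_threeCycle hσ hc
  obtain ⟨xy, -, -, -, -, -, hfix⟩ := hc
  obtain ⟨i, hi, f, hf, hif⟩ :=
    h.exists_bond (List.mem_singleton_self x) (List.mem_singleton.not.mpr xy.symm)
  obtain rfl := List.mem_singleton.mp hi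
  refine ⟨f, hfix f (List.mem_singleton.not.mp hf) ?_ ?_, by rwa [real_inner_comm]⟩
  · rintro rfl; exact hif hxy
  · rintro rfl; exact hif hxz

theorem mem_of_threeCycle {x y z f : ι} (hc : IsThreeCycleOn σ x y z) (hf : σ f = f)
    (hfx : ⟪α f, α x⟫ ≠ 0) (i : ι) : i ∈ [x, f, y, z] := by
  obtain ⟨xy, yz, zx, rfl, rfl, hz, hfix⟩ := hc
  by_contra hi
  obtain ⟨j, hj, g, hg, hjg⟩ := h.exists_bond (l := [x, f, σ x, σ (σ x)]) (i₀ := x) (by simp) hi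
  simp only [List.mem_cons, List.not_mem_nil, or_false, not_or] at hj hg
  obtain ⟨gx, gf, gy, gz⟩ := hg
  have hg := hfix g gx gy gz
  have hgx := h.inner_eq_zero_of_bond hσ hf xy.symm hfx hg gf
  rw [real_inner_comm] at hjg
  rcases hj with rfl | rfl | rfl | rfl
  · exact hjg hgx
  · have fx : j ≠ x := by rintro rfl; exact xy hf.symm
    have fy : j ≠ σ x := by rintro rfl; exact yz hf.symm
    have fz : j ≠ σ (σ x) := by rintro rfl; exact zx (hf.symm.trans hz)
    rw [real_inner_comm] at hjg
    exact h.no_four_star (c := j) (x := x) (y := σ x) (z := σ (σ x)) (w := g)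
      (by simp [*, zx.symm, Ne.symm gx, Ne.symm gf, Ne.symm gy, Ne.symm gz]) hfx
      (by rwa [inner_apply_of_fixed hσ hf])
      (by rwa [inner_apply_of_fixed hσ hf, inner_apply_of_fixed hσ hf]) hjg
  · exact hjg (by rw [inner_apply_of_fixed hσ hg, hgx])
  · exact hjg (by rw [inner_apply_of_fixed hσ hg, inner_apply_of_fixed hσ hg, hgx])

theorem realizes_of_threeCycle {x y z : ι} (hc : IsThreeCycleOn σ x y z) :
    Realizes α coxeterMatrixD4 := by
  obtain ⟨hxy, hxz, hyz⟩ := h.inner_eq_zero_of_threeCycle hσ hc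
  obtain ⟨f, hf, hfx⟩ := h.exists_fixed_bond_of_threeCycle hσ hc
  have hall := h.mem_of_threeCycle hσ hc hf hfx
  obtain ⟨xy, yz, zx, rfl, rfl, hz, -⟩ := hc
  have fx : f ≠ x := by rintro rfl; exact xy hf.symm
  have fy : f ≠ σ x := by rintro rfl; exact yz hf.symm
  have fz : f ≠ σ (σ x) := by rintro rfl; exact zx (hf.symm.trans hz)
  have hfx := h.inner_eq_neg_half_of_bond hσ hf xy.symm hfx
  have hfy : ⟪α f, α (σ x)⟫ = -(1 / 2) := by rw [inner_apply_of_fixed hσ hf, hfx]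
  have hfz : ⟪α f, α (σ (σ x))⟫ = -(1 / 2) := by rw [inner_apply_of_fixed hσ hf, hfy]
  have hxf : ⟪α x, α f⟫ = -(1 / 2) := by rw [real_inner_comm, hfx]
  refine realizes_of_nodup h.inner_self _ (v := ![x, f, σ x, σ (σ x)])
    (by simp [*, fx.symm, zx.symm]) hall fun i j hij => ?_
  fin_cases i <;> fin_cases j <;> first
    | exact absurd hij (by decide)
    | exact eq_cos_of_two (by decide) (by assumption)
    | exact eq_cos_of_three (by decide) (by assumption)

end ThreeCycle

section DoubleSwap

variable {x x' y y' : ι} (hc : IsDoubleSwapOn σ x x' y y')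

omit h in
include hc in
theorem inner_eq_of_doubleSwap : ⟪α x', α y'⟫ = ⟪α x, α y⟫ ∧ ⟪α x', α y⟫ = ⟪α x, α y'⟫ := by
  obtain ⟨-, -, -, -, -, -, hx, -, hy, hy', -⟩ := hc
  exact ⟨by rw [← hσ x y, hx, hy], by rw [← hσ x y', hx, hy']⟩

include hc

theorem realizes_of_path (hall : ∀ i, i ∈ [y, x, x', y']) (hxy' : ⟪α x, α y'⟫ = 0)
    (hxy : ⟪α x, α y⟫ ≠ 0) (hxx' : ⟪α x, α x'⟫ ≠ 0) (hyy' : ⟪α y, α y'⟫ = 0) :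
    RealizesExtendable α := by
  obtain ⟨hx'y', hx'y⟩ := inner_eq_of_doubleSwap hσ hc
  obtain ⟨xx', xy, xy', x'y, x'y', yy', -⟩ := hc
  have hd : [y, x, x', y'].Nodup := by simp [*, xy.symm, x'y.symm]
  rw [real_inner_comm] at hxy
  rw [real_inner_comm (α y) (α x)] at hx'y'
  rw [hxy', real_inner_comm] at hx'y
  have hyx : ⟪α y, α x⟫ = -(1 / 2) := by
    refine (h.inner_eq_or_le_of_ne_zero xy.symm hxy).resolve_right fun hle => ?_
    exact h.no_heavy_ends_four hd hle hxx' (by rwa [hx'y'])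
  rw [hyx] at hx'y'
  rcases h.inner_cases x x' xx' with h1 | h1 | h1 | h1
  · exact absurd h1 hxx'
  · refine .inl (realizes_of_nodup h.inner_self _ (v := ![y, x, x', y']) hd hall fun i j hij => ?_)
    fin_cases i <;> fin_cases j <;> first
      | exact absurd hij (by decide)
      | exact eq_cos_of_two (by decide) (by assumption)
      | exact eq_cos_of_three (by decide) (by assumption)
  · refine .inr <| .inr <| .inl <|
      realizes_of_nodup h.inner_self _ (v := ![y, x, x', y']) hd hall fun i j hij => ?_
    fin_cases i <;> fin_cases j <;> first
      | exact absurd hij (by decide)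
      | exact eq_cos_of_two (by decide) (by assumption)
      | exact eq_cos_of_three (by decide) (by assumption)
      | exact eq_cos_of_four (by decide) (by assumption)
  · exact (h.no_heavy_middle hd (by rw [hyx]; norm_num) h1 (by rw [hx'y']; norm_num)).elim

omit h hσ in
theorem fixed_ne_of_doubleSwap {f : ι} (hf : σ f = f) : f ≠ x ∧ f ≠ x' ∧ f ≠ y ∧ f ≠ y' := by
  obtain ⟨xx', -, -, -, -, yy', hx, hx', hy, hy', -⟩ := hc
  refine ⟨?_, ?_, ?_, ?_⟩ <;> rintro rfl
  exacts [xx' (hf.symm.trans hx), xx' (hx'.symm.trans hf), yy' (hf.symm.trans hy),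
    yy' (hy'.symm.trans hf)]

omit h hσ in
theorem mem_or_fixed_of_doubleSwap (i : ι) : i ∈ [x, x', y, y'] ∨ σ i = i := by
  obtain ⟨-, -, -, -, -, -, -, -, -, -, hfix⟩ := hc
  by_cases hi : i ∈ [x, x', y, y']
  · exact .inl hi
  · simp only [List.mem_cons, List.not_mem_nil, or_false, not_or] at hi
    exact .inr (hfix i hi.1 hi.2.1 hi.2.2.1 hi.2.2.2)

section Fork

variable (hs : ⟪α x, α y'⟫ = 0) {f : ι} (hf : σ f = f) (hfx : ⟪α f, α x⟫ ≠ 0)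

include hs hf hfx

theorem inner_sum_of_fork [Fintype ι] (hxy : ⟪α x, α y⟫ = 0) :
    ⟪α x, ∑ i, α i⟫ = 1 / 2 ∧ ⟪α x', ∑ i, α i⟫ = 1 / 2 := by
  have hfne := fixed_ne_of_doubleSwap hc hf
  have hmem := mem_or_fixed_of_doubleSwap hc
  obtain ⟨xx', -, -, -, -, -, rfl, -⟩ := hc
  have hhalf : ⟪α x, ∑ i, α i⟫ = 1 / 2 := by
    refine h.inner_sum_eq_half hfne.1.symm
      (by rw [real_inner_comm, h.inner_eq_neg_half_of_bond hσ hf xx'.symm hfx]) fun i hix hif => ?_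
    rcases hmem i with hi | hi
    · simp only [List.mem_cons, List.not_mem_nil, or_false] at hi
      rcases hi with rfl | rfl | rfl | rfl
      exacts [absurd rfl hix, h.inner_apply_self_eq_zero_of_bond hσ hf xx'.symm hfx, hxy, hs]
    · rw [real_inner_comm, h.inner_eq_zero_of_bond hσ hf xx'.symm hfx hi hif]
  refine ⟨hhalf, ?_⟩
  rw [← hhalf, inner_sum, inner_sum, ← Equiv.sum_comp σ]
  exact Finset.sum_congr rfl fun i _ => hσ x i

theorem inner_eq_zero_of_fork_of_orthogonal [Finite ι] (hxy : ⟪α x, α y⟫ = 0) {g : ι}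
    (hg : σ g = g) : ⟪α g, α y⟫ = 0 := by
  classical
  cases nonempty_fintype ι
  by_contra hgy
  obtain ⟨hx'y', hx'y⟩ := inner_eq_of_doubleSwap hσ hc
  have hends := h.inner_sum_of_fork hσ hc hs hf hfx hxy
  have hends' := h.inner_sum_of_fork hσ hc.symm (by rw [real_inner_comm, hx'y, hs]) hg hgy
    (by rw [real_inner_comm, hxy])
  obtain ⟨xx', xy, xy', x'y, x'y', yy', rfl, -, rfl, -⟩ := hc
  have hxx' := h.inner_apply_self_eq_zero_of_bond hσ hf xx'.symm hfx
  have hyy' := h.inner_apply_self_eq_zero_of_bond hσ hg yy'.symm hgy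
  rw [hxy] at hx'y'
  rw [hs] at hx'y
  refine (h.card_ends_lt_four (T := {x, σ x, y, σ y}) ?_ (by simp [*])).not_ge ?_
  · intro u hu v hv huv
    simp only [Finset.coe_insert, Finset.coe_singleton, Set.mem_insert_iff,
      Set.mem_singleton_iff] at hu hv
    rcases hu with rfl | rfl | rfl | rfl <;> rcases hv with rfl | rfl | rfl | rfl <;> first
      | exact absurd rfl huv
      | assumption
      | (rw [real_inner_comm]; assumption)
  · rw [Finset.card_insert_of_notMem (by simp [*]), Finset.card_insert_of_notMem (by simp [*]),
      Finset.card_pair yy']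

theorem inner_eq_zero_of_fork [Finite ι] {g : ι} (hg : σ g = g) : ⟪α g, α y⟫ = 0 := by
  by_cases hxy : ⟪α x, α y⟫ = 0
  · exact h.inner_eq_zero_of_fork_of_orthogonal hσ hc hs hf hfx hxy hg
  by_contra hgy
  obtain ⟨fx, fx', fy, fy'⟩ := fixed_ne_of_doubleSwap hc hf
  obtain ⟨gx, gx', gy, gy'⟩ := fixed_ne_of_doubleSwap hc hg
  have hx'y' := (inner_eq_of_doubleSwap hσ hc).1
  obtain ⟨xx', xy, xy', x'y, x'y', yy', rfl, -, rfl, -⟩ := hc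
  by_cases hfg : f = g
  · subst hfg
    refine h.no_cycle (l := [f, x, y]) (by simp [*]) (by simp) ?_
    simp [*, real_inner_comm (α f)]
  · have hfx' := inner_apply_of_fixed hσ hf x
    have hgy' := inner_apply_of_fixed hσ hg y
    refine h.no_cycle (l := [f, x, y, g, σ y, σ x])
      (by simp [*, Ne.symm gx, Ne.symm gy, x'y.symm, x'y'.symm]) (by simp) ?_
    simp [*, real_inner_comm (α g) (α y), real_inner_comm (α (σ x)) (α (σ y)),
      real_inner_comm (α f) (α (σ x))]

theorem inner_ne_zero_of_fork [Finite ι] : ⟪α x, α y⟫ ≠ 0 := by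
  intro hxy
  have hmem := mem_or_fixed_of_doubleSwap hc
  have hfix {g : ι} (hg : σ g = g) : ⟪α y, α g⟫ = 0 ∧ ⟪α y', α g⟫ = 0 := by
    have hgy := h.inner_eq_zero_of_fork hσ hc hs hf hfx hg
    obtain ⟨-, -, -, -, -, -, -, -, rfl, -⟩ := hc
    rw [real_inner_comm, hgy, real_inner_comm, inner_apply_of_fixed hσ hg, hgy, and_self]
  obtain ⟨hx'y', hx'y⟩ := inner_eq_of_doubleSwap hσ hc
  rw [hxy] at hx'y'
  rw [hs] at hx'y
  obtain ⟨i, hi, g, hg, hig⟩ := h.exists_bond (l := [y, y']) (i₀ := y) (j₀ := x) (by simp)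
    (by simp [hc.2.1, hc.2.2.1])
  refine hig ?_
  simp only [List.mem_cons, List.not_mem_nil, or_false, not_or] at hi hg
  rcases hmem g with hgm | hgf
  · simp only [List.mem_cons, List.not_mem_nil, or_false] at hgm
    rw [real_inner_comm]
    rcases hgm with rfl | rfl | rfl | rfl
    · rcases hi with rfl | rfl <;> assumption
    · rcases hi with rfl | rfl <;> assumption
    · exact absurd rfl hg.1
    · exact absurd rfl hg.2
  · rcases hi with rfl | rfl
    exacts [(hfix hgf).1, (hfix hgf).2]

theorem inner_eq_of_fork [Finite ι] :
    ⟪α x, α y⟫ = -(1 / 2) ∧ ⟪α y, α y'⟫ = 0 := by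
  have hxy := h.inner_ne_zero_of_fork hσ hc hs hf hfx
  obtain ⟨fx, fx', fy, fy'⟩ := fixed_ne_of_doubleSwap hc hf
  obtain ⟨hx'y', -⟩ := inner_eq_of_doubleSwap hσ hc
  obtain ⟨xx', xy, xy', x'y, x'y', yy', rfl, -⟩ := hc
  have hfx' := inner_apply_of_fixed hσ hf x
  constructor
  · refine (h.inner_eq_or_le_of_ne_zero xy hxy).resolve_right fun hle => ?_
    exact h.no_heavy_ends_five (a := y) (b := x) (c := f) (d := σ x) (e := y')
      (by simp [*, xy.symm, x'y.symm, Ne.symm fx, Ne.symm fy]) (by rwa [real_inner_comm])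
      (by rwa [real_inner_comm]) (by rwa [hfx']) (by rwa [hx'y'])
  · by_contra hyy'
    refine h.no_cycle (l := [f, x, y, y', σ x]) (by simp [*, x'y.symm, x'y'.symm]) (by simp) ?_
    simp [*, real_inner_comm (α (σ x)) (α y'), real_inner_comm (α f) (α (σ x))]

theorem inner_eq_zero_of_fork_of_fixed [Finite ι] {g : ι} (hg : σ g = g) (hgf : g ≠ f) :
    ⟪α g, α x⟫ = 0 ∧ ⟪α g, α x'⟫ = 0 ∧ ⟪α g, α y⟫ = 0 ∧ ⟪α g, α y'⟫ = 0 := by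
  have hgy := h.inner_eq_zero_of_fork hσ hc hs hf hfx hg
  obtain ⟨xx', -, -, -, -, -, rfl, -, rfl, -⟩ := hc
  have hgx := h.inner_eq_zero_of_bond hσ hf xx'.symm hfx hg hgf
  rw [inner_apply_of_fixed hσ hg, inner_apply_of_fixed hσ hg, hgx, hgy]
  simp

theorem exists_fixed_bond_of_fork [Finite ι] {l : List ι} (hl : ∀ i ∈ [x, x', y, y', f], i ∈ l)
    {j₀ : ι} (hj : j₀ ∉ l) : ∃ i ∈ l, σ i = i ∧ ∃ j ∉ l, σ j = j ∧ ⟪α i, α j⟫ ≠ 0 := by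
  obtain ⟨i, hi, j, hj, hij⟩ := h.exists_bond (hl x (by simp)) hj
  have hjσ := (mem_or_fixed_of_doubleSwap hc j).resolve_left fun hjm =>
    hj (hl j (List.mem_append_left [f] hjm))
  obtain ⟨hjx, hjx', hjy, hjy'⟩ := h.inner_eq_zero_of_fork_of_fixed hσ hc hs hf hfx hjσ
    fun e => hj (hl j (by simp [e]))
  refine ⟨i, hi, (mem_or_fixed_of_doubleSwap hc i).resolve_left fun him => hij ?_, j, hj, hjσ, hij⟩
  rw [real_inner_comm]
  simp only [List.mem_cons, List.not_mem_nil, or_false] at him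
  rcases him with rfl | rfl | rfl | rfl <;> assumption

theorem realizes_A₅_of_fork [Finite ι] (hall : ∀ i, i ∈ [y, x, f, x', y']) :
    Realizes α (CoxeterMatrix.A 5) := by
  obtain ⟨hxy, hyy'⟩ := h.inner_eq_of_fork hσ hc hs hf hfx
  have hfy : ⟪α f, α y⟫ = 0 := h.inner_eq_zero_of_fork hσ hc hs hf hfx hf
  obtain ⟨fx, fx', fy, fy'⟩ := fixed_ne_of_doubleSwap hc hf
  obtain ⟨hx'y', hx'y⟩ := inner_eq_of_doubleSwap hσ hc
  obtain ⟨xx', xy, xy', x'y, x'y', yy', rfl, -, rfl, -⟩ := hc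
  have hxx' := h.inner_apply_self_eq_zero_of_bond hσ hf xx'.symm hfx
  have hfx := h.inner_eq_neg_half_of_bond hσ hf xx'.symm hfx
  have hfx' := inner_apply_of_fixed hσ hf x
  have hfy' := inner_apply_of_fixed hσ hf y
  rw [hfx] at hfx'
  rw [hfy] at hfy'
  rw [hxy] at hx'y'
  rw [hs] at hx'y
  refine realizes_of_nodup h.inner_self _ (v := ![y, x, f, σ x, σ y])
    (by simp [*, xy.symm, x'y.symm, Ne.symm fx, Ne.symm fy]) hall fun i j hij => ?_
  fin_cases i <;> fin_cases j <;> first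
    | exact absurd hij (by decide)
    | exact eq_cos_of_two (by decide) (by assumption)
    | exact eq_cos_of_three (by decide) (by assumption)
    | exact eq_cos_of_two (by decide) (by rw [real_inner_comm]; assumption)
    | exact eq_cos_of_three (by decide) (by rw [real_inner_comm]; assumption)

theorem mem_of_fork_of_bond [Finite ι] {g : ι} (hg : σ g = g) (hgf : g ≠ f)
    (hfg : ⟪α f, α g⟫ ≠ 0) (i : ι) : i ∈ [y, g, x, f, x', y'] := by
  by_contra hi
  obtain ⟨u, hu, huσ, k, hk, hkσ, huk⟩ := h.exists_fixed_bond_of_fork hσ hc hs hf hfx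
    (l := [y, g, x, f, x', y']) (by simp +contextual) hi
  obtain ⟨fx, fx', fy, fy'⟩ := fixed_ne_of_doubleSwap hc hf
  obtain ⟨gx, gx', gy, gy'⟩ := fixed_ne_of_doubleSwap hc hg
  obtain ⟨ux, ux', uy, uy'⟩ := fixed_ne_of_doubleSwap hc huσ
  obtain ⟨kx, kx', ky, ky'⟩ := fixed_ne_of_doubleSwap hc hkσ
  have hxy := h.inner_ne_zero_of_fork hσ hc hs hf hfx
  obtain ⟨hx'y', -⟩ := inner_eq_of_doubleSwap hσ hc
  obtain ⟨xx', xy, xy', x'y, x'y', yy', rfl, -⟩ := hc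
  have hfx' := inner_apply_of_fixed hσ hf x
  simp only [List.mem_cons, List.not_mem_nil, ux, ux', uy, uy', false_or, or_false, not_or]
    at hu hk
  obtain ⟨-, kg, -, kf, -, -⟩ := hk
  rcases hu with rfl | rfl
  · exact h.no_long_three_star (c := f) (x := x) (y := σ x) (z := u) (x' := y) (y' := y')
      (z' := k) (by simp [*, Ne.symm hgf, Ne.symm ux, Ne.symm ux', Ne.symm kf, Ne.symm kx,
        Ne.symm kx', Ne.symm kg, Ne.symm ky, Ne.symm ky']) hfx (by rwa [hfx']) hfg hxy
      (by rwa [hx'y']) huk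
  · exact h.no_four_star (c := u) (x := x) (y := σ x) (z := g) (w := k)
      (by simp [*, Ne.symm hgf, Ne.symm gx, Ne.symm gx', Ne.symm kf, Ne.symm kx, Ne.symm kx',
        Ne.symm kg]) hfx (by rwa [hfx']) hfg huk

theorem realizes_E₆_of_fork [Finite ι] {g : ι} (hg : σ g = g) (hgf : g ≠ f)
    (hfg : ⟪α f, α g⟫ ≠ 0) : Realizes α CoxeterMatrix.E₆ := by
  have hall := h.mem_of_fork_of_bond hσ hc hs hf hfx hg hgf hfg
  obtain ⟨hxy, hyy'⟩ := h.inner_eq_of_fork hσ hc hs hf hfx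
  have hfy : ⟪α f, α y⟫ = 0 := h.inner_eq_zero_of_fork hσ hc hs hf hfx hf
  obtain ⟨hgx, hgx', hgy, hgy'⟩ := h.inner_eq_zero_of_fork_of_fixed hσ hc hs hf hfx hg hgf
  obtain ⟨fx, fx', fy, fy'⟩ := fixed_ne_of_doubleSwap hc hf
  obtain ⟨gx, gx', gy, gy'⟩ := fixed_ne_of_doubleSwap hc hg
  obtain ⟨hx'y', hx'y⟩ := inner_eq_of_doubleSwap hσ hc
  obtain ⟨xx', xy, xy', x'y, x'y', yy', rfl, -, rfl, -⟩ := hc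
  have hxx' := h.inner_apply_self_eq_zero_of_bond hσ hf xx'.symm hfx
  have hfg : ⟪α f, α g⟫ = -(1 / 2) := by
    refine (h.inner_eq_or_le_of_ne_zero hgf.symm hfg).resolve_right fun hle => ?_
    exact h.no_heavy_three_star (c := f) (x := x) (y := σ x) (z := g)
      (by simp [*, Ne.symm hgf, Ne.symm gx, Ne.symm gx']) hfx
      (by rwa [inner_apply_of_fixed hσ hf]) hle
  have hfx := h.inner_eq_neg_half_of_bond hσ hf xx'.symm hfx
  have hfx' := inner_apply_of_fixed hσ hf x
  have hfy' := inner_apply_of_fixed hσ hf y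
  rw [hfx] at hfx'
  rw [hfy] at hfy'
  rw [hxy] at hx'y'
  rw [hs] at hx'y
  refine realizes_of_nodup h.inner_self _ (v := ![y, g, x, f, σ x, σ y])
    (by simp [*, xy.symm, x'y.symm, Ne.symm fx, Ne.symm fy, Ne.symm gy]) hall fun i j hij => ?_
  fin_cases i <;> fin_cases j <;> first
    | exact absurd hij (by decide)
    | exact eq_cos_of_two (by decide) (by assumption)
    | exact eq_cos_of_three (by decide) (by assumption)
    | exact eq_cos_of_two (by decide) (by rw [real_inner_comm]; assumption)
    | exact eq_cos_of_three (by decide) (by rw [real_inner_comm]; assumption)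

theorem realizes_of_fork [Finite ι] : RealizesExtendable α := by
  by_cases hall : ∀ i, i ∈ [y, x, f, x', y']
  · exact .inr <| .inr <| .inr <| .inl <| h.realizes_A₅_of_fork hσ hc hs hf hfx hall
  · push Not at hall
    obtain ⟨i, hi⟩ := hall
    obtain ⟨u, hu, huσ, g, hg, hgσ, hug⟩ := h.exists_fixed_bond_of_fork hσ hc hs hf hfx
      (l := [y, x, f, x', y']) (by simp +contextual) hi
    obtain ⟨ux, ux', uy, uy'⟩ := fixed_ne_of_doubleSwap hc huσ
    simp only [List.mem_cons, List.not_mem_nil, ux, ux', uy, uy', false_or, or_false] at hu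
    subst hu
    exact .inr <| .inr <| .inr <| .inr <| h.realizes_E₆_of_fork hσ hc hs hf hfx hgσ
      (fun e => hg (by simp [e])) hug

end Fork

theorem mem_of_doubleSwap (hbond : ∀ f, σ f = f → ⟪α f, α x⟫ = 0 ∧ ⟪α f, α y⟫ = 0) (i : ι) :
    i ∈ [x, x', y, y'] := by
  by_contra hi
  obtain ⟨j, hj, g, hg, hjg⟩ := h.exists_bond (List.mem_cons_self (a := x)) hi
  have hgσ := (mem_or_fixed_of_doubleSwap hc g).resolve_left hg
  obtain ⟨hgx, hgy⟩ := hbond g hgσ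
  obtain ⟨-, -, -, -, -, -, rfl, -, rfl, -⟩ := hc
  refine hjg ?_
  rw [real_inner_comm]
  simp only [List.mem_cons, List.not_mem_nil, or_false] at hj
  rcases hj with rfl | rfl | rfl | rfl
  exacts [hgx, by rw [inner_apply_of_fixed hσ hgσ, hgx], hgy,
    by rw [inner_apply_of_fixed hσ hgσ, hgy]]

section NoFixedBond

variable (hxy' : ⟪α x, α y'⟫ = 0)

include hxy'

theorem inner_ne_zero_of_forall_mem (hall : ∀ i, i ∈ [x, x', y, y']) : ⟪α x, α y⟫ ≠ 0 := by
  intro hxy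
  obtain ⟨hx'y', hx'y⟩ := inner_eq_of_doubleSwap hσ hc
  rw [hxy] at hx'y'
  rw [hxy'] at hx'y
  obtain ⟨i, hi, j, hj, hij⟩ := h.exists_bond (l := [x, x']) (i₀ := x) (j₀ := y) (by simp)
    (by simp [hc.2.1.symm, hc.2.2.2.1.symm])
  have hjy := hall j
  simp only [List.mem_cons, List.not_mem_nil, or_false] at hi hj hjy
  rcases hi with rfl | rfl <;> rcases hjy with rfl | rfl | rfl | rfl <;> simp_all

theorem realizes_of_forall_mem (hall : ∀ i, i ∈ [x, x', y, y']) : RealizesExtendable α := by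
  have hxy := h.inner_ne_zero_of_forall_mem hσ hc hxy' hall
  obtain ⟨hx'y', hx'y⟩ := inner_eq_of_doubleSwap hσ hc
  by_cases hxx' : ⟪α x, α x'⟫ = 0
  · by_cases hyy' : ⟪α y, α y'⟫ = 0
    · obtain ⟨xx', xy, xy', x'y, x'y', yy', -⟩ := hc
      obtain ⟨i, hi, j, hj, hij⟩ := h.exists_bond (l := [x, y]) (i₀ := x) (j₀ := x') (by simp)
        (by simp [*, xx'.symm])
      have hjy := hall j
      simp only [List.mem_cons, List.not_mem_nil, or_false] at hi hj hjy
      rw [real_inner_comm] at hij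
      rcases hi with rfl | rfl <;> rcases hjy with rfl | rfl | rfl | rfl <;>
        simp_all [real_inner_comm]
    · exact h.realizes_of_path hσ hc.symm (fun i => by simpa [or_comm, or_left_comm] using hall i)
        (by rw [real_inner_comm, hx'y, hxy']) (by rwa [real_inner_comm]) hyy' hxx'
  · by_cases hyy' : ⟪α y, α y'⟫ = 0
    · exact h.realizes_of_path hσ hc (fun i => by simpa [or_comm, or_left_comm] using hall i)
        hxy' hxy hxx' hyy'
    · obtain ⟨xx', xy, xy', x'y, x'y', yy', -⟩ := hc
      refine (h.no_cycle (l := [x, x', y', y]) (by simp [*, yy'.symm]) (by simp) ?_).elim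
      simp [*, real_inner_comm (α y) (α y'), real_inner_comm (α x) (α y)]

theorem realizes_of_doubleSwap_of_orthogonal [Finite ι] : RealizesExtendable α := by
  by_cases hbond : ∀ f, σ f = f → ⟪α f, α x⟫ = 0 ∧ ⟪α f, α y⟫ = 0
  · exact h.realizes_of_forall_mem hσ hc hxy' (h.mem_of_doubleSwap hσ hc hbond)
  · push Not at hbond
    obtain ⟨f, hf, hfxy⟩ := hbond
    by_cases hfx : ⟪α f, α x⟫ = 0
    · have hyx' : ⟪α y, α x'⟫ = 0 := by
        rw [real_inner_comm, (inner_eq_of_doubleSwap hσ hc).2, hxy']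
      exact h.realizes_of_fork hσ hc.symm hyx' hf (hfxy hfx)
    · exact h.realizes_of_fork hσ hc hxy' hf hfx

end NoFixedBond

theorem realizes_of_doubleSwap [Finite ι] : RealizesExtendable α := by
  by_cases hxy' : ⟪α x, α y'⟫ = 0
  · exact h.realizes_of_doubleSwap_of_orthogonal hσ hc hxy'
  by_cases hxy : ⟪α x, α y⟫ = 0
  · exact h.realizes_of_doubleSwap_of_orthogonal hσ hc.flip hxy
  obtain ⟨hx'y', hx'y⟩ := inner_eq_of_doubleSwap hσ hc
  obtain ⟨xx', xy, xy', x'y, x'y', yy', -⟩ := hc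
  refine (h.no_cycle (l := [x, y, x', y']) (by simp [*, x'y.symm]) (by simp) ?_).elim
  simp [*, real_inner_comm (α x) (α y'), real_inner_comm (α x') (α y)]

end DoubleSwap

end IsDiagram

theorem IsSimpleSystem.hasCoxeterType {n : ℕ} {ι κ : Type} {W : Subgroup (OrthGroup n)}
    {α : Module.Basis ι ℝ (EuclideanSpace ℝ (Fin n))} (h : IsSimpleSystem W α)
    {M : CoxeterMatrix κ} (hM : Realizes α M) : HasCoxeterType W M := by
  obtain ⟨f, hf⟩ := hM
  refine ⟨α.reindex f.symm, fun i j => by simpa using hf i j, ?_⟩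
  rw [h.eq_closure, ← f.surjective.range_comp]
  simp [Function.comp_def]

section Irreducible

variable {E ι : Type*} [NormedAddCommGroup E] [InnerProductSpace ℝ E]
  {W : Subgroup (E ≃ₗᵢ[ℝ] E)} {α : Module.Basis ι ℝ E}

theorem inner_cases_of_eq_neg_cos {m : ℕ} (hm : 2 ≤ m) {t : ℝ}
    (ht : t = -Real.cos (Real.pi / m)) :
    t = 0 ∨ t = -(1 / 2) ∨ t = -(√2 / 2) ∨ t ≤ -(3 / 4) := by
  subst ht
  rcases Nat.lt_or_ge m 5 with hlt | hge
  · interval_cases m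
    · left; simp
    · right; left; simp
    · right; right; left; simp
  · right; right; right
    have hm5 : (5 : ℝ) ≤ m := by exact_mod_cast hge
    have hcos : Real.cos (Real.pi / 5) ≤ Real.cos (Real.pi / m) :=
      Real.cos_le_cos_of_nonneg_of_le_pi (by positivity)
        (div_le_self Real.pi_pos.le (by norm_num))
        (div_le_div_of_nonneg_left Real.pi_pos.le (by norm_num) hm5)
    have hsqrt : (2 : ℝ) ≤ √5 := Real.le_sqrt_of_sq_le (by norm_num)
    rw [Real.cos_pi_div_five] at hcos
    linarith

namespace IsSimpleSystem

theorem apply_mem_of_forall_reflect (h : IsSimpleSystem W α) {U : Submodule ℝ E}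
    (hU : ∀ i, ∀ v ∈ U, reflect (α i) v ∈ U) {g : E ≃ₗᵢ[ℝ] E} (hg : g ∈ W) {v : E}
    (hv : v ∈ U) : g v ∈ U := by
  obtain ⟨l, rfl⟩ := h.exists_wordProd_eq hg
  clear hg
  induction l with
  | nil => exact hv
  | cons i l ih => rw [wordProd_cons, mul_apply]; exact hU i _ ih

theorem span_image_invariant (h : IsSimpleSystem W α) {S : Set ι}
    (hS : ∀ i ∈ S, ∀ j ∉ S, ⟪α i, α j⟫ = 0) {g : E ≃ₗᵢ[ℝ] E} (hg : g ∈ W) {v : E}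
    (hv : v ∈ Submodule.span ℝ (α '' S)) : g v ∈ Submodule.span ℝ (α '' S) := by
  refine h.apply_mem_of_forall_reflect (fun i v hv => ?_) hg hv
  by_cases hi : i ∈ S
  · rw [reflect_apply_of_norm (h.norm_eq_one i)]
    exact Submodule.sub_mem _ hv (Submodule.smul_mem _ _ (Submodule.subset_span ⟨i, hi, rfl⟩))
  · rwa [reflect_apply_eq_self_iff.mpr]
    refine Submodule.mem_orthogonal_singleton_iff_inner_right.mp
      (Submodule.span_le.mpr ?_ hv : v ∈ (ℝ ∙ α i)ᗮ)
    rintro _ ⟨j, hj, rfl⟩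
    exact Submodule.mem_orthogonal_singleton_iff_inner_left.mpr (hS j hj i hi)

theorem isDiagram (h : IsSimpleSystem W α)
    (hirr : ∀ U : Submodule ℝ E, (∀ g ∈ W, ∀ v ∈ U, g v ∈ U) → U = ⊥ ∨ U = ⊤) :
    IsDiagram α := by
  refine ⟨fun i => inner_self_eq_one_of_norm_eq_one (h.norm_eq_one i), fun i j hij => ?_,
    fun S ⟨i, hi⟩ hS => Set.eq_univ_of_forall fun j => ?_⟩
  · obtain ⟨m, hm, hcos⟩ := h.exists_inner_eq_neg_cos hij
    exact inner_cases_of_eq_neg_cos hm hcos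
  · have htop := (hirr _ fun g hg v hv => h.span_image_invariant hS hg hv).resolve_left
      ((Submodule.ne_bot_iff _).mpr ⟨α i, α.self_mem_span_image.mpr hi, α.ne_zero i⟩)
    exact α.self_mem_span_image.mp (htop ▸ Submodule.mem_top : α j ∈ Submodule.span ℝ (α '' S))

end IsSimpleSystem

end Irreducible

section Necessity

variable {n : ℕ} {W : Subgroup (OrthGroup n)}

theorem ne_bot_of_actsIrreducibly (hirr : ActsIrreducibly W) (hn : 2 ≤ n) : W ≠ ⊥ := by
  rintro rfl
  have : Nontrivial (EuclideanSpace ℝ (Fin n)) :=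
    Module.nontrivial_of_finrank_pos (R := ℝ) (by rw [finrank_euclideanSpace_fin]; omega)
  obtain ⟨v, hv⟩ := exists_ne (0 : EuclideanSpace ℝ (Fin n))
  have hrank := finrank_span_singleton (K := ℝ) hv
  have htop := (hirr.2 (ℝ ∙ v) fun g hg u hu => by rwa [Subgroup.mem_bot.mp hg]).resolve_left
    fun h => hv (Submodule.span_singleton_eq_bot.mp h)
  rw [htop, finrank_top, finrank_euclideanSpace_fin] at hrank
  omega

theorem span_roots_eq_top (hW : IsReflectionGroup W) (hirr : ActsIrreducibly W) (hn : 2 ≤ n) :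
    Submodule.span ℝ (roots W) = ⊤ := by
  refine (hirr.2 _ fun g hg v hv => ?_).resolve_left fun hbot => ?_
  · have hle : Submodule.span ℝ (roots W) ≤
        (Submodule.span ℝ (roots W)).comap g.toLinearEquiv.toLinearMap :=
      Submodule.span_le.mpr fun s hs => Submodule.subset_span (apply_mem_roots hg hs)
    exact hle hv
  · have hempty : roots W = ∅ := Set.eq_empty_of_forall_notMem fun v hv =>
      ne_zero_of_norm_eq_one hv.1 (Submodule.span_eq_bot.mp hbot v hv)
    refine ne_bot_of_actsIrreducibly hirr hn ?_
    rw [eq_closure_roots hW, hempty, Set.image_empty, Subgroup.closure_empty]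

theorem hasExtendableType_of_realizesExtendable {ι : Type}
    {α : Module.Basis ι ℝ (EuclideanSpace ℝ (Fin n))} (hα : IsSimpleSystem W α)
    (h : RealizesExtendable α) : HasExtendableType W :=
  h.imp hα.hasCoxeterType <| Or.imp hα.hasCoxeterType <| Or.imp hα.hasCoxeterType <|
    Or.imp hα.hasCoxeterType hα.hasCoxeterType

theorem hasExtendableType_of_isExtendingRotation (hW : IsReflectionGroup W)
    (hirr : ActsIrreducibly W) {h : OrthGroup n} (hh : IsExtendingRotation W h) :
    HasExtendableType W := by
  have hn : 2 ≤ n := hh.isRotation ▸ Nat.le_add_left 2 _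
  have := hW.1
  obtain ⟨D, α, hα⟩ := exists_isSimpleSystem (eq_closure_roots hW) (span_roots_eq_top hW hirr hn)
  have := Module.Finite.finite_basis α
  have hdiag := hα.isDiagram hirr.2
  obtain ⟨w, -, a, σ, hσ, -, hcases⟩ := IsExtendingRotation.exists_perm hW hα hh
  have hinv (i j : D) : ⟪α (σ i), α (σ j)⟫ = ⟪α i, α j⟫ := by
    rw [← hσ, ← hσ, a.inner_map_map]
  refine hasExtendableType_of_realizesExtendable hα ?_
  rcases hcases with ⟨x, y, z, hc⟩ | ⟨x, x', y, y', hc⟩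
  · exact .inr (.inl (hdiag.realizes_of_threeCycle hinv hc))
  · exact hdiag.realizes_of_doubleSwap hinv hc

end Necessity

/-! ### Simple systems from invariant lattices -/

section Lattice

variable {E ι : Type*} [NormedAddCommGroup E] [InnerProductSpace ℝ E] {α : Module.Basis ι ℝ E}

/-- The part of `v` with positive coordinates in the basis `α`, so that
`v = basisPosPart α v - basisPosPart α (-v)`. -/
noncomputable def basisPosPart [Fintype ι] (α : Module.Basis ι ℝ E) (v : E) : E :=
  ∑ i, (α.repr v i)⁺ • α i

theorem repr_basisPosPart [Fintype ι] (v : E) (i : ι) :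
    α.repr (basisPosPart α v) i = (α.repr v i)⁺ :=
  congrFun (α.repr_sum_self _) i

theorem basisPosPart_sub_basisPosPart_neg [Fintype ι] (v : E) :
    basisPosPart α v - basisPosPart α (-v) = v := by
  refine α.ext_elem fun i => ?_
  rw [map_sub, Finsupp.sub_apply, repr_basisPosPart, repr_basisPosPart, map_neg,
    Finsupp.neg_apply, posPart_neg, posPart_sub_negPart]

theorem repr_nonpos_of_basisPosPart_eq_zero [Fintype ι] {v : E} (h : basisPosPart α v = 0) (i : ι) :
    α.repr v i ≤ 0 := by
  rw [← posPart_eq_zero, ← repr_basisPosPart, h, map_zero, Finsupp.zero_apply]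

theorem inner_basisPosPart_neg_nonpos [Fintype ι] (hα : ∀ i j, i ≠ j → ⟪α i, α j⟫ ≤ 0) (v : E) :
    ⟪basisPosPart α v, basisPosPart α (-v)⟫ ≤ 0 := by
  rw [basisPosPart, basisPosPart, sum_inner]
  refine Finset.sum_nonpos fun i _ => ?_
  rw [inner_sum]
  refine Finset.sum_nonpos fun j _ => ?_
  rw [real_inner_smul_left, real_inner_smul_right, ← mul_assoc]
  by_cases hij : i = j
  · rw [hij, map_neg, Finsupp.neg_apply, posPart_neg]
    rcases le_total 0 (α.repr v j) with h | h
    · rw [negPart_of_nonneg h, mul_zero, zero_mul]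
    · rw [posPart_of_nonpos h, zero_mul, zero_mul]
  · exact mul_nonpos_of_nonneg_of_nonpos (mul_nonneg (posPart_nonneg _) (posPart_nonneg _))
      (hα i j hij)

/-- The lattice spanned by the vectors `t i • α i`. -/
def scaledLattice (α : Module.Basis ι ℝ E) (t : ι → ℝ) : AddSubgroup E :=
  AddSubgroup.closure (Set.range fun i => t i • α i)

/-- The vectors `t i • α i` have integral squared length, and the reflections in the unit vectors
`α i` preserve the lattice spanned by them. -/
structure IsIntegralScaling (α : Module.Basis ι ℝ E) (t : ι → ℝ) : Prop where
  mul_self : ∀ i, ∃ k : ℤ, t i * t i = k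
  two_mul_inner : ∀ i j, ∃ k : ℤ, 2 * t i * ⟪α i, α j⟫ = k * t j

theorem mem_scaledLattice [Finite ι] {t : ι → ℝ} {v : E} :
    v ∈ scaledLattice α t ↔ ∀ j, ∃ c : ℤ, α.repr v j = c * t j := by
  classical
  cases nonempty_fintype ι
  refine ⟨fun hv j => ?_, fun hv => ?_⟩
  · induction hv using AddSubgroup.closure_induction with
    | mem x hx =>
      obtain ⟨i, rfl⟩ := hx
      rcases eq_or_ne i j with rfl | hij
      · exact ⟨1, by simp⟩
      · exact ⟨0, by simp [hij]⟩
    | zero => exact ⟨0, by simp⟩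
    | add u w _ _ hu hw =>
      obtain ⟨⟨k, hk⟩, m, hm⟩ := And.intro hu hw
      exact ⟨k + m, by rw [map_add, Finsupp.add_apply, hk, hm]; push_cast; ring⟩
    | neg u _ hu =>
      obtain ⟨k, hk⟩ := hu
      exact ⟨-k, by rw [map_neg, Finsupp.neg_apply, hk]; push_cast; ring⟩
  · choose c hc using hv
    rw [← α.sum_repr v]
    refine AddSubgroup.sum_mem _ fun j _ => ?_
    rw [hc, mul_smul, Int.cast_smul_eq_zsmul]
    exact AddSubgroup.zsmul_mem _ (AddSubgroup.subset_closure (Set.mem_range_self j)) _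

theorem basisPosPart_mem_scaledLattice [Fintype ι] {t : ι → ℝ} {v : E}
    (hv : v ∈ scaledLattice α t) : basisPosPart α v ∈ scaledLattice α t := by
  refine mem_scaledLattice.mpr fun j => ?_
  rw [repr_basisPosPart]
  rcases le_total 0 (α.repr v j) with h0 | h0
  · rw [posPart_of_nonneg h0]; exact mem_scaledLattice.mp hv j
  · exact ⟨0, by rw [posPart_of_nonpos h0, Int.cast_zero, zero_mul]⟩

namespace IsIntegralScaling

variable {t : ι → ℝ} (h : IsIntegralScaling α t)

include h

theorem two_mul_inner_int {u v : E} (hu : u ∈ scaledLattice α t) (hv : v ∈ scaledLattice α t) :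
    ∃ k : ℤ, 2 * ⟪u, v⟫ = k := by
  induction hu, hv using AddSubgroup.closure_induction₂ with
  | mem x y hx hy =>
    obtain ⟨⟨i, rfl⟩, j, rfl⟩ := And.intro hx hy
    obtain ⟨k, hk⟩ := h.two_mul_inner i j
    obtain ⟨m, hm⟩ := h.mul_self j
    refine ⟨k * m, ?_⟩
    rw [real_inner_smul_left, real_inner_smul_right, Int.cast_mul, ← hm]
    linear_combination t j * hk
  | zero_left => exact ⟨0, by simp⟩
  | zero_right => exact ⟨0, by simp⟩
  | add_left x y z _ _ _ hx hy =>
    obtain ⟨⟨k, hk⟩, m, hm⟩ := And.intro hx hy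
    exact ⟨k + m, by rw [inner_add_left, mul_add, hk, hm, Int.cast_add]⟩
  | add_right x y z _ _ _ hx hy =>
    obtain ⟨⟨k, hk⟩, m, hm⟩ := And.intro hx hy
    exact ⟨k + m, by rw [inner_add_right, mul_add, hk, hm, Int.cast_add]⟩
  | neg_left x y _ _ hx =>
    obtain ⟨k, hk⟩ := hx
    exact ⟨-k, by rw [inner_neg_left, mul_neg, hk, Int.cast_neg]⟩
  | neg_right x y _ _ hx =>
    obtain ⟨k, hk⟩ := hx
    exact ⟨-k, by rw [inner_neg_right, mul_neg, hk, Int.cast_neg]⟩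

theorem inner_self_int (hα : ∀ i, ‖α i‖ = 1) {v : E} (hv : v ∈ scaledLattice α t) :
    ∃ k : ℤ, ⟪v, v⟫ = k := by
  induction hv using AddSubgroup.closure_induction with
  | mem x hx =>
    obtain ⟨i, rfl⟩ := hx
    obtain ⟨k, hk⟩ := h.mul_self i
    exact ⟨k, by rw [real_inner_smul_left, real_inner_smul_right,
      inner_self_eq_one_of_norm_eq_one (hα i), mul_one, hk]⟩
  | zero => exact ⟨0, by simp⟩
  | add u w hu hw hu' hw' =>
    obtain ⟨⟨k, hk⟩, m, hm⟩ := And.intro hu' hw'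
    obtain ⟨l, hl⟩ := h.two_mul_inner_int hu hw
    exact ⟨k + l + m, by rw [real_inner_add_add_self, hk, hl, hm]; push_cast; rfl⟩
  | neg u _ hu => rwa [inner_neg_neg]

theorem reflect_mem_scaledLattice (hα : ∀ i, ‖α i‖ = 1) (i : ι) {v : E}
    (hv : v ∈ scaledLattice α t) : reflect (α i) v ∈ scaledLattice α t := by
  induction hv using AddSubgroup.closure_induction with
  | mem x hx =>
    obtain ⟨j, rfl⟩ := hx
    obtain ⟨k, hk⟩ := h.two_mul_inner j i
    rw [reflect_apply_of_norm (hα i), real_inner_smul_right, real_inner_comm, ← mul_assoc, hk,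
      mul_smul, Int.cast_smul_eq_zsmul]
    exact AddSubgroup.sub_mem _ (AddSubgroup.subset_closure (Set.mem_range_self j))
      (AddSubgroup.zsmul_mem _ (AddSubgroup.subset_closure (Set.mem_range_self i)) k)
  | zero => rw [map_zero]; exact AddSubgroup.zero_mem _
  | add u w _ _ hu hw => rw [map_add]; exact AddSubgroup.add_mem _ hu hw
  | neg u _ hu => rw [map_neg]; exact AddSubgroup.neg_mem _ hu

theorem one_le_inner_self (hα : ∀ i, ‖α i‖ = 1) {v : E} (hv : v ∈ scaledLattice α t)
    (hv0 : v ≠ 0) : 1 ≤ ⟪v, v⟫ := by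
  obtain ⟨k, hk⟩ := h.inner_self_int hα hv
  have hpos := real_inner_self_pos.mpr hv0
  rw [hk] at hpos ⊢
  exact_mod_cast hpos

/-- Otherwise `v` is the difference of two nonzero lattice vectors at an obtuse angle, and both of
them have length at least `1`. -/
theorem repr_dichotomy [Finite ι] (hα : ∀ i, ‖α i‖ = 1) (hob : ∀ i j, i ≠ j → ⟪α i, α j⟫ ≤ 0)
    {v : E} (hv : v ∈ scaledLattice α t) (hv1 : ‖v‖ = 1) :
    (∀ j, 0 ≤ α.repr v j) ∨ (∀ j, α.repr v j ≤ 0) := by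
  cases nonempty_fintype ι
  have hzero : basisPosPart α v = 0 ∨ basisPosPart α (-v) = 0 := by
    by_contra! hne
    have hp := h.one_le_inner_self hα (basisPosPart_mem_scaledLattice hv) hne.1
    have hn := h.one_le_inner_self hα
      (basisPosPart_mem_scaledLattice (AddSubgroup.neg_mem _ hv)) hne.2
    have hpn := inner_basisPosPart_neg_nonpos hob v
    have hone := inner_self_eq_one_of_norm_eq_one (𝕜 := ℝ) hv1
    rw [← basisPosPart_sub_basisPosPart_neg (α := α) v, real_inner_sub_sub_self] at hone
    linarith
  refine hzero.symm.imp (fun h0 j => ?_) fun h0 => repr_nonpos_of_basisPosPart_eq_zero h0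
  simpa using repr_nonpos_of_basisPosPart_eq_zero h0 j

end IsIntegralScaling

theorem isSimpleSystem_of_isIntegralScaling [Finite ι] {W : Subgroup (E ≃ₗᵢ[ℝ] E)}
    (hα : ∀ i, ‖α i‖ = 1) (hW : W = Subgroup.closure (Set.range fun i => reflect (α i)))
    (hob : ∀ i j, i ≠ j → ⟪α i, α j⟫ ≤ 0) (ht : ∀ l, ∃ t, t l = 1 ∧ IsIntegralScaling α t) :
    IsSimpleSystem W α := by
  refine ⟨hα, hW, fun w hw l => ?_⟩
  obtain ⟨t, htl, h⟩ := ht l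
  refine h.repr_dichotomy hα hob ?_ (by rw [w.norm_map, hα])
  rw [hW] at hw
  induction hw using Subgroup.closure_induction_left with
  | one =>
    have hmem : t l • α l ∈ scaledLattice α t := AddSubgroup.subset_closure (Set.mem_range_self l)
    rwa [htl, one_smul] at hmem
  | mul_left x hx y _ hy =>
    obtain ⟨i, rfl⟩ := hx
    exact h.reflect_mem_scaledLattice hα i hy
  | inv_mul_cancel x hx y _ hy =>
    obtain ⟨i, rfl⟩ := hx
    rw [reflect_inv]
    exact h.reflect_mem_scaledLattice hα i hy

end Lattice

/-! ### Symmetries of a cube -/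

section Frame

variable {E ι : Type*} [NormedAddCommGroup E] [InnerProductSpace ℝ E]

theorem reflect_sub_apply_left {u v : E} (h : ‖u‖ = ‖v‖) : reflect (u - v) u = v :=
  Submodule.reflection_sub h

theorem reflect_sub_apply_right {u v : E} (h : ‖u‖ = ‖v‖) : reflect (u - v) v = u := by
  rw [← neg_sub, reflect_neg, reflect_sub_apply_left h.symm]

/-- `g` permutes the lines spanned by the family `e` and fixes its orthogonal complement; for an
orthonormal triple `e`, these are the symmetries of the cube with axes `e`. -/
def PreservesFrame (e : ι → E) (g : E ≃ₗᵢ[ℝ] E) : Prop :=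
  (∃ π : Equiv.Perm ι, ∀ a, g (e a) = e (π a) ∨ g (e a) = -e (π a)) ∧
    ∀ y, (∀ a, ⟪y, e a⟫ = 0) → g y = y

theorem preservesFrame_of_mem_closure {e : ι → E} {S : Set (E ≃ₗᵢ[ℝ] E)}
    (hS : ∀ s ∈ S, PreservesFrame e s) {g : E ≃ₗᵢ[ℝ] E} (hg : g ∈ Subgroup.closure S) :
    PreservesFrame e g := by
  induction hg using Subgroup.closure_induction with
  | mem s hs => exact hS s hs
  | one => exact ⟨⟨1, fun a => Or.inl rfl⟩, fun y _ => rfl⟩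
  | mul g h _ _ hg hh =>
    obtain ⟨⟨⟨π, hπ⟩, hg'⟩, ⟨τ, hτ⟩, hh'⟩ := And.intro hg hh
    refine ⟨⟨π * τ, fun a => ?_⟩, fun y hy => by rw [mul_apply, hh' y hy, hg' y hy]⟩
    rw [mul_apply, Equiv.Perm.mul_apply]
    rcases hτ a with h1 | h1 <;> rcases hπ (τ a) with h2 | h2 <;> simp [h1, h2]
  | inv g _ hg =>
    obtain ⟨⟨π, hπ⟩, hg'⟩ := hg
    refine ⟨⟨π⁻¹, fun a => ?_⟩, fun y hy => inv_apply_eq.mpr (hg' y hy).symm⟩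
    have h1 := hπ (π⁻¹ a)
    rw [← Equiv.Perm.mul_apply, mul_inv_cancel, Equiv.Perm.one_apply] at h1
    refine h1.imp (fun h => ?_) fun h => ?_
    · rw [inv_apply_eq, h]
    · rw [inv_apply_eq, map_neg, h, neg_neg]

variable {e : ι → E}

theorem eq_of_eq_or_eq_neg (he : Orthonormal ℝ e) {a b : ι} (h : e a = e b ∨ e a = -e b) :
    a = b := by
  by_contra hab
  have h0 : ⟪e a, e b⟫ = 0 := he.2 hab
  have hb := inner_self_eq_one_of_norm_eq_one (𝕜 := ℝ) (he.1 b)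
  rcases h with h | h <;> rw [h] at h0
  · exact one_ne_zero (hb.symm.trans h0)
  · rw [inner_neg_left, hb] at h0
    norm_num at h0

theorem reflect_sub_apply [DecidableEq ι] (he : Orthonormal ℝ e) (a b c : ι) :
    reflect (e a - e b) (e c) = e (Equiv.swap a b c) := by
  have hn : ‖e a‖ = ‖e b‖ := by rw [he.1, he.1]
  rcases eq_or_ne c a with rfl | hca
  · rw [Equiv.swap_apply_left, reflect_sub_apply_left hn]
  rcases eq_or_ne c b with rfl | hcb
  · rw [Equiv.swap_apply_right, reflect_sub_apply_right hn]
  rw [Equiv.swap_apply_of_ne_of_ne hca hcb, reflect_apply_eq_self_iff, inner_sub_left,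
    he.2 hca.symm, he.2 hcb.symm, sub_zero]

theorem preservesFrame_reflect_sub (he : Orthonormal ℝ e) (a b : ι) :
    PreservesFrame e (reflect (e a - e b)) := by
  classical
  refine ⟨⟨Equiv.swap a b, fun c => Or.inl (reflect_sub_apply he a b c)⟩, fun y hy => ?_⟩
  rw [reflect_apply_eq_self_iff, real_inner_comm, inner_sub_right, hy, hy, sub_zero]

theorem reflect_add_apply_left (he : Orthonormal ℝ e) (a b : ι) :
    reflect (e a + e b) (e a) = -e b := by
  rw [← sub_neg_eq_add]
  exact reflect_sub_apply_left (by rw [norm_neg, he.1, he.1])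

theorem reflect_add_apply_right (he : Orthonormal ℝ e) (a b : ι) :
    reflect (e a + e b) (e b) = -e a := by
  rw [add_comm, reflect_add_apply_left he]

theorem reflect_add_apply_of_ne (he : Orthonormal ℝ e) {a b c : ι} (hca : c ≠ a) (hcb : c ≠ b) :
    reflect (e a + e b) (e c) = e c := by
  rw [reflect_apply_eq_self_iff, inner_add_left, he.2 hca.symm, he.2 hcb.symm, add_zero]

theorem preservesFrame_reflect_add (he : Orthonormal ℝ e) (a b : ι) :
    PreservesFrame e (reflect (e a + e b)) := by
  classical
  refine ⟨⟨Equiv.swap a b, fun c => ?_⟩, fun y hy => ?_⟩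
  · rcases eq_or_ne c a with rfl | hca
    · rw [Equiv.swap_apply_left, reflect_add_apply_left he]; exact Or.inr rfl
    rcases eq_or_ne c b with rfl | hcb
    · rw [Equiv.swap_apply_right, reflect_add_apply_right he]; exact Or.inr rfl
    rw [Equiv.swap_apply_of_ne_of_ne hca hcb, reflect_add_apply_of_ne he hca hcb]
    exact Or.inl rfl
  · rw [reflect_apply_eq_self_iff, real_inner_comm, inner_add_right, hy, hy, add_zero]

theorem reflect_apply_of_ne (he : Orthonormal ℝ e) {a c : ι} (hca : c ≠ a) :
    reflect (e a) (e c) = e c :=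
  reflect_apply_eq_self_iff.mpr (he.2 hca.symm)

theorem preservesFrame_reflect (he : Orthonormal ℝ e) (a : ι) :
    PreservesFrame e (reflect (e a)) := by
  refine ⟨⟨1, fun c => ?_⟩, fun y hy => ?_⟩
  · rcases eq_or_ne c a with rfl | hca
    · exact Or.inr (reflect_apply_self _)
    · exact Or.inl (reflect_apply_of_ne he hca)
  · rw [reflect_apply_eq_self_iff, real_inner_comm, hy]

theorem inner_sub_sum_smul_eq_zero [Fintype ι] (he : Orthonormal ℝ e) (x : E) (a : ι) :
    ⟪x - ∑ b, ⟪x, e b⟫ • e b, e a⟫ = 0 := by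
  rw [inner_sub_left, he.inner_left_fintype]
  exact sub_self _

theorem eq_one_of_fixes_frame [Finite ι] (he : Orthonormal ℝ e) {g : E ≃ₗᵢ[ℝ] E}
    (h : ∀ a, g (e a) = e a) (h' : ∀ y, (∀ a, ⟪y, e a⟫ = 0) → g y = y) : g = 1 := by
  cases nonempty_fintype ι
  ext1 x
  have hz := h' _ (inner_sub_sum_smul_eq_zero he x)
  simp only [map_sub, map_sum, map_smul, h, sub_left_inj] at hz
  exact hz

theorem eq_sum_of_forall_inner_eq_zero [Fintype ι] (he : Orthonormal ℝ e) {ρ : E}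
    (hρ : ∀ z, (∀ a, ⟪z, e a⟫ = 0) → ⟪z, ρ⟫ = 0) : ρ = ∑ a, ⟪ρ, e a⟫ • e a := by
  have hz := inner_sub_sum_smul_eq_zero he ρ
  rw [← sub_eq_zero, ← inner_self_eq_zero (𝕜 := ℝ), inner_sub_right, hρ _ hz, inner_sum, zero_sub,
    neg_eq_zero]
  exact Finset.sum_eq_zero fun a _ => by rw [real_inner_smul_right, hz, mul_zero]

end Frame

section Cube

variable {E : Type*} [NormedAddCommGroup E] [InnerProductSpace ℝ E] {e : Fin 3 → E}

theorem perm_cube_eq_one_of_preservesFrame (he : Orthonormal ℝ e) {g : E ≃ₗᵢ[ℝ] E}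
    {π : Equiv.Perm (Fin 3)} (hπ : ∀ a, g (e a) = e (π a) ∨ g (e a) = -e (π a))
    (h3 : g ^ 3 = 1) : π ^ 3 = 1 := by
  ext1 a
  refine eq_of_eq_or_eq_neg he ?_
  have hg3 : g (g (g (e a))) = e a := by
    rw [← mul_apply, ← mul_apply, ← pow_three', h3, one_apply]
  rw [pow_three]
  rcases hπ a with h1 | h1 <;> rcases hπ (π a) with h2 | h2 <;>
    rcases hπ (π (π a)) with h4 | h4 <;> simp only [h1, h2, h4, map_neg, neg_neg] at hg3 <;>
    simp [← hg3]

/-- An element of order three permutes the three axes cyclically, up to signs. -/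
theorem sq_inner_eq_of_preservesFrame (he : Orthonormal ℝ e) {g : E ≃ₗᵢ[ℝ] E}
    (hg : PreservesFrame e g) (h3 : g ^ 3 = 1) (h1 : g ≠ 1) {y : E} (hy : g y = y) (a b : Fin 3) :
    ⟪y, e a⟫ ^ 2 = ⟪y, e b⟫ ^ 2 := by
  obtain ⟨⟨π, hπ⟩, hfix⟩ := hg
  have hsq (c : Fin 3) : ⟪y, e (π c)⟫ ^ 2 = ⟪y, e c⟫ ^ 2 := by
    rw [← g.inner_map_map y (e c), hy]
    rcases hπ c with h | h <;> rw [h]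
    rw [inner_neg_right, neg_sq]
  have hcyclic : ∀ π : Equiv.Perm (Fin 3), π ^ 3 = 1 →
      π = 1 ∨ ∀ a b, b = a ∨ b = π a ∨ b = π (π a) := by decide
  rcases hcyclic π (perm_cube_eq_one_of_preservesFrame he hπ h3) with rfl | h
  · refine absurd (eq_one_of_fixes_frame he (fun c => (hπ c).resolve_right fun hc => ?_) hfix) h1
    have hc3 : (g ^ 3) (e c) = -e c := by
      rw [Equiv.Perm.one_apply] at hc
      rw [pow_three, mul_apply, mul_apply, hc, map_neg, hc, neg_neg, hc]
    rw [h3, one_apply] at hc3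
    have : IsAddTorsionFree E := .of_isTorsionFree ℝ E
    exact he.ne_zero c (self_eq_neg.mp hc3)
  · rcases h a b with rfl | rfl | rfl
    · rfl
    · exact (hsq a).symm
    · rw [hsq, hsq]

/-- The rotation of order three permuting an orthonormal triple `e` cyclically, as a product of two
reflections. -/
noncomputable def frameRotation (e : Fin 3 → E) : E ≃ₗᵢ[ℝ] E :=
  reflect (e 0 - e 1) * reflect (e 1 - e 2)

theorem frameRotation_apply (he : Orthonormal ℝ e) (a : Fin 3) :
    frameRotation e (e a) = e (a + 1) := by
  rw [frameRotation, mul_apply, reflect_sub_apply he, reflect_sub_apply he]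
  fin_cases a <;> rfl

theorem frameRotation_apply_of_orthogonal (he : Orthonormal ℝ e) {y : E}
    (hy : ∀ a, ⟪y, e a⟫ = 0) : frameRotation e y = y := by
  rw [frameRotation, mul_apply, (preservesFrame_reflect_sub he 1 2).2 y hy,
    (preservesFrame_reflect_sub he 0 1).2 y hy]

theorem frameRotation_pow_three (he : Orthonormal ℝ e) : frameRotation e ^ 3 = 1 := by
  refine eq_one_of_fixes_frame he (fun a => ?_) fun y hy => ?_
  · rw [pow_three, mul_apply, mul_apply, frameRotation_apply he, frameRotation_apply he,
      frameRotation_apply he]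
    fin_cases a <;> rfl
  · rw [pow_three, mul_apply, mul_apply, frameRotation_apply_of_orthogonal he hy,
      frameRotation_apply_of_orthogonal he hy, frameRotation_apply_of_orthogonal he hy]

theorem frameRotation_ne_one (he : Orthonormal ℝ e) : frameRotation e ≠ 1 := by
  intro h
  have h0 := frameRotation_apply he 0
  rw [h, one_apply] at h0
  exact absurd (eq_of_eq_or_eq_neg he (Or.inl h0)) (by decide)

theorem frameRotation_apply_sum (he : Orthonormal ℝ e) :
    frameRotation e (∑ a, e a) = ∑ a, e a := by
  simp only [map_sum, frameRotation_apply he]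
  exact Equiv.sum_comp (Equiv.addRight 1) e

theorem mul_mul_eq_zero_of_sq_eq {x y z : ℝ} (hsum : x + y + z = 0)
    (hsq : x ^ 2 + y ^ 2 + z ^ 2 = 1) (hxy : (4 * x * x - 1) ^ 2 = (4 * x * y + 1) ^ 2)
    (hyz : (4 * x * y + 1) ^ 2 = (4 * x * z + 1) ^ 2) : x * y * z = 0 := by
  obtain rfl : x = -y - z := by linarith
  have hfactor : (-y - z) * (y - z) * (1 - 2 * (-y - z) ^ 2) = 0 := by
    linear_combination hyz / 8
  rcases mul_eq_zero.mp hfactor with h | h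
  · rcases mul_eq_zero.mp h with h | h
    · rw [h, zero_mul, zero_mul]
    · obtain rfl : y = z := by linarith
      have hy2 : y ^ 2 = 1 / 6 := by linarith
      have hy4 : y ^ 4 = 1 / 36 := by rw [show y ^ 4 = (y ^ 2) ^ 2 by ring, hy2]; norm_num
      ring_nf at hxy
      rw [hy2, hy4] at hxy
      norm_num at hxy
  · have hyz0 : y * z = 0 := by linarith
    rw [mul_assoc, hyz0, mul_zero]

theorem exists_inner_eq_zero_of_sq_eq (he : Orthonormal ℝ e) {ρ : E} (hρ1 : ‖ρ‖ = 1)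
    (hρ : ρ = ∑ a, ⟪ρ, e a⟫ • e a) (hsum : ⟪ρ, ∑ a, e a⟫ = 0) (k : Fin 3)
    (hsq : ∀ a b, ⟪reflect ρ (∑ c, e c - (2 : ℝ) • e k), e a⟫ ^ 2 =
      ⟪reflect ρ (∑ c, e c - (2 : ℝ) • e k), e b⟫ ^ 2) : ∃ a, ⟪ρ, e a⟫ = 0 := by
  have hcoord (a : Fin 3) : ⟪reflect ρ (∑ c, e c - (2 : ℝ) • e k), e a⟫ =
      1 - 2 * (if k = a then 1 else 0) + 4 * ⟪ρ, e k⟫ * ⟪ρ, e a⟫ := by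
    rw [reflect_apply_of_norm hρ1, inner_sub_left, real_inner_smul_left, inner_sub_right, hsum,
      real_inner_smul_right, inner_sub_left, sum_inner, real_inner_smul_left]
    simp only [orthonormal_iff_ite.mp he, Finset.sum_ite_eq', Finset.mem_univ, if_true]
    ring
  have hnorm : ∑ a, ⟪ρ, e a⟫ ^ 2 = 1 := by
    rw [← inner_self_eq_one_of_norm_eq_one (𝕜 := ℝ) hρ1]
    conv_rhs => rw [hρ, he.inner_sum]
    simp [sq]
  have hsum_univ (f : Fin 3 → ℝ) : ∑ a, f a = f k + f (k + 1) + f (k + 2) := by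
    rw [← Equiv.sum_comp (Equiv.addLeft k) f, Fin.sum_univ_three]
    simp only [Equiv.coe_addLeft, add_zero]
  have hne : ∀ k : Fin 3, k ≠ k + 1 ∧ k ≠ k + 2 := by decide
  rw [inner_sum, hsum_univ] at hsum
  rw [hsum_univ] at hnorm
  have hself := hsq k (k + 1)
  have hother := hsq (k + 1) (k + 2)
  rw [hcoord, hcoord, if_pos rfl, if_neg (hne k).1] at hself
  rw [hcoord, hcoord, if_neg (hne k).1, if_neg (hne k).2] at hother
  rcases mul_eq_zero.mp (mul_mul_eq_zero_of_sq_eq hsum hnorm (by linear_combination hself)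
    (by linear_combination hother)) with h | h
  · rcases mul_eq_zero.mp h with h | h <;> exact ⟨_, h⟩
  · exact ⟨_, h⟩

theorem exists_reflect_sum_eq (he : Orthonormal ℝ e) {κ : E} (hκ : κ = e 1 + e 2 ∨ κ = e 2) :
    ∃ k, reflect κ (∑ a, e a) = ∑ a, e a - (2 : ℝ) • e k ∨
      reflect κ (∑ a, e a) = -(∑ a, e a - (2 : ℝ) • e k) := by
  simp only [Fin.sum_univ_three, map_add]
  rcases hκ with rfl | rfl
  · refine ⟨0, Or.inr ?_⟩
    rw [reflect_add_apply_left he, reflect_add_apply_right he,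
      reflect_add_apply_of_ne he (by decide) (by decide)]
    module
  · refine ⟨2, Or.inl ?_⟩
    rw [reflect_apply_self, reflect_apply_of_ne he (by decide),
      reflect_apply_of_ne he (by decide)]
    module

theorem reflect_mem_of_inner_eq_zero (he : Orthonormal ℝ e) {W : Subgroup (E ≃ₗᵢ[ℝ] E)}
    (hp : reflect (e 0 - e 1) ∈ W) (hq : reflect (e 1 - e 2) ∈ W) {ρ : E} (hρ0 : ρ ≠ 0)
    (hρ : ρ = ∑ a, ⟪ρ, e a⟫ • e a) (hsum : ⟪ρ, ∑ a, e a⟫ = 0) {a : Fin 3} (ha : ⟪ρ, e a⟫ = 0) :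
    reflect ρ ∈ W := by
  have hpq : reflect (e 0 - e 2) ∈ W := by
    have hconj := conj_reflect (reflect (e 0 - e 1)) (e 1 - e 2)
    rw [map_sub, reflect_sub_apply he, reflect_sub_apply he] at hconj
    exact (show reflect (e 0 - e 2) = _ from hconj.symm) ▸
      W.mul_mem (W.mul_mem hp hq) (W.inv_mem hp)
  have hsmul {t : ℝ} {v : E} (h : ρ = t • v) (hv : reflect v ∈ W) : reflect ρ ∈ W := by
    rwa [h, reflect_smul (left_ne_zero_of_smul (h ▸ hρ0))]
  rw [inner_sum, Fin.sum_univ_three] at hsum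
  rw [Fin.sum_univ_three] at hρ
  fin_cases a <;> simp only [Fin.reduceFinMk, Fin.zero_eta, Fin.mk_one] at ha <;>
    rw [ha] at hρ hsum
  · refine hsmul (t := ⟪ρ, e 1⟫) (hρ.trans ?_) hq
    rw [show ⟪ρ, e 2⟫ = -⟪ρ, e 1⟫ by linarith]
    module
  · refine hsmul (t := ⟪ρ, e 0⟫) (hρ.trans ?_) hpq
    rw [show ⟪ρ, e 2⟫ = -⟪ρ, e 0⟫ by linarith]
    module
  · refine hsmul (t := ⟪ρ, e 0⟫) (hρ.trans ?_) hp
    rw [show ⟪ρ, e 1⟫ = -⟪ρ, e 0⟫ by linarith]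
    module

/-- The conjugate of the rotation fixes a vector, the image of `∑ a, e a`, whose coordinates must
have equal squares; this leaves so few candidates for `ρ` that they are all roots of `W`. -/
theorem reflect_mem_of_preservesFrame (he : Orthonormal ℝ e) {W : Subgroup (E ≃ₗᵢ[ℝ] E)}
    (hp : reflect (e 0 - e 1) ∈ W) (hq : reflect (e 1 - e 2) ∈ W) {κ : E}
    (hκ : κ = e 1 + e 2 ∨ κ = e 2) {ρ : E} (hρ1 : ‖ρ‖ = 1)
    (hρ : ∀ x, frameRotation e x = x → ⟪x, ρ⟫ = 0)
    (hpres : PreservesFrame e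
      (reflect ρ * reflect κ * frameRotation e * (reflect ρ * reflect κ)⁻¹)) :
    reflect ρ ∈ W := by
  have hsum : ⟪ρ, ∑ a, e a⟫ = 0 := by
    rw [real_inner_comm]
    exact hρ _ (frameRotation_apply_sum he)
  have hspan := eq_sum_of_forall_inner_eq_zero he fun z hz =>
    hρ z (frameRotation_apply_of_orthogonal he hz)
  obtain ⟨k, hk⟩ := exists_reflect_sum_eq he hκ
  obtain ⟨a, ha⟩ : ∃ a, ⟪ρ, e a⟫ = 0 := by
    refine exists_inner_eq_zero_of_sq_eq he hρ1 hspan hsum k fun a b => ?_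
    have hsq := sq_inner_eq_of_preservesFrame he hpres
      (by rw [conj_pow, frameRotation_pow_three he, mul_one, mul_inv_cancel])
      (fun h => frameRotation_ne_one he (conj_eq_one_iff.mp h))
      (y := (reflect ρ * reflect κ) (∑ a, e a))
      (by rw [mul_apply, mul_apply, inv_apply_self, frameRotation_apply_sum he]) a b
    rw [mul_apply] at hsq
    rcases hk with hk | hk <;> rw [hk] at hsq
    · exact hsq
    · simpa only [map_neg, inner_neg_left, neg_sq] using hsq
  exact reflect_mem_of_inner_eq_zero he hp hq (ne_zero_of_norm_eq_one hρ1) hspan hsum ha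

end Cube

/-! ### Extension by a diagram automorphism -/

section PairProducts

variable {E ι : Type*} [NormedAddCommGroup E] [InnerProductSpace ℝ E] {α : Module.Basis ι ℝ E}

theorem inner_eq_zero_of_reflect_mul_reflect_apply {i j : ι} (hij : i ≠ j) {v : E}
    (h : (reflect (α i) * reflect (α j)) v = v) : ⟪α i, v⟫ = 0 ∧ ⟪α j, v⟫ = 0 := by
  have hswap : reflect (α j) v = reflect (α i) v := by
    rw [mul_apply] at h
    rw [← reflect_reflect (α i) (reflect (α j) v), h]
  have hj : reflect (α j) v = v := α.ext_elem fun k => by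
    rcases eq_or_ne k j with rfl | hk
    · rw [hswap, repr_reflect v hij.symm]
    · exact repr_reflect v hk
  exact ⟨reflect_apply_eq_self_iff.mp (hswap ▸ hj), reflect_apply_eq_self_iff.mp hj⟩

variable {n : ℕ} {α : Module.Basis ι ℝ (EuclideanSpace ℝ (Fin n))} {W : Subgroup (OrthGroup n)}

theorem isRotation_reflect_mul_reflect [Finite ι] {i j : ι} (hij : i ≠ j) :
    IsRotation (reflect (α i) * reflect (α j)) := by
  classical
  cases nonempty_fintype ι
  refine le_antisymm ?_ ?_
  · have hfinrank := finrank_add_card_le α (U := fixedSpace (reflect (α i) * reflect (α j)))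
      (P := {i, j}) fun x hx h0 => ?_
    · rwa [finrank_euclideanSpace_fin, Finset.card_pair hij] at hfinrank
    obtain ⟨hi, hj⟩ := inner_eq_zero_of_reflect_mul_reflect_apply hij (mem_fixedSpace.mp hx)
    rw [← inner_self_eq_zero (𝕜 := ℝ), inner_eq_sum_repr α x x]
    refine Finset.sum_eq_zero fun l _ => ?_
    by_cases hl : l ∈ ({i, j} : Finset ι)
    · rw [Finset.mem_insert, Finset.mem_singleton] at hl
      rcases hl with rfl | rfl
      · rw [real_inner_comm, hi, mul_zero]
      · rw [real_inner_comm, hj, mul_zero]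
    · rw [h0 l hl, zero_mul]
  · let L : EuclideanSpace ℝ (Fin n) →ₗ[ℝ] Fin 2 → ℝ :=
      LinearMap.pi ![innerₗ _ (α i), innerₗ _ (α j)]
    have hker : LinearMap.ker L ≤ fixedSpace (reflect (α i) * reflect (α j)) := fun v hv => by
      have hi : ⟪α i, v⟫ = 0 := congrFun (LinearMap.mem_ker.mp hv) 0
      have hj : ⟪α j, v⟫ = 0 := congrFun (LinearMap.mem_ker.mp hv) 1
      rw [mem_fixedSpace, mul_apply, reflect_apply_eq_self_iff.mpr hj,
        reflect_apply_eq_self_iff.mpr hi]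
    simpa using finrank_le_add_of_ker_le L hker

theorem isometryDet_wordProd (α : Module.Basis ι ℝ (EuclideanSpace ℝ (Fin n))) (l : List ι) :
    isometryDet _ (wordProd α l) = (-1) ^ l.length := by
  induction l with
  | nil => exact map_one _
  | cons i l ih =>
    rw [wordProd_cons, map_mul, isometryDet_reflect (α.ne_zero i), ih, List.length_cons, pow_succ']

theorem wordProd_mem_closure_of_even : ∀ l : List ι, Even l.length →
    wordProd α l ∈ Subgroup.closure {g | ∃ i j, i ≠ j ∧ g = reflect (α i) * reflect (α j)}
  | [], _ => one_mem _
  | [_], h => absurd h (by simp)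
  | i :: j :: l, h => by
    rw [wordProd_cons, wordProd_cons, ← mul_assoc]
    refine mul_mem ?_ (wordProd_mem_closure_of_even l (by simpa [parity_simps] using h))
    rcases eq_or_ne i j with rfl | hij
    · rw [reflect_mul_self]
      exact one_mem _
    · exact Subgroup.subset_closure ⟨i, j, hij, rfl⟩

theorem reflect_mul_reflect_mem_orientationPreserving {u v : EuclideanSpace ℝ (Fin n)}
    (hu0 : u ≠ 0) (hv0 : v ≠ 0) (hu : reflect u ∈ W) (hv : reflect v ∈ W) :
    reflect u * reflect v ∈ orientationPreserving W :=
  mem_orientationPreserving.mpr ⟨mul_mem hu hv, by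
    rw [map_mul, isometryDet_reflect hu0, isometryDet_reflect hv0]
    norm_num⟩

namespace IsSimpleSystem

theorem reflect_mul_reflect_mem (h : IsSimpleSystem W α) (i j : ι) :
    reflect (α i) * reflect (α j) ∈ orientationPreserving W :=
  reflect_mul_reflect_mem_orientationPreserving (α.ne_zero i) (α.ne_zero j) (h.reflect_mem i)
    (h.reflect_mem j)

theorem orientationPreserving_eq_closure (h : IsSimpleSystem W α) :
    orientationPreserving W =
      Subgroup.closure {g | ∃ i j, i ≠ j ∧ g = reflect (α i) * reflect (α j)} := by
  refine le_antisymm (fun g hg => ?_) ?_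
  · obtain ⟨hgW, hdet⟩ := mem_orientationPreserving.mp hg
    obtain ⟨l, rfl⟩ := h.exists_wordProd_eq hgW
    rw [isometryDet_wordProd, neg_one_pow_eq_one_iff_even (by norm_num)] at hdet
    exact wordProd_mem_closure_of_even l hdet
  · rw [Subgroup.closure_le]
    rintro _ ⟨i, j, -, rfl⟩
    exact h.reflect_mul_reflect_mem i j

theorem span_roots_eq_top_of_le [Finite ι] [Nontrivial ι] (h : IsSimpleSystem W α)
    {W' : Subgroup (OrthGroup n)} (hW' : IsReflectionGroup W')
    (hle : orientationPreserving W ≤ W') : Submodule.span ℝ (roots W') = ⊤ := by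
  cases nonempty_fintype ι
  rw [← Submodule.orthogonal_eq_bot_iff, Submodule.eq_bot_iff]
  intro v hv
  have hfix {g : OrthGroup n} (hg : g ∈ W') : g v = v := by
    rw [eq_closure_roots hW'] at hg
    refine apply_eq_self_of_mem_closure ?_ hg
    rintro _ ⟨u, hu, rfl⟩
    exact reflect_apply_eq_self_iff.mpr ((Submodule.mem_orthogonal _ _).mp hv u
      (Submodule.subset_span hu))
  rw [← inner_self_eq_zero (𝕜 := ℝ), inner_eq_sum_repr α v v]
  refine Finset.sum_eq_zero fun j _ => ?_
  obtain ⟨i, hij⟩ := exists_ne j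
  have hj := (inner_eq_zero_of_reflect_mul_reflect_apply hij
    (hfix (hle (h.reflect_mul_reflect_mem i j)))).2
  rw [real_inner_comm, hj, mul_zero]

end IsSimpleSystem

end PairProducts

section ExtendedGroup

variable {n : ℕ} {ι : Type*} {W : Subgroup (OrthGroup n)}
  {α : Module.Basis ι ℝ (EuclideanSpace ℝ (Fin n))} {σ : Equiv.Perm ι} {a w : OrthGroup n}

theorem zpow_apply_basis {E : Type*} [NormedAddCommGroup E] [InnerProductSpace ℝ E]
    {α : Module.Basis ι ℝ E} {a : E ≃ₗᵢ[ℝ] E} (hσ : ∀ i, a (α i) = α (σ i)) :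
    ∀ (t : ℤ) (i : ι), (a ^ t) (α i) = α ((σ ^ t) i)
  | .ofNat k, i => by simpa using pow_apply_basis hσ k i
  | .negSucc k, i => by
    rw [zpow_negSucc, zpow_negSucc]
    exact inv_apply_basis (pow_apply_basis hσ _) i

theorem isometryDet_of_perm {E : Type*} [NormedAddCommGroup E] [InnerProductSpace ℝ E] [Fintype ι]
    [DecidableEq ι] {α : Module.Basis ι ℝ E} {a : E ≃ₗᵢ[ℝ] E} (hσ : ∀ i, a (α i) = α (σ i)) :
    isometryDet E a = (Equiv.Perm.sign σ : ℤ) := by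
  have hmatrix : (LinearMap.toMatrix α α (a.toLinearEquiv : E →ₗ[ℝ] E)).transpose
      = σ.permMatrix ℝ := by
    ext i j
    rw [Matrix.transpose_apply, LinearMap.toMatrix_apply]
    change α.repr (a (α i)) j = _
    rw [hσ, α.repr_self, Finsupp.single_apply, Equiv.Perm.permMatrix, PEquiv.toMatrix_apply]
    simp [eq_comm]
  change LinearMap.det (a.toLinearEquiv : E →ₗ[ℝ] E) = _
  rw [← LinearMap.det_toMatrix α, ← Matrix.det_transpose, hmatrix, Matrix.det_permutation]

theorem normalizer_le_normalizer_orientationPreserving :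
    Subgroup.normalizer (W : Set (OrthGroup n)) ≤
      Subgroup.normalizer (orientationPreserving W : Set (OrthGroup n)) := fun a ha => by
  refine Subgroup.mem_normalizer_iff.mpr fun g => ?_
  rw [mem_orientationPreserving, mem_orientationPreserving, ← Subgroup.mem_normalizer_iff.mp ha,
    map_mul, map_mul, mul_right_comm, ← map_mul, mul_inv_cancel, map_one, one_mul]

theorem extendedGroup_mul_of_mem (hw : w ∈ orientationPreserving W) :
    extendedGroup W (w * a) = extendedGroup W a := by
  have hw' {b : OrthGroup n} : w ∈ extendedGroup W b := orientationPreserving_le_extendedGroup hw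
  refine le_antisymm (extendedGroup_le.mpr ⟨orientationPreserving_le_extendedGroup, ?_⟩)
    (extendedGroup_le.mpr ⟨orientationPreserving_le_extendedGroup, ?_⟩)
  · exact mul_mem hw' mem_extendedGroup
  · exact (Subgroup.mul_mem_cancel_left _ hw').mp mem_extendedGroup

theorem extendedGroup_inv : extendedGroup W a⁻¹ = extendedGroup W a := by
  refine le_antisymm (extendedGroup_le.mpr ⟨orientationPreserving_le_extendedGroup, ?_⟩)
    (extendedGroup_le.mpr ⟨orientationPreserving_le_extendedGroup, ?_⟩)
  · exact inv_mem mem_extendedGroup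
  · exact inv_mem_iff.mp mem_extendedGroup

theorem extendedGroup_le_sup_zpowers : extendedGroup W a ≤ W ⊔ Subgroup.zpowers a := by
  simpa using extendedGroup_le_sup (a := a) (one_mem W)

theorem fixedSpace_inv (a : OrthGroup n) : fixedSpace a⁻¹ = fixedSpace a := by
  ext x
  rw [mem_fixedSpace, mem_fixedSpace, inv_apply_eq, eq_comm]

theorem IsSimpleSystem.isRotationGroup_extendedGroup [Finite ι] [Finite W]
    (hα : IsSimpleSystem W α) (hσ : ∀ i, a (α i) = α (σ i)) (ha : IsRotation a) :
    IsRotationGroup (extendedGroup W a) := by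
  constructor
  · have := finite_sup_zpowers (hα.mem_normalizer_of_perm hσ) (isOfFinOrder_of_perm hσ)
    exact Finite.of_injective _ (Subgroup.inclusion_injective extendedGroup_le_sup_zpowers)
  · refine ⟨{g | ∃ i j, i ≠ j ∧ g = reflect (α i) * reflect (α j)} ∪ {a}, ?_, ?_⟩
    · rintro g (⟨i, j, hij, rfl⟩ | rfl)
      · exact isRotation_reflect_mul_reflect hij
      · exact ha
    · rw [extendedGroup, hα.orientationPreserving_eq_closure, Subgroup.closure_union,
        Subgroup.closure_union, Subgroup.closure_eq]

end ExtendedGroup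

section ExtendingPerm

variable {E ι : Type*} [NormedAddCommGroup E] [InnerProductSpace ℝ E] {α : Module.Basis ι ℝ E}
  {W : Subgroup (E ≃ₗᵢ[ℝ] E)} {e : Fin 3 → E} {v : Fin 3 → ι} {σ : Equiv.Perm ι}

/-- The reflections in the three basis vectors `α (v 0)`, `α (v 1)` and `α (v 2)` are the standard
generators of the reflection group of type `D₃ = A₃` or `B₃` in the orthonormal coordinates `e`. -/
structure IsWeylFrame (α : Module.Basis ι ℝ E) (e : Fin 3 → E) (v : Fin 3 → ι) : Prop where
  orthonormal : Orthonormal ℝ e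
  reflect_zero : reflect (α (v 0)) = reflect (e 0 - e 1)
  reflect_one : reflect (α (v 1)) = reflect (e 1 - e 2)
  reflect_two : reflect (α (v 2)) = reflect (e 1 + e 2) ∨ reflect (α (v 2)) = reflect (e 2)

namespace IsWeylFrame

theorem preservesFrame_reflect (h : IsWeylFrame α e v) :
    ∀ m, PreservesFrame e (reflect (α (v m)))
  | 0 => h.reflect_zero ▸ preservesFrame_reflect_sub h.orthonormal 0 1
  | 1 => h.reflect_one ▸ preservesFrame_reflect_sub h.orthonormal 1 2
  | 2 => h.reflect_two.elim (· ▸ preservesFrame_reflect_add h.orthonormal 1 2)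
      (· ▸ ReflectionGroup.preservesFrame_reflect h.orthonormal 2)

theorem frameRotation_eq (h : IsWeylFrame α e v) :
    frameRotation e = reflect (α (v 0)) * reflect (α (v 1)) := by
  rw [frameRotation, h.reflect_zero, h.reflect_one]

end IsWeylFrame

/-- `σ` is an automorphism of the diagram of `α` with which the group generated by the reflections
in `α` can be extended. It acts on the basis as a rotation does, it is up to inversion the only
automorphism to do so, and it does not stabilise some subdiagram of type `A₃` or `B₃`. -/
structure IsExtendingPerm [Fintype ι] [DecidableEq ι] (α : Module.Basis ι ℝ E)
    (σ : Equiv.Perm ι) : Prop where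
  inner_eq : ∀ i j, ⟪α (σ i), α (σ j)⟫ = ⟪α i, α j⟫
  sign : Equiv.Perm.sign σ = 1
  shape : (∃ x y z, IsThreeCycleOn σ x y z) ∨ ∃ x x' y y', IsDoubleSwapOn σ x x' y y'
  order : σ ^ 2 = 1 ∨ σ ^ 3 = 1
  eq_of_inner_eq : ∀ τ : Equiv.Perm ι, (∀ i j, ⟪α (τ i), α (τ j)⟫ = ⟪α i, α j⟫) →
    τ = 1 ∨ τ = σ ∨ τ = σ⁻¹ ∨ ∃ x x', IsSwapOn τ x x'
  frame : ∃ e v, IsWeylFrame α e v ∧ ∃ m, σ (v m) ∉ Set.range v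

theorem zpow_eq_one_or_self_or_inv {G : Type*} [Group G] {g : G} (h : g ^ 2 = 1 ∨ g ^ 3 = 1)
    (t : ℤ) : g ^ t = 1 ∨ g ^ t = g ∨ g ^ t = g⁻¹ := by
  rcases h with h | h <;> rw [zpow_eq_zpow_emod' t h]
  · obtain ht | ht : t % 2 = 0 ∨ t % 2 = 1 := by omega
    · exact .inl (by simp [ht])
    · exact .inr (.inl (by simp [ht]))
  · obtain ht | ht | ht : t % 3 = 0 ∨ t % 3 = 1 ∨ t % 3 = 2 := by omega
    · exact .inl (by simp [ht])
    · exact .inr (.inl (by simp [ht]))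
    · refine .inr (.inr (eq_inv_of_mul_eq_one_left ?_))
      rw [← h]
      simp [ht, pow_succ]

theorem exists_mem_chamber_inner_eq_zero_iff [Finite ι] (α : Module.Basis ι ℝ E) (S : Set ι) :
    ∃ x ∈ chamber α, ∀ i, ⟪x, α i⟫ = 0 ↔ i ∈ S := by
  classical
  obtain ⟨x, hx⟩ := exists_inner_basis_eq α fun i => if i ∈ S then 0 else 1
  refine ⟨x, fun i => ?_, fun i => ?_⟩
  · rw [hx]
    positivity
  · rw [hx, ite_eq_left_iff]
    simp

theorem IsSimpleSystem.mem_closure_of_mem_sup [Finite ι] (hα : IsSimpleSystem W α)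
    {a g : E ≃ₗᵢ[ℝ] E} (hσ : ∀ i, a (α i) = α (σ i)) {x : E} (hx : x ∈ chamber α)
    (hstab : ∀ t : ℤ, (∀ i, ⟪x, α ((σ ^ t) i)⟫ = ⟪x, α i⟫) → σ ^ t = 1)
    (hg : g ∈ W ⊔ Subgroup.zpowers a) (hgx : g x = x) :
    g ∈ Subgroup.closure {r | ∃ i, ⟪x, α i⟫ = 0 ∧ r = reflect (α i)} := by
  obtain ⟨w, hw, t, rfl⟩ := exists_mul_zpow_of_mem_sup (hα.mem_normalizer_of_perm hσ) hg
  have hxt : (a ^ t) x ∈ chamber α := apply_mem_chamber_of_perm (zpow_apply_basis hσ t) hx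
  have hat : (a ^ t) x = x :=
    (hα.fixes_of_mem_chamber hw hxt (by rwa [← mul_apply, hgx])).1.symm.trans hgx
  have hone : a ^ t = 1 := eq_one_of_perm_eq_one (zpow_apply_basis hσ t) <| hstab t fun i => by
    rw [← zpow_apply_basis hσ, ← (a ^ t).inner_map_map x (α i), hat]
  rw [hone, mul_one] at hgx ⊢
  exact (hα.fixes_of_mem_chamber hw hx (by rwa [hgx])).2

namespace IsExtendingPerm

variable [Fintype ι] [DecidableEq ι]

theorem ne_one (h : IsExtendingPerm α σ) : σ ≠ 1 := by
  rintro rfl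
  obtain ⟨e, v, -, m, hm⟩ := h.frame
  exact hm ⟨m, rfl⟩

theorem eq_one_of_zpow_mapsTo (h : IsExtendingPerm α σ) {S : Set ι} {l : ι} (hl : l ∈ S)
    (hσl : σ l ∉ S) {t : ℤ} (hS : ∀ i, (σ ^ t) i ∈ S ↔ i ∈ S) : σ ^ t = 1 := by
  rcases zpow_eq_one_or_self_or_inv h.order t with ht | ht | ht
  · exact ht
  · exact absurd ((hS l).mpr hl) (by rwa [ht])
  · refine absurd ((hS (σ l)).mp ?_) hσl
    simpa [ht] using hl

theorem notMem (h : IsExtendingPerm α σ) (hα : IsSimpleSystem W α) {a : E ≃ₗᵢ[ℝ] E}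
    (hσ : ∀ i, a (α i) = α (σ i)) : a ∉ W := fun ha => h.ne_one <| by
  ext1 i
  refine α.injective ?_
  rw [← hσ, hα.eq_one_of_perm ha hσ, one_apply, Equiv.Perm.one_apply]

end IsExtendingPerm

end ExtendingPerm

section ExtendingRotation

variable {n : ℕ} {ι : Type*} {W W' : Subgroup (OrthGroup n)}
  {α : Module.Basis ι ℝ (EuclideanSpace ℝ (Fin n))} {σ : Equiv.Perm ι} {a : OrthGroup n}

theorem isRotation_of_shape [Finite ι] (hσ : ∀ i, a (α i) = α (σ i))
    (h : (∃ x y z, IsThreeCycleOn σ x y z) ∨ ∃ x x' y y', IsDoubleSwapOn σ x x' y y') :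
    IsRotation a := by
  rcases h with ⟨x, y, z, hcycle⟩ | ⟨x, x', y, y', hswap⟩
  · exact hcycle.isRotation hσ
  · exact hswap.isRotation hσ

theorem conj_mem_orientationPreserving {g r : OrthGroup n} (hr : r ∈ W)
    (hg : g ∈ orientationPreserving W) : r * g * r⁻¹ ∈ orientationPreserving W :=
  (Subgroup.mem_normalizer_iff.mp
    (normalizer_le_normalizer_orientationPreserving (Subgroup.le_normalizer hr)) g).mp hg

theorem IsSimpleSystem.exists_mem_roots_orthogonal_fixed [Finite ι] [Nontrivial ι]
    (hα : IsSimpleSystem W α) (hW' : IsReflectionGroup W') (hle : orientationPreserving W ≤ W')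
    {c : OrthGroup n} (hc : c ∈ W') (hc1 : c ≠ 1) : ∃ ρ ∈ roots W', ∀ x, c x = x → ⟪x, ρ⟫ = 0 := by
  have := hW'.1
  obtain ⟨κ, β, hβ⟩ := exists_isSimpleSystem (eq_closure_roots hW')
    (hα.span_roots_eq_top_of_le hW' hle)
  have := Module.Finite.finite_basis β
  obtain ⟨u, hu, i, hfix⟩ := hβ.exists_root_orthogonal_fixed hc hc1
  exact ⟨u (β i), apply_mem_roots_of_mem_normalizer (Subgroup.le_normalizer hu) (hβ.mem_roots i),
    hfix⟩

namespace IsExtendingPerm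

variable [Fintype ι] [DecidableEq ι]

theorem isometryDet_eq_one (h : IsExtendingPerm α σ) (hσ : ∀ i, a (α i) = α (σ i)) :
    isometryDet _ a = 1 := by
  rw [isometryDet_of_perm hσ, h.sign]
  norm_num

theorem zpow_eq_one_of_finrank (h : IsExtendingPerm α σ) (hσ : ∀ i, a (α i) = α (σ i)) {t : ℤ}
    (hrank : n ≤ Module.finrank ℝ (fixedSpace (a ^ t)) + 1) : a ^ t = 1 := by
  have hrot : Module.finrank ℝ (fixedSpace a) + 2 = n := isRotation_of_shape hσ h.shape
  have hext {b : OrthGroup n} {τ : Equiv.Perm ι} (hb : ∀ i, b (α i) = α (τ i)) (ht : σ ^ t = τ) :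
      a ^ t = b :=
    Module.Basis.ext_linearIsometryEquiv α fun i => by rw [zpow_apply_basis hσ, hb, ht]
  rcases zpow_eq_one_or_self_or_inv h.order t with ht | ht | ht
  · exact eq_one_of_perm_eq_one (zpow_apply_basis hσ t) ht
  · rw [hext hσ ht] at hrank
    omega
  · rw [hext (inv_apply_basis hσ) ht, fixedSpace_inv] at hrank
    omega

theorem preservesFrame_of_mem_sup (h : IsExtendingPerm α σ) (hα : IsSimpleSystem W α)
    (hσ : ∀ i, a (α i) = α (σ i)) {e : Fin 3 → EuclideanSpace ℝ (Fin n)} {v : Fin 3 → ι}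
    (hev : IsWeylFrame α e v) {m : Fin 3} (hm : σ (v m) ∉ Set.range v) {g : OrthGroup n}
    (hg : g ∈ W ⊔ Subgroup.zpowers a) (hfix : ∀ x, (∀ k, ⟪x, α (v k)⟫ = 0) → g x = x) :
    PreservesFrame e g := by
  obtain ⟨x, hx, hx0⟩ := exists_mem_chamber_inner_eq_zero_iff α (Set.range v)
  refine preservesFrame_of_mem_closure ?_ <| hα.mem_closure_of_mem_sup hσ hx (fun t ht => ?_) hg
    (hfix x fun k => (hx0 _).mpr ⟨k, rfl⟩)
  · rintro _ ⟨i, hi, rfl⟩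
    obtain ⟨k, rfl⟩ := (hx0 i).mp hi
    exact hev.preservesFrame_reflect k
  · exact h.eq_one_of_zpow_mapsTo (Set.mem_range_self m) hm fun i => by rw [← hx0, ← hx0, ht]

/-- Conjugating the frame rotation `c` by the third reflection of the frame, and then by the
reflection in a root `ρ` of `W'` orthogonal to the vectors fixed by `c`, gives an element of
`W'⁺ = ⟨W⁺, a⟩` which fixes the orthogonal complement of the frame, and hence preserves the frame.
This leaves few choices for `ρ`. -/
theorem exists_mem_roots_reflect_mem [Finite W] (h : IsExtendingPerm α σ) (hα : IsSimpleSystem W α)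
    (hσ : ∀ i, a (α i) = α (σ i)) (hW' : IsReflectionGroup W')
    (heq : extendedGroup W a = orientationPreserving W') : ∃ ρ ∈ roots W', reflect ρ ∈ W := by
  obtain ⟨e, v, hev, m, hm⟩ := h.frame
  have : Nontrivial ι := ⟨v m, σ (v m), fun h => hm ⟨m, h⟩⟩
  have hle : orientationPreserving W ≤ orientationPreserving W' :=
    heq ▸ orientationPreserving_le_extendedGroup
  have hc : frameRotation e ∈ orientationPreserving W :=
    hev.frameRotation_eq ▸ hα.reflect_mul_reflect_mem (v 0) (v 1)
  obtain ⟨ρ, hρ, hρc⟩ := hα.exists_mem_roots_orthogonal_fixed hW' (hle.trans inf_le_left)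
    (hle hc).1 (frameRotation_ne_one hev.orthonormal)
  obtain ⟨κ, hκ, hvκ⟩ : ∃ κ, (κ = e 1 + e 2 ∨ κ = e 2) ∧ reflect (α (v 2)) = reflect κ :=
    by rcases hev.reflect_two with h | h; exacts [⟨_, .inl rfl, h⟩, ⟨_, .inr rfl, h⟩]
  refine ⟨ρ, hρ, reflect_mem_of_preservesFrame hev.orthonormal
    (hev.reflect_zero ▸ hα.reflect_mem (v 0)) (hev.reflect_one ▸ hα.reflect_mem (v 1)) hκ hρ.1 hρc
    (h.preservesFrame_of_mem_sup hα hσ hev hm ?_ fun x hx => ?_)⟩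
  · have hmem := conj_mem_orientationPreserving hρ.2
      (hle (conj_mem_orientationPreserving (hα.reflect_mem (v 2)) hc))
    rw [← heq, hvκ] at hmem
    have hconj : reflect ρ * reflect κ * frameRotation e * (reflect ρ * reflect κ)⁻¹ =
        reflect ρ * (reflect κ * frameRotation e * (reflect κ)⁻¹) * (reflect ρ)⁻¹ := by
      simp only [mul_inv_rev, mul_assoc]
    rw [hconj]
    exact extendedGroup_le_sup_zpowers hmem
  · have hfix (k : Fin 3) : reflect (α (v k)) x = x := by
      rw [reflect_apply_eq_self_iff, real_inner_comm, hx]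
    have hcx : frameRotation e x = x := by
      rw [hev.frameRotation_eq, mul_apply, hfix, hfix]
    have hρκ : (reflect ρ * reflect κ) x = x := by
      rw [← hvκ, mul_apply, hfix, reflect_apply_eq_self_iff, real_inner_comm, hρc x hcx]
    rw [mul_apply, mul_apply, inv_apply_eq.mpr hρκ.symm, hcx, hρκ]

theorem not_orientationPreserving [Finite W] (h : IsExtendingPerm α σ) (hα : IsSimpleSystem W α)
    (hσ : ∀ i, a (α i) = α (σ i)) :
    ¬ ∃ W' : Subgroup (OrthGroup n), IsReflectionGroup W' ∧
      extendedGroup W a = orientationPreserving W' := by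
  rintro ⟨W', hW', heq⟩
  obtain ⟨ρ, hρ, hρW⟩ := h.exists_mem_roots_reflect_mem hα hσ hW' heq
  suffices hW'W : W' ≤ W from
    h.notMem hα hσ (hW'W (heq ▸ mem_extendedGroup : a ∈ orientationPreserving W').1)
  rw [eq_closure_roots hW', Subgroup.closure_le]
  rintro _ ⟨v, hv, rfl⟩
  have hv0 := ne_zero_of_norm_eq_one hv.1
  have hmem : reflect v * reflect ρ ∈ W ⊔ Subgroup.zpowers a :=
    extendedGroup_le_sup_zpowers <| heq ▸ reflect_mul_reflect_mem_orientationPreserving hv0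
      (ne_zero_of_norm_eq_one hρ.1) hv.2 hρ.2
  obtain ⟨w, hw, t, hwt⟩ := exists_mul_zpow_of_mem_sup (hα.mem_normalizer_of_perm hσ)
    ((Subgroup.mul_mem_cancel_right _ (Subgroup.mem_sup_left hρW)).mp hmem)
  have hrank := hα.finrank_fixedSpace_mul_le hw (zpow_apply_basis hσ t)
  rw [← hwt] at hrank
  have hone : a ^ t = 1 := h.zpow_eq_one_of_finrank hσ <|
    (isReflection_reflect hv0).ge.trans (Nat.add_le_add_right hrank 1)
  rw [SetLike.mem_coe, hwt, hone, mul_one]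
  exact hw

theorem isExtendingRotation [Finite W] (h : IsExtendingPerm α σ) (hα : IsSimpleSystem W α)
    (hσ : ∀ i, a (α i) = α (σ i)) : IsExtendingRotation W a where
  isRotation := isRotation_of_shape hσ h.shape
  mem_SO := h.isometryDet_eq_one hσ
  notMem := h.notMem hα hσ
  normalizes := Subgroup.mem_normalizer_iff.mp (hα.mem_normalizer_of_perm hσ)
  normalizes_orientationPreserving := Subgroup.mem_normalizer_iff.mp
    (normalizer_le_normalizer_orientationPreserving (hα.mem_normalizer_of_perm hσ))
  isRotationGroup := hα.isRotationGroup_extendedGroup hσ (isRotation_of_shape hσ h.shape)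
  not_orientationPreserving := h.not_orientationPreserving hα hσ

theorem extendedGroup_eq (h : IsExtendingPerm α σ) (hW : IsReflectionGroup W)
    (hα : IsSimpleSystem W α) (hσ : ∀ i, a (α i) = α (σ i)) {b : OrthGroup n}
    (hb : IsExtendingRotation W b) : extendedGroup W b = extendedGroup W a := by
  obtain ⟨w, hw, c, τ, hτ, rfl, hshape⟩ := IsExtendingRotation.exists_perm hW hα hb
  have hrot : IsRotation c := isRotation_of_shape hτ hshape
  have hext {c' : OrthGroup n} {τ' : Equiv.Perm ι} (hc' : ∀ i, c' (α i) = α (τ' i)) (h : τ = τ') :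
      c = c' := Module.Basis.ext_linearIsometryEquiv α fun i => by rw [hτ, hc', h]
  have hdet : isometryDet _ (w * c) = 1 := hb.mem_SO
  have hwpos (hc : isometryDet _ c = 1) : w ∈ orientationPreserving W :=
    mem_orientationPreserving.mpr ⟨hw, by rwa [map_mul, hc, mul_one] at hdet⟩
  rcases h.eq_of_inner_eq τ (fun i j => by rw [← hτ, ← hτ, c.inner_map_map]) with
    hone | hself | hinv | ⟨x, x', hswap⟩
  · exact absurd (by rwa [eq_one_of_perm_eq_one hτ hone, mul_one]) hb.notMem
  · obtain rfl := hext hσ hself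
    exact extendedGroup_mul_of_mem (hwpos (h.isometryDet_eq_one hσ))
  · obtain rfl := hext (inv_apply_basis hσ) hinv
    rw [extendedGroup_mul_of_mem (hwpos (by rw [map_inv, h.isometryDet_eq_one hσ, inv_one])),
      extendedGroup_inv]
  · have hrefl : IsReflection c := hswap.isReflection hτ
    unfold IsReflection at hrefl
    unfold IsRotation at hrot
    omega

theorem exists_and_existsUnique (h : IsExtendingPerm α σ) (hW : IsReflectionGroup W)
    (hα : IsSimpleSystem W α) : (∃ b, IsExtendingRotation W b) ∧
      ∃! G : Subgroup (OrthGroup n), ∃ b, IsExtendingRotation W b ∧ G = extendedGroup W b := by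
  have := hW.1
  obtain ⟨a, hσ⟩ := exists_isometry_of_inner_perm α σ h.inner_eq
  have ha := h.isExtendingRotation hα hσ
  refine ⟨⟨a, ha⟩, extendedGroup W a, ⟨a, ha, rfl⟩, ?_⟩
  rintro _ ⟨b, hb, rfl⟩
  exact h.extendedGroup_eq hW hα hσ hb

end IsExtendingPerm

end ExtendingRotation

/-! ### The diagrams of extendable type -/

section WeylFrame

variable {E ι : Type*} [NormedAddCommGroup E] [InnerProductSpace ℝ E] {α : Module.Basis ι ℝ E}

theorem exists_isWeylFrame_A₃ (hα : ∀ i, ‖α i‖ = 1) {i j k : ι} (hij : ⟪α i, α j⟫ = -(1 / 2))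
    (hjk : ⟪α j, α k⟫ = -(1 / 2)) (hik : ⟪α i, α k⟫ = 0) :
    ∃ e, IsWeylFrame α e ![j, i, k] := by
  obtain ⟨s, hs⟩ : ∃ s : ℝ, s * s = 2 := ⟨√2, Real.mul_self_sqrt (by norm_num)⟩
  have hs0 : s ≠ 0 := by rintro rfl; norm_num at hs
  have hself (l : ι) : ⟪α l, α l⟫ = 1 := inner_self_eq_one_of_norm_eq_one (hα l)
  have hji := (real_inner_comm (α i) (α j)).trans hij
  have hkj := (real_inner_comm (α j) (α k)).trans hjk
  have hki := (real_inner_comm (α i) (α k)).trans hik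
  refine ⟨![s • α j + (s / 2) • (α i + α k), (s / 2) • (α i + α k), (s / 2) • (α k - α i)],
    ?_, ?_, ?_, .inl ?_⟩
  · rw [orthonormal_iff_ite]
    intro a b
    fin_cases a <;> fin_cases b <;>
      simp [-inner_self_eq_norm_sq_to_K, inner_add_left, inner_add_right, inner_sub_left,
        inner_sub_right, real_inner_smul_left, real_inner_smul_right, hself, hij, hjk, hik, hji,
        hkj, hki] <;>
      linarith
  all_goals simp only [Matrix.cons_val]
  · rw [add_sub_cancel_right, reflect_smul hs0]
  · rw [← reflect_smul hs0 (α i)]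
    congr 1
    module
  · rw [← reflect_smul hs0 (α k)]
    congr 1
    module

theorem exists_isWeylFrame_B₃ (hα : ∀ i, ‖α i‖ = 1) {i j k : ι} (hij : ⟪α i, α j⟫ = -(1 / 2))
    (hjk : ⟪α j, α k⟫ = -(√2 / 2)) (hik : ⟪α i, α k⟫ = 0) :
    ∃ e, IsWeylFrame α e ![i, j, k] := by
  have hs : √2 * √2 = (2 : ℝ) := Real.mul_self_sqrt (by norm_num)
  generalize √2 = s at hs hjk
  have hs0 : s ≠ 0 := by rintro rfl; norm_num at hs
  have hself (l : ι) : ⟪α l, α l⟫ = 1 := inner_self_eq_one_of_norm_eq_one (hα l)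
  have hji := (real_inner_comm (α i) (α j)).trans hij
  have hkj := (real_inner_comm (α j) (α k)).trans hjk
  have hki := (real_inner_comm (α i) (α k)).trans hik
  refine ⟨![s • α i + (s • α j + α k), s • α j + α k, α k], ?_, ?_, ?_, .inr rfl⟩
  · rw [orthonormal_iff_ite]
    intro a b
    fin_cases a <;> fin_cases b <;>
      simp [-inner_self_eq_norm_sq_to_K, inner_add_left, inner_add_right, real_inner_smul_left,
        real_inner_smul_right, hself, hij, hjk, hik, hji, hkj, hki] <;>
      linarith
  all_goals simp only [Matrix.cons_val]
  · rw [add_sub_cancel_right, reflect_smul hs0]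
  · rw [add_sub_cancel_right, reflect_smul hs0]

end WeylFrame

theorem eq_of_cos_pi_div_eq {m m' : ℕ} (hm : m ≠ 0) (hm' : m' ≠ 0)
    (h : Real.cos (Real.pi / m) = Real.cos (Real.pi / m')) : m = m' := by
  have hmem {k : ℕ} (hk : k ≠ 0) : Real.pi / k ∈ Set.Icc 0 Real.pi :=
    ⟨by positivity, div_le_self Real.pi_pos.le (by exact_mod_cast Nat.one_le_iff_ne_zero.mpr hk)⟩
  have hdiv := Real.injOn_cos (hmem hm) (hmem hm') h
  rw [div_eq_mul_inv, div_eq_mul_inv, mul_right_inj' Real.pi_ne_zero, inv_inj] at hdiv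
  exact_mod_cast hdiv

namespace HasGram

variable {E ι : Type*} [NormedAddCommGroup E] [InnerProductSpace ℝ E] {M : CoxeterMatrix ι}

section Family

variable {α : ι → E} (h : HasGram α M)

include h

theorem inner_self (i : ι) : ⟪α i, α i⟫ = 1 := by
  rw [h, M.diagonal, Nat.cast_one, div_one, Real.cos_pi, neg_neg]

theorem norm_eq_one (i : ι) : ‖α i‖ = 1 := by
  rw [norm_eq_sqrt_real_inner, h.inner_self, Real.sqrt_one]

theorem inner_of_two {i j : ι} (hij : M i j = 2) : ⟪α i, α j⟫ = 0 :=
  (h i j).trans (eq_cos_of_two hij rfl).symm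

theorem inner_of_three {i j : ι} (hij : M i j = 3) : ⟪α i, α j⟫ = -(1 / 2) :=
  (h i j).trans (eq_cos_of_three hij rfl).symm

theorem inner_of_four {i j : ι} (hij : M i j = 4) : ⟪α i, α j⟫ = -(√2 / 2) :=
  (h i j).trans (eq_cos_of_four hij rfl).symm

theorem inner_perm_iff (hM : ∀ i j, M i j ≠ 0) {τ : Equiv.Perm ι} :
    (∀ i j, ⟪α (τ i), α (τ j)⟫ = ⟪α i, α j⟫) ↔ M.M.submatrix τ τ = M.M := by
  refine ⟨fun hτ => Matrix.ext fun i j => ?_, fun hτ i j => ?_⟩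
  · have hcos := hτ i j
    rw [h, h, neg_inj] at hcos
    exact eq_of_cos_pi_div_eq (hM _ _) (hM _ _) hcos
  · have hij : M (τ i) (τ j) = M i j := congrFun₂ hτ i j
    rw [h, h, hij]

theorem inner_nonpos (hM : ∀ i j, M i j ≠ 0) {i j : ι} (hij : i ≠ j) : ⟪α i, α j⟫ ≤ 0 := by
  have htwo : (2 : ℝ) ≤ M i j := by
    have hone := M.off_diagonal i j hij
    have hzero := hM i j
    exact_mod_cast (by omega : 2 ≤ M i j)
  rw [h, neg_nonpos]
  refine Real.cos_nonneg_of_mem_Icc ⟨?_, ?_⟩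
  · have := Real.pi_pos
    linarith [div_nonneg Real.pi_pos.le (Nat.cast_nonneg (α := ℝ) (M i j))]
  · exact div_le_div_of_nonneg_left Real.pi_pos.le two_pos htwo

end Family

section SimpleSystem

variable {α : Module.Basis ι ℝ E} {W : Subgroup (E ≃ₗᵢ[ℝ] E)}

theorem isSimpleSystem_of_le_three [Finite ι] (h : HasGram α M) (hM : ∀ i j, M i j ≠ 0)
    (hM3 : ∀ i j, M i j ≤ 3)
    (hW : W = Subgroup.closure (Set.range fun i => reflect (α i))) : IsSimpleSystem W α := by
  refine isSimpleSystem_of_isIntegralScaling h.norm_eq_one hW (fun i j => h.inner_nonpos hM)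
    fun l => ⟨fun _ => 1, rfl, fun _ => ⟨1, by norm_num⟩, fun i j => ?_⟩
  have hzero := hM i j
  obtain hij | hij | hij : M i j = 1 ∨ M i j = 2 ∨ M i j = 3 := by
    have := hM3 i j
    omega
  · obtain rfl : i = j := by_contra fun hne => M.off_diagonal i j hne hij
    exact ⟨2, by rw [h.inner_self]; norm_num⟩
  · exact ⟨0, by norm_num [h.inner_of_two hij]⟩
  · exact ⟨-1, by norm_num [h.inner_of_three hij]⟩

theorem inner_F₄ {α : Fin 4 → E} (h : HasGram α CoxeterMatrix.F₄) (i j : Fin 4) :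
    ⟪α i, α j⟫ = !![1, -(1 / 2), 0, 0; -(1 / 2), 1, -(√2 / 2), 0; 0, -(√2 / 2), 1, -(1 / 2);
      0, 0, -(1 / 2), 1] i j := by
  fin_cases i <;> fin_cases j <;> first
    | exact h.inner_self _
    | exact h.inner_of_two rfl
    | exact h.inner_of_three rfl
    | exact h.inner_of_four rfl

variable {α : Module.Basis (Fin 4) ℝ E} (h : HasGram α CoxeterMatrix.F₄)

include h

theorem isIntegralScaling_F₄ : IsIntegralScaling α ![1, 1, √2, √2] := by
  have hs : √2 * √2 = (2 : ℝ) := Real.mul_self_sqrt (by norm_num)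
  refine ⟨fun i => ⟨![1, 1, 2, 2] i, ?_⟩, fun i j =>
    ⟨!![2, -1, 0, 0; -1, 2, -1, 0; 0, -2, 2, -1; 0, 0, -1, 2] i j, ?_⟩⟩
  · fin_cases i <;> simp
  · rw [h.inner_F₄]
    fin_cases i <;> fin_cases j <;> simp <;> linarith

theorem isIntegralScaling_F₄_dual : IsIntegralScaling α ![√2, √2, 1, 1] := by
  have hs : √2 * √2 = (2 : ℝ) := Real.mul_self_sqrt (by norm_num)
  refine ⟨fun i => ⟨![2, 2, 1, 1] i, ?_⟩, fun i j =>
    ⟨!![2, -1, 0, 0; -1, 2, -2, 0; 0, -1, 2, -1; 0, 0, -1, 2] i j, ?_⟩⟩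
  · fin_cases i <;> simp
  · rw [h.inner_F₄]
    fin_cases i <;> fin_cases j <;> simp <;> linarith

theorem isSimpleSystem_F₄ (hW : W = Subgroup.closure (Set.range fun i => reflect (α i))) :
    IsSimpleSystem W α := by
  refine isSimpleSystem_of_isIntegralScaling h.norm_eq_one hW
    (fun i j => h.inner_nonpos fun i j => by fin_cases i <;> fin_cases j <;> decide) ?_
  intro l
  fin_cases l
  exacts [⟨_, rfl, h.isIntegralScaling_F₄⟩, ⟨_, rfl, h.isIntegralScaling_F₄⟩,
    ⟨_, rfl, h.isIntegralScaling_F₄_dual⟩, ⟨_, rfl, h.isIntegralScaling_F₄_dual⟩]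

end SimpleSystem

end HasGram

theorem isSwapOn_swap {ι : Type*} [DecidableEq ι] {x y : ι} (h : x ≠ y) :
    IsSwapOn (Equiv.swap x y) x y :=
  ⟨h, Equiv.swap_apply_left x y, Equiv.swap_apply_right x y,
    fun _ hx hy => Equiv.swap_apply_of_ne_of_ne hx hy⟩

theorem isDoubleSwapOn_swap_mul_swap {ι : Type*} [DecidableEq ι] {x x' y y' : ι}
    (hd : [x, x', y, y'].Nodup) :
    IsDoubleSwapOn (Equiv.swap x x' * Equiv.swap y y') x x' y y' := by
  simp only [List.nodup_cons, List.mem_cons, List.not_mem_nil, or_false, not_or, not_false_eq_true,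
    List.nodup_nil, and_true] at hd
  obtain ⟨⟨hxx', hxy, hxy'⟩, ⟨hx'y, hx'y'⟩, hyy'⟩ := hd
  refine ⟨hxx', hxy, hxy', hx'y, hx'y', hyy', ?_, ?_, ?_, ?_, fun i hix hix' hiy hiy' => ?_⟩ <;>
    rw [Equiv.Perm.mul_apply]
  · rw [Equiv.swap_apply_of_ne_of_ne hxy hxy', Equiv.swap_apply_left]
  · rw [Equiv.swap_apply_of_ne_of_ne hx'y hx'y', Equiv.swap_apply_right]
  · rw [Equiv.swap_apply_left, Equiv.swap_apply_of_ne_of_ne (Ne.symm hxy') (Ne.symm hx'y')]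
  · rw [Equiv.swap_apply_right, Equiv.swap_apply_of_ne_of_ne (Ne.symm hxy) (Ne.symm hx'y)]
  · rw [Equiv.swap_apply_of_ne_of_ne hiy hiy', Equiv.swap_apply_of_ne_of_ne hix hix']

section Automorphisms

theorem perm_eq_of_submatrix_A₄ : ∀ τ : Equiv.Perm (Fin 4),
    (CoxeterMatrix.A 4).M.submatrix τ τ = (CoxeterMatrix.A 4).M →
      τ = 1 ∨ τ = Equiv.swap 0 3 * Equiv.swap 1 2 := by
  decide +kernel

theorem perm_eq_of_submatrix_A₅ : ∀ τ : Equiv.Perm (Fin 5),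
    (CoxeterMatrix.A 5).M.submatrix τ τ = (CoxeterMatrix.A 5).M →
      τ = 1 ∨ τ = Equiv.swap 0 4 * Equiv.swap 1 3 := by
  decide +kernel

theorem perm_eq_of_submatrix_F₄ : ∀ τ : Equiv.Perm (Fin 4),
    CoxeterMatrix.F₄.M.submatrix τ τ = CoxeterMatrix.F₄.M →
      τ = 1 ∨ τ = Equiv.swap 0 3 * Equiv.swap 1 2 := by
  decide +kernel

theorem perm_eq_of_submatrix_D₄ : ∀ τ : Equiv.Perm (Fin 4),
    coxeterMatrixD4.M.submatrix τ τ = coxeterMatrixD4.M →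
      τ = 1 ∨ τ = Equiv.swap 0 2 * Equiv.swap 2 3 ∨ τ = (Equiv.swap 0 2 * Equiv.swap 2 3)⁻¹ ∨
        τ = Equiv.swap 0 2 ∨ τ = Equiv.swap 0 3 ∨ τ = Equiv.swap 2 3 := by
  decide +kernel

/-- The nodes `i` and `j` of the diagram of `M` are joined by a bond labelled three. As an ordinary
predicate, unlike the equation `M i j = 3`, it is decidable below several quantifiers. -/
def IsSimpleBond {ι : Type*} (M : CoxeterMatrix ι) (i j : ι) : Prop :=
  M i j = 3

instance {ι : Type*} (M : CoxeterMatrix ι) : DecidableRel (IsSimpleBond M) :=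
  fun i j => Nat.decEq (M i j) 3

theorem nodes_eq_of_isSimpleBond_E₆ : ∀ a c, IsSimpleBond CoxeterMatrix.E₆ a c → ∀ d, a ≠ d →
    IsSimpleBond CoxeterMatrix.E₆ c d → ∀ b, b ≠ c → IsSimpleBond CoxeterMatrix.E₆ d b →
    ∀ e, c ≠ e → b ≠ e → IsSimpleBond CoxeterMatrix.E₆ d e → ∀ f, d ≠ f →
    IsSimpleBond CoxeterMatrix.E₆ e f →
      ![a, b, c, d, e, f] = ![0, 1, 2, 3, 4, 5] ∨ ![a, b, c, d, e, f] = ![5, 1, 4, 3, 2, 0] := by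
  decide

theorem perm_eq_of_submatrix_E₆ (τ : Equiv.Perm (Fin 6))
    (hτ : CoxeterMatrix.E₆.M.submatrix τ τ = CoxeterMatrix.E₆.M) :
    τ = 1 ∨ τ = Equiv.swap 0 5 * Equiv.swap 2 4 := by
  have hbond {i j : Fin 6} (h : IsSimpleBond CoxeterMatrix.E₆ i j) :
      IsSimpleBond CoxeterMatrix.E₆ (τ i) (τ j) := (congrFun₂ hτ i j).trans h
  have hne {i j : Fin 6} (h : i ≠ j) : τ i ≠ τ j := τ.injective.ne h
  have h : _ ∨ _ := nodes_eq_of_isSimpleBond_E₆ (τ 0) (τ 2) (hbond rfl) (τ 3)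
    (hne (by decide)) (hbond rfl) (τ 1) (hne (by decide)) (hbond rfl) (τ 4) (hne (by decide))
    (hne (by decide)) (hbond rfl) (τ 5) (hne (by decide)) (hbond rfl)
  refine h.imp (fun h => ?_) fun h => ?_ <;> ext1 i <;> have hi := congrFun h i <;>
    fin_cases i <;> exact hi

end Automorphisms

namespace HasGram

variable {E : Type*} [NormedAddCommGroup E] [InnerProductSpace ℝ E]

theorem isExtendingPerm_of_swap_mul_swap {ι : Type*} [Fintype ι] [DecidableEq ι]
    {α : Module.Basis ι ℝ E} {M : CoxeterMatrix ι} (h : HasGram α M) (hM : ∀ i j, M i j ≠ 0)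
    {x x' y y' : ι} (hd : [x, x', y, y'].Nodup) {σ : Equiv.Perm ι}
    (hσ : σ = Equiv.swap x x' * Equiv.swap y y') (hσM : M.M.submatrix σ σ = M.M)
    (haut : ∀ τ : Equiv.Perm ι, M.M.submatrix τ τ = M.M → τ = 1 ∨ τ = σ) {e : Fin 3 → E}
    {v : Fin 3 → ι} (he : IsWeylFrame α e v) (hv : ∃ m, ∀ k, v k ≠ σ (v m)) :
    IsExtendingPerm α σ := by
  have hdisj : (Equiv.swap x x').Disjoint (Equiv.swap y y') :=
    Equiv.Perm.disjoint_swap_swap hd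
  have hdouble := isDoubleSwapOn_swap_mul_swap hd
  refine ⟨(h.inner_perm_iff hM).mpr hσM, ?_, .inr ⟨x, x', y, y', hσ ▸ hdouble⟩, .inl ?_,
    fun τ hτ => (haut τ ((h.inner_perm_iff hM).mp hτ)).imp_right .inl,
    ⟨e, v, he, hv.imp fun m hm => ?_⟩⟩
  · obtain ⟨hxx', -, -, -, -, hyy', -⟩ := hdouble
    rw [hσ, Equiv.Perm.sign_mul, Equiv.Perm.sign_swap hxx', Equiv.Perm.sign_swap hyy']
    rfl
  · rw [hσ, hdisj.commute.mul_pow, pow_two, pow_two, Equiv.swap_mul_self, Equiv.swap_mul_self,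
      one_mul]
  · rintro ⟨k, hk⟩
    exact hm k hk

theorem isExtendingPerm_A₄ {α : Module.Basis (Fin 4) ℝ E} (h : HasGram α (CoxeterMatrix.A 4)) :
    IsExtendingPerm α (Equiv.swap 0 3 * Equiv.swap 1 2) := by
  obtain ⟨e, he⟩ := exists_isWeylFrame_A₃ h.norm_eq_one (i := 0) (j := 1) (k := 2)
    (h.inner_of_three rfl) (h.inner_of_three rfl) (h.inner_of_two rfl)
  exact h.isExtendingPerm_of_swap_mul_swap (fun i j => by fin_cases i <;> fin_cases j <;> decide)
    (by decide) rfl (by decide) perm_eq_of_submatrix_A₄ he ⟨1, by decide⟩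

theorem isExtendingPerm_A₅ {α : Module.Basis (Fin 5) ℝ E} (h : HasGram α (CoxeterMatrix.A 5)) :
    IsExtendingPerm α (Equiv.swap 0 4 * Equiv.swap 1 3) := by
  obtain ⟨e, he⟩ := exists_isWeylFrame_A₃ h.norm_eq_one (i := 0) (j := 1) (k := 2)
    (h.inner_of_three rfl) (h.inner_of_three rfl) (h.inner_of_two rfl)
  exact h.isExtendingPerm_of_swap_mul_swap (fun i j => by fin_cases i <;> fin_cases j <;> decide)
    (by decide) rfl (by decide) perm_eq_of_submatrix_A₅ he ⟨1, by decide⟩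

theorem isExtendingPerm_E₆ {α : Module.Basis (Fin 6) ℝ E} (h : HasGram α CoxeterMatrix.E₆) :
    IsExtendingPerm α (Equiv.swap 0 5 * Equiv.swap 2 4) := by
  obtain ⟨e, he⟩ := exists_isWeylFrame_A₃ h.norm_eq_one (i := 0) (j := 2) (k := 3)
    (h.inner_of_three rfl) (h.inner_of_three rfl) (h.inner_of_two rfl)
  exact h.isExtendingPerm_of_swap_mul_swap (fun i j => by fin_cases i <;> fin_cases j <;> decide)
    (by decide) rfl (by decide) perm_eq_of_submatrix_E₆ he ⟨1, by decide⟩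

theorem isExtendingPerm_F₄ {α : Module.Basis (Fin 4) ℝ E} (h : HasGram α CoxeterMatrix.F₄) :
    IsExtendingPerm α (Equiv.swap 0 3 * Equiv.swap 1 2) := by
  obtain ⟨e, he⟩ := exists_isWeylFrame_B₃ h.norm_eq_one (i := 0) (j := 1) (k := 2)
    (h.inner_of_three rfl) (h.inner_of_four rfl) (h.inner_of_two rfl)
  exact h.isExtendingPerm_of_swap_mul_swap (fun i j => by fin_cases i <;> fin_cases j <;> decide)
    (by decide) rfl (by decide) perm_eq_of_submatrix_F₄ he ⟨0, by decide⟩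

theorem isExtendingPerm_D₄ {α : Module.Basis (Fin 4) ℝ E} (h : HasGram α coxeterMatrixD4) :
    IsExtendingPerm α (Equiv.swap 0 2 * Equiv.swap 2 3) := by
  have hM : ∀ i j, coxeterMatrixD4 i j ≠ 0 := fun i j => by
    fin_cases i <;> fin_cases j <;> decide
  obtain ⟨e, he⟩ := exists_isWeylFrame_A₃ h.norm_eq_one (i := 0) (j := 1) (k := 2)
    (h.inner_of_three rfl) (h.inner_of_three rfl) (h.inner_of_two rfl)
  refine ⟨(h.inner_perm_iff hM).mpr (by decide), by decide,
    .inl ⟨0, 2, 3, by unfold IsThreeCycleOn; decide⟩, .inr (by decide), fun τ hτ => ?_,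
    ⟨e, _, he, 2, by rintro ⟨k, hk⟩; revert k; decide⟩⟩
  rcases perm_eq_of_submatrix_D₄ τ ((h.inner_perm_iff hM).mp hτ) with
    hone | hself | hinv | rfl | rfl | rfl
  · exact .inl hone
  · exact .inr (.inl hself)
  · exact .inr (.inr (.inl hinv))
  all_goals exact .inr (.inr (.inr ⟨_, _, isSwapOn_swap (by decide)⟩))

end HasGram

theorem exists_and_existsUnique_of_hasExtendableType {n : ℕ} {W : Subgroup (OrthGroup n)}
    (hW : IsReflectionGroup W) (h : HasExtendableType W) : (∃ b, IsExtendingRotation W b) ∧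
      ∃! G : Subgroup (OrthGroup n), ∃ b, IsExtendingRotation W b ∧ G = extendedGroup W b := by
  rcases h with ⟨α, hα, hc⟩ | ⟨α, hα, hc⟩ | ⟨α, hα, hc⟩ | ⟨α, hα, hc⟩ | ⟨α, hα, hc⟩
  · exact (HasGram.isExtendingPerm_A₄ hα).exists_and_existsUnique hW <|
      HasGram.isSimpleSystem_of_le_three hα
        (fun i j => by fin_cases i <;> fin_cases j <;> decide)
        (fun i j => by fin_cases i <;> fin_cases j <;> decide) hc
  · exact (HasGram.isExtendingPerm_D₄ hα).exists_and_existsUnique hW <|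
      HasGram.isSimpleSystem_of_le_three hα
        (fun i j => by fin_cases i <;> fin_cases j <;> decide)
        (fun i j => by fin_cases i <;> fin_cases j <;> decide) hc
  · exact (HasGram.isExtendingPerm_F₄ hα).exists_and_existsUnique hW
      (HasGram.isSimpleSystem_F₄ hα hc)
  · exact (HasGram.isExtendingPerm_A₅ hα).exists_and_existsUnique hW <|
      HasGram.isSimpleSystem_of_le_three hα
        (fun i j => by fin_cases i <;> fin_cases j <;> decide)
        (fun i j => by fin_cases i <;> fin_cases j <;> decide) hc
  · exact (HasGram.isExtendingPerm_E₆ hα).exists_and_existsUnique hW <|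
      HasGram.isSimpleSystem_of_le_three hα
        (fun i j => by fin_cases i <;> fin_cases j <;> decide)
        (fun i j => by fin_cases i <;> fin_cases j <;> decide) hc

end ReflectionGroup

theorem lemma4p3 {n : ℕ} (W : Subgroup (OrthGroup n)) (hW : IsReflectionGroup W)
    (hirr : ActsIrreducibly W) :
    ((∃ h : OrthGroup n, IsExtendingRotation W h) ↔ HasExtendableType W) ∧
    (HasExtendableType W →
      ∃! G : Subgroup (OrthGroup n), ∃ h : OrthGroup n,
        IsExtendingRotation W h ∧ G = extendedGroup W h) :=
  ⟨⟨fun ⟨_, hh⟩ => ReflectionGroup.hasExtendableType_of_isExtendingRotation hW hirr hh,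
    fun h => (ReflectionGroup.exists_and_existsUnique_of_hasExtendableType hW h).1⟩,
    fun h => (ReflectionGroup.exists_and_existsUnique_of_hasExtendableType hW h).2⟩
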